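/- **Proposition 1.3.** Let $X$ be a random vector in $\mathbb{R}^d$ and $Y$ a random variable with values in $\{-1,1\}$ such that, for some $\theta^*\in\mathbb{R}^d$, $$\mathbb{P}[Y=1\mid X]=\frac{1}{1+e^{-\langle X,\theta^*\rangle}}\quad\text{a.s.}$$ Assume that $|X|\le R$ a.s. for some $R>0$ and that the law of $X$ is elliptic: $\operatorname{Var}(\langle X,e\rangle)>0$ for every unit vector $e\in\mathbb{R}^d$. Let $$f(\theta)=\mathbb{E}\left[\log\left(1+e^{-Y\langle X,\theta\rangle}\right)\right],\qquad \theta\in\mathbb{R}^d .$$ (i) The function $f$ is convex and of class $\mathcal{C}^2$ with $D^2f$ bounded and Lipschitz on $\mathbb{R}^d$, and $D^2f(\theta^*)$ is invertible. Moreover $f(\theta)\to+\infty$ as $|\theta|\to+\infty$, $\{\theta:\nabla f(\theta)=0\}=\{\theta^*\}$, and $f$ satisfies $(\mathbf{H}^r_{\rm KL})$ with $r=0$. Here, for $r\in[0,1/2]$, $(\mathbf{H}^r_{\rm KL})$ means that $f$ is $\mathcal{C}^2$ with $D^2f$ bounded and Lipschitz, that $D^2f(\theta^*)$ is invertible, and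 that $$\liminf_{|\theta|\to\infty}(f(\theta)-f(\theta^*))^{-r}|\nabla f(\theta)|>0,\qquad \limsup_{|\theta|\to\infty}(f(\theta)-f(\theta^*))^{-r}|\nabla f(\theta)|<+\infty .$$ (ii) Let $(X_n,Y_n)_{n\ge 0}$ be i.i.d. copies of $(X,Y)$, let $\gamma>0$, $\theta_0\in\mathbb{R}^d$ and $\gamma_n=\gamma n^{-3/4}$ for $n\ge1$, and define $$\theta_{n+1}=\theta_n+\gamma_{n+1}\frac{Y_nX_n}{1+e^{Y_n\langle\theta_n,X_n\rangle}}\quad(n\ge0),\qquad \hat\theta_n=\frac1n\sum_{k=1}^n\theta_k\quad(n\ge1).$$ Let $S^*=\mathbb{E}[\Delta M\,\Delta M^T]$ with $\Delta M=\nabla f(\theta^*)+\dfrac{YX}{1+e^{Y\langle\theta^*,X\rangle}}$, and $\Sigma^*=\{D^2f(\theta^*)\}^{-1}S^*\{D^2f(\theta^*)\}^{-1}$. Then there exists $C>0$ such that, for all $n\ge1$, $|\hat\theta_n-\theta^*|^2$ is integrable and $$\mathbb{E}\,|\hat\theta_n-\theta^*|^2\le\frac{\operatorname{Tr}(\Sigma^*)}{n}+C\,n^{-5/4}.$$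 -/

import Mathlib

open MeasureTheory ProbabilityTheory Filter Topology

noncomputable section

namespace LogisticSGD

/-- The Hessian matrix of `f` at `θ`, with entries `∂ᵢ∂ⱼ f (θ)`. -/
def hessian {d : ℕ} (f : EuclideanSpace ℝ (Fin d) → ℝ) (θ : EuclideanSpace ℝ (Fin d)) :
    Matrix (Fin d) (Fin d) ℝ :=
  Matrix.of fun i j =>
    fderiv ℝ (fderiv ℝ f) θ (EuclideanSpace.single i (1 : ℝ)) (EuclideanSpace.single j (1 : ℝ))

/-- The global Kurdyka-Lojasiewicz assumption of exponent `r ∈ [0, 1/2]` for a function `f` with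
minimizer `θs`. The function is not normalized to vanish at `θs`, so the factor `f ^ (-r)` is
written for `f - f θs`. The limits are taken in `[0, ∞]` as `|x| → ∞`. -/
structure GlobalKL {d : ℕ} (r : ℝ) (f : EuclideanSpace ℝ (Fin d) → ℝ)
    (θs : EuclideanSpace ℝ (Fin d)) : Prop where
  exponent_mem : r ∈ Set.Icc (0 : ℝ) (1 / 2)
  contDiff : ContDiff ℝ 2 f
  hessian_bounded : ∃ B : ℝ, ∀ x, ‖fderiv ℝ (fderiv ℝ f) x‖ ≤ B
  hessian_lipschitz : ∃ K : NNReal, LipschitzWith K (fderiv ℝ (fderiv ℝ f))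
  hessian_invertible : IsUnit (hessian f θs)
  liminf_pos :
    0 < liminf (fun x => ENNReal.ofReal ((f x - f θs) ^ (-r) * ‖gradient f x‖))
      (Bornology.cobounded (EuclideanSpace ℝ (Fin d)))
  limsup_lt_top :
    limsup (fun x => ENNReal.ofReal ((f x - f θs) ^ (-r) * ‖gradient f x‖))
      (Bornology.cobounded (EuclideanSpace ℝ (Fin d))) < ⊤

/-- The logistic loss `f θ = 𝔼[log (1 + exp (- Y ⟨X, θ⟩))]`. -/
def logisticRisk {d : ℕ} {Ω : Type*} [MeasurableSpace Ω] (P : Measure Ω)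
    (X : Ω → EuclideanSpace ℝ (Fin d)) (Y : Ω → ℝ) (θ : EuclideanSpace ℝ (Fin d)) : ℝ :=
  ∫ ω, Real.log (1 + Real.exp (-(Y ω * inner ℝ (X ω) θ))) ∂P

/-- The response `Y` takes its values in `{-1, 1}` and follows the logistic model with parameter
`θs`: `P[Y = 1 | X] = 1 / (1 + exp (- ⟨X, θs⟩))`. -/
structure IsLogisticModel {d : ℕ} {Ω : Type*} [MeasurableSpace Ω] (P : Measure Ω)
    (X : Ω → EuclideanSpace ℝ (Fin d)) (Y : Ω → ℝ) (θs : EuclideanSpace ℝ (Fin d)) : Prop where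
  values : ∀ᵐ ω ∂P, Y ω = 1 ∨ Y ω = -1
  condProb :
    P[(Y ⁻¹' {1}).indicator (fun _ => (1 : ℝ)) | MeasurableSpace.comap X inferInstance]
      =ᵐ[P] fun ω => 1 / (1 + Real.exp (-(inner ℝ (X ω) θs)))

/-- The stochastic descent direction `y x / (1 + exp (y ⟨θ, x⟩))` at `θ` for the observation
`(x, y)`; it is minus the gradient in `θ` of `log (1 + exp (- y ⟨x, θ⟩))`. -/
def descentDir {d : ℕ} (θ x : EuclideanSpace ℝ (Fin d)) (y : ℝ) : EuclideanSpace ℝ (Fin d) :=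
  (y / (1 + Real.exp (y * inner ℝ θ x))) • x

/-- The stochastic gradient descent
`θ (n + 1) = θ n + γ (n + 1) * y n x n / (1 + exp (y n ⟨θ n, x n⟩))` started from `θ₀`. -/
def sgd {d : ℕ} (γ : ℕ → ℝ) (θ₀ : EuclideanSpace ℝ (Fin d))
    (x : ℕ → EuclideanSpace ℝ (Fin d)) (y : ℕ → ℝ) : ℕ → EuclideanSpace ℝ (Fin d)
  | 0 => θ₀
  | n + 1 => sgd γ θ₀ x y n + γ (n + 1) • descentDir (sgd γ θ₀ x y n) (x n) (y n)

/-- The Cesaro average `(1 / n) ∑_{k = 1}^{n} θ k`. -/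
def average {d : ℕ} (θ : ℕ → EuclideanSpace ℝ (Fin d)) (n : ℕ) : EuclideanSpace ℝ (Fin d) :=
  (1 / (n : ℝ)) • ∑ k ∈ Finset.Icc 1 n, θ k

/-- The martingale increment at `θ` for the observation `(x, y)`: the random vector `ΔM` such that
`descentDir θ x y = - ∇ f θ + ΔM`, where `f` is the risk. -/
def noise {d : ℕ} (f : EuclideanSpace ℝ (Fin d) → ℝ) (θ x : EuclideanSpace ℝ (Fin d)) (y : ℝ) :
    EuclideanSpace ℝ (Fin d) :=
  gradient f θ + descentDir θ x y

/-- The covariance matrix `S θ = 𝔼[ΔM ΔMᵀ]` of the martingale increment at `θ`. -/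
def noiseCov {d : ℕ} {Ω : Type*} [MeasurableSpace Ω] (P : Measure Ω)
    (X : Ω → EuclideanSpace ℝ (Fin d)) (Y : Ω → ℝ) (θ : EuclideanSpace ℝ (Fin d)) :
    Matrix (Fin d) (Fin d) ℝ :=
  Matrix.of fun i j =>
    ∫ ω, noise (logisticRisk P X Y) θ (X ω) (Y ω) i *
      noise (logisticRisk P X Y) θ (X ω) (Y ω) j ∂P

/-- The limiting covariance `Σ* = {D² f (θs)}⁻¹ S (θs) {D² f (θs)}⁻¹`. -/
def limitCov {d : ℕ} {Ω : Type*} [MeasurableSpace Ω] (P : Measure Ω)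
    (X : Ω → EuclideanSpace ℝ (Fin d)) (Y : Ω → ℝ) (θs : EuclideanSpace ℝ (Fin d)) :
    Matrix (Fin d) (Fin d) ℝ :=
  (hessian (logisticRisk P X Y) θs)⁻¹ * noiseCov P X Y θs * (hessian (logisticRisk P X Y) θs)⁻¹

end LogisticSGD

end

noncomputable section
namespace LogisticSGD

/-! ### Powers and recursive inequalities -/

/-! For (i), put `Z = Y • X`, which is bounded by `R`. The risk is an integral of a ridge function
`φ ⟪Z, θ⟫`, and so are its derivatives. The first three derivatives of `φ t = log (1 + exp (-t))`
are bounded by 1, which gives the regularity. The logistic model enters through a single identity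
(`inner_gradient_risk_eq`): `⟪∇f θ, v⟫ = 𝔼[⟪X, v⟫ (σ ⟪X, θ⟫ - σ ⟪X, θs⟫)]`, with `σ` the sigmoid.
Monotonicity of `σ` and ellipticity of `X` turn it into the drift inequality `⟪∇f (θs + D), D⟫ ≥ c
‖D‖² / (1 + R ‖D‖)` (`exists_drift`). From this follow the uniqueness of the critical point, the
lower bound on `‖∇f‖` at infinity and, with convexity, the divergence of `f`.

For (ii), write `D n = θ n - θs`. The drift grows only linearly in `‖D‖`, so `‖D‖²` is not
contracted far from `θs`. The function `exp (√(1 + ‖D‖²) - 1) - 1` is contracted everywhere, because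
its logarithmic derivative makes up for the missing factor. Its square satisfies `v (n + 1) ≤ (1 - a
γₙ) v n + C γₙ³`, whence `𝔼 ‖D n‖⁴ = O(γₙ²)` (`exists_fourth_moment_le`).

Let `H` be the Hessian at `θs`, `A` its inverse, `ξ` the martingale increments and `r` the
linearization errors, with `‖r‖ ≤ K ‖D‖²`. Solving one step for `H (D k)` and summing by parts gives
`∑ D k = A M + F + N` (`sum_error_eq`), where `M` is the martingale, `F` collects the increments of
`1 / γ` and the boundary term, and `N` collects `r`, the initial condition and the last error.
Orthogonality of the `ξ` gives `𝔼 ‖A M‖² = n Tr Σ* + O(n^(5/8))` from above, while `𝔼 ‖F‖² =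
O(n^(3/4))` and `𝔼 ‖N‖² = O(n^(1/2))`.

The product `A M · N` is of order `n^(3/4)` by Cauchy-Schwarz, but for `A M · F` this would only
give `n^(7/8)`. The decisive point is that the correlations `𝔼[M n ⊗ D k]`, `k ≤ n`, are bounded
(`exists_norm_correlation_le`, `exists_abs_integral_inner_le`): they do not change in `n` beyond
`k`, and on the diagonal they satisfy a contracting recursion. So `𝔼 ⟪A M, F⟫ = O(n^(3/4))`, and
division by `n²` gives the rate `n^(-5/4)`. -/

theorem add_rpow_le {x t q : ℝ} (hx : 0 < x) (ht : 0 ≤ x + t) (hq : 0 ≤ q) (hq1 : q ≤ 1) :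
    (x + t) ^ q ≤ x ^ q + q * t * x ^ (q - 1) := by
  have h1 : -1 ≤ t / x := by
    rw [le_div_iff₀ hx]; linarith
  have h2 : x + t = x * (1 + t / x) := by field_simp
  rw [h2, Real.mul_rpow hx.le (by linarith), Real.rpow_sub_one hx.ne']
  calc x ^ q * (1 + t / x) ^ q ≤ x ^ q * (1 + q * (t / x)) := by
        gcongr
        exact rpow_one_add_le_one_add_mul_self h1 hq hq1
    _ = x ^ q + q * t * (x ^ q / x) := by field_simp

theorem sum_rpow_le {q : ℝ} (hq : 0 < q) (hq1 : q ≤ 1) (n : ℕ) :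
    ∑ k ∈ Finset.range n, ((k : ℝ) + 1) ^ (q - 1) ≤ (n : ℝ) ^ q / q := by
  induction n with
  | zero => simp [Real.zero_rpow hq.ne']
  | succ n ih =>
    rw [Finset.sum_range_succ]
    -- The tangent at `n + 1` is followed backwards to `n`, so that concavity bounds the new term by
    -- a difference of powers.
    have h := add_rpow_le (x := (n : ℝ) + 1) (t := -1) (q := q) (by positivity) (by simp) hq.le hq1
    have h2 : (n : ℝ) + 1 + -1 = n := by ring
    rw [h2] at h
    have h3 : (n : ℝ) ^ q / q ≤ (((n : ℝ) + 1) ^ q - q * ((n : ℝ) + 1) ^ (q - 1)) / q := by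
      gcongr
      linarith
    have h4 : (((n : ℝ) + 1) ^ q - q * ((n : ℝ) + 1) ^ (q - 1)) / q
        = ((n : ℝ) + 1) ^ q / q - ((n : ℝ) + 1) ^ (q - 1) := by field_simp
    push_cast
    linarith

/-- The step size profile `(n + 1) ^ (- 3 / 4)`. -/
def stepProfile (n : ℕ) : ℝ := ((n : ℝ) + 1) ^ (-(3 / 4) : ℝ)

theorem stepProfile_pos (n : ℕ) : 0 < stepProfile n := by
  unfold stepProfile; positivity

theorem stepProfile_le_one (n : ℕ) : stepProfile n ≤ 1 := by
  unfold stepProfile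
  exact Real.rpow_le_one_of_one_le_of_nonpos (by simp) (by norm_num)

theorem tendsto_stepProfile : Tendsto stepProfile atTop (𝓝 0) := by
  unfold stepProfile
  exact (tendsto_rpow_neg_atTop (by norm_num : (0 : ℝ) < 3 / 4)).comp
    (tendsto_atTop_add_const_right _ _ tendsto_natCast_atTop_atTop)

theorem eventually_inv_le_stepProfile {c : ℝ} (hc : 0 < c) :
    ∀ᶠ n : ℕ in atTop, 1 / ((n : ℝ) + 1) ≤ c * stepProfile n := by
  have h : Tendsto (fun n : ℕ => ((n : ℝ) + 1) ^ (-(1 / 4) : ℝ)) atTop (𝓝 0) :=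
    (tendsto_rpow_neg_atTop (by norm_num : (0 : ℝ) < 1 / 4)).comp
    (tendsto_atTop_add_const_right _ _ tendsto_natCast_atTop_atTop)
  filter_upwards [h.eventually_lt_const hc] with n hn
  have hp : (0 : ℝ) < (n : ℝ) + 1 := by positivity
  have h1 : 1 / ((n : ℝ) + 1) = ((n : ℝ) + 1) ^ (-(1 / 4) : ℝ) * stepProfile n := by
    rw [stepProfile, ← Real.rpow_add hp, one_div, ← Real.rpow_neg_one]
    norm_num
  rw [h1]
  have := stepProfile_pos n
  gcongr

/-- The squared step loses a relative amount `3 / 2 / (n + 2)` at most, by Bernoulli's inequality,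
and `1 / n` is negligible compared with `n ^ (-3 / 4)`. The steps thus decay more slowly than any
contraction `1 - a γₙ`. -/
theorem eventually_stepProfile_succ_sq {a : ℝ} (ha : 0 < a) :
    ∀ᶠ n : ℕ in atTop,
      stepProfile n ^ 2 * (1 - a * stepProfile n) ≤ stepProfile (n + 1) ^ 2 := by
  filter_upwards [eventually_inv_le_stepProfile (c := a / (3 / 2)) (by positivity)] with n hn
  have hp : (0 : ℝ) < (n : ℝ) + 1 := by positivity
  have hp2 : (0 : ℝ) < (n : ℝ) + 2 := by positivity
  have e1 : ∀ m : ℕ, stepProfile m ^ 2 = (((m : ℝ) + 1) ^ (3 / 2 : ℝ))⁻¹ := fun m => by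
    rw [stepProfile, ← Real.rpow_natCast, ← Real.rpow_mul (by positivity),
      ← Real.rpow_neg (by positivity)]
    norm_num
  have hB : 1 + (3 / 2 : ℝ) * (-1 / ((n : ℝ) + 2)) ≤ (1 + -1 / ((n : ℝ) + 2)) ^ (3 / 2 : ℝ) := by
    apply one_add_mul_self_le_rpow_one_add _ (by norm_num)
    rw [le_div_iff₀ hp2]; linarith
  have e2 : 1 + -1 / ((n : ℝ) + 2) = ((n : ℝ) + 1) / ((n : ℝ) + 2) := by field_simp; ring
  rw [e2, Real.div_rpow hp.le hp2.le] at hB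
  have e3 : stepProfile (n + 1) ^ 2
      = stepProfile n ^ 2 * (((n : ℝ) + 1) ^ (3 / 2 : ℝ) / ((n : ℝ) + 2) ^ (3 / 2 : ℝ)) := by
    rw [e1, e1]
    have : (((n + 1 : ℕ) : ℝ) + 1) = (n : ℝ) + 2 := by push_cast; ring
    rw [this]
    have : (0 : ℝ) < ((n : ℝ) + 1) ^ (3 / 2 : ℝ) := by positivity
    field_simp
  rw [e3]
  gcongr
  refine le_trans ?_ hB
  have h5 : 1 / ((n : ℝ) + 2) ≤ 1 / ((n : ℝ) + 1) := by gcongr; linarith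
  have h6 : -1 / ((n : ℝ) + 2) = -(1 / ((n : ℝ) + 2)) := by ring
  rw [h6]
  have : a / (3 / 2) * stepProfile n = (2 / 3) * (a * stepProfile n) := by ring
  linarith

theorem exists_bound_le (v : ℕ → ℝ) (N : ℕ) : ∃ K : ℝ, 0 < K ∧ ∀ n ≤ N, v n ≤ K := by
  obtain ⟨M, hM⟩ := Finset.exists_le ((Finset.range (N + 1)).image v)
  refine ⟨max M 1, by positivity, fun n hn => ?_⟩
  exact (hM _ (Finset.mem_image_of_mem v (by simp; omega))).trans (le_max_left _ _)

/-- Half of the contraction absorbs the noise `C γₙ³`, which requires `K ≥ 2 C / a`; the other half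
pays for the decrease of `γₙ²`. The finitely many terms before the recursion starts are absorbed in
`K`. -/
theorem le_of_eventually_recursion_sq {v : ℕ → ℝ} {a C : ℝ} (ha : 0 < a)
    (h : ∀ᶠ n in atTop,
      v (n + 1) ≤ (1 - a * stepProfile n) * v n + C * stepProfile n ^ 3) :
    ∃ K : ℝ, 0 < K ∧ ∀ n, v n ≤ K * stepProfile n ^ 2 := by
  have h1 : ∀ᶠ n in atTop, a * stepProfile n ≤ 1 := by
    have := tendsto_stepProfile.const_mul a
    rw [mul_zero] at this
    exact (this.eventually_lt_const one_pos).mono fun n hn => hn.le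
  obtain ⟨N, hN⟩ := eventually_atTop.1
    (h.and (h1.and (eventually_stepProfile_succ_sq (half_pos ha))))
  obtain ⟨K₀, hK₀, hK₀'⟩ := exists_bound_le (fun n => v n / stepProfile n ^ 2) N
  set K := max K₀ (2 * C / a) with hK
  have hKpos : 0 < K := lt_of_lt_of_le hK₀ (le_max_left _ _)
  refine ⟨K, hKpos, fun n => ?_⟩
  have hinit : ∀ n ≤ N, v n ≤ K * stepProfile n ^ 2 := fun n hn => by
    have := (hK₀' n hn).trans (le_max_left K₀ (2 * C / a))
    rwa [div_le_iff₀ (pow_pos (stepProfile_pos n) 2)] at this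
  rcases le_total n N with hn | hn
  · exact hinit n hn
  · induction n, hn using Nat.le_induction with
    | base => exact hinit N le_rfl
    | succ n hn ih =>
      obtain ⟨r1, r2, r3⟩ := hN n hn
      have hx := stepProfile_pos n
      have hC : C ≤ K * a / 2 := by
        have : 2 * C / a ≤ K := le_max_right _ _
        rw [div_le_iff₀ ha] at this
        linarith
      calc v (n + 1) ≤ (1 - a * stepProfile n) * v n + C * stepProfile n ^ 3 := r1
        _ ≤ (1 - a * stepProfile n) * (K * stepProfile n ^ 2)
            + (K * a / 2) * stepProfile n ^ 3 := by
          gcongr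
        _ = K * (stepProfile n ^ 2 * (1 - a / 2 * stepProfile n)) := by ring
        _ ≤ K * stepProfile (n + 1) ^ 2 := by gcongr

theorem le_of_eventually_recursion {v : ℕ → ℝ} {a C : ℝ} (ha : 0 < a)
    (h : ∀ᶠ n in atTop, v (n + 1) ≤ (1 - a * stepProfile n) * v n + C * stepProfile n) :
    ∃ K : ℝ, 0 < K ∧ ∀ n, v n ≤ K := by
  have h1 : ∀ᶠ n in atTop, a * stepProfile n ≤ 1 := by
    have := tendsto_stepProfile.const_mul a
    rw [mul_zero] at this
    exact (this.eventually_lt_const one_pos).mono fun n hn => hn.le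
  obtain ⟨N, hN⟩ := eventually_atTop.1 (h.and h1)
  obtain ⟨K₀, hK₀, hK₀'⟩ := exists_bound_le v N
  set K := max K₀ (C / a) with hK
  have hKpos : 0 < K := lt_of_lt_of_le hK₀ (le_max_left _ _)
  refine ⟨K, hKpos, fun n => ?_⟩
  have hinit : ∀ n ≤ N, v n ≤ K := fun n hn => (hK₀' n hn).trans (le_max_left _ _)
  rcases le_total n N with hn | hn
  · exact hinit n hn
  · induction n, hn using Nat.le_induction with
    | base => exact hinit N le_rfl
    | succ n hn ih =>
      obtain ⟨r1, r2⟩ := hN n hn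
      have hx := stepProfile_pos n
      have hC : C ≤ K * a := by
        have : C / a ≤ K := le_max_right _ _
        rwa [div_le_iff₀ ha] at this
      calc v (n + 1) ≤ (1 - a * stepProfile n) * v n + C * stepProfile n := r1
        _ ≤ (1 - a * stepProfile n) * K + (K * a) * stepProfile n := by
          gcongr
        _ = K := by ring

/-! ### The Lyapunov function -/

/-- The profile `exp (√(1 + u) - 1) - 1` of the Lyapunov function. -/
def lyapunov (u : ℝ) : ℝ := Real.exp (√(1 + u) - 1) - 1

theorem lyapunov_nonneg {u : ℝ} (hu : 0 ≤ u) : 0 ≤ lyapunov u := by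
  unfold lyapunov
  have : 1 ≤ √(1 + u) := Real.one_le_sqrt.2 (by linarith)
  have := Real.one_le_exp (x := √(1 + u) - 1) (by linarith)
  linarith

theorem le_two_mul_lyapunov {u : ℝ} (hu : 0 ≤ u) : u ≤ 2 * lyapunov u := by
  unfold lyapunov
  have h1 : 1 ≤ √(1 + u) := Real.one_le_sqrt.2 (by linarith)
  have h2 := Real.sq_sqrt (show 0 ≤ 1 + u by linarith)
  -- With `s = √(1 + u) - 1`, one has `s + s² / 2 = u / 2`.
  have := Real.quadratic_le_exp_of_nonneg (x := √(1 + u) - 1) (by linarith)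
  nlinarith

/-- With `u = ‖D‖²`, the quantity `(1 + lyapunov u) * (u / (1 + u))` is, up to a constant, what the
drift takes from `lyapunov u` in one step. The first bound makes this a contraction; the second
controls the second-order terms by the function itself. Both follow from `exp x ≥ 1 + x`, used at `t
- 1` and at `-(t - 1)`. -/
theorem lyapunov_comparison {u : ℝ} (hu : 0 ≤ u) :
    lyapunov u ≤ 2 * ((1 + lyapunov u) * (u / (1 + u))) ∧
      (1 + lyapunov u) * (u / (1 + u)) ≤ 2 * lyapunov u := by
  have h1 : 1 ≤ √(1 + u) := Real.one_le_sqrt.2 (by linarith)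
  have h2 := Real.sq_sqrt (show 0 ≤ 1 + u by linarith)
  set t := √(1 + u) with ht
  have hu' : u = t ^ 2 - 1 := by linarith
  have hE : 1 + lyapunov u = Real.exp (t - 1) := by unfold lyapunov; ring
  have hL : lyapunov u = Real.exp (t - 1) - 1 := by unfold lyapunov; ring
  have hq : u / (1 + u) = (t ^ 2 - 1) / t ^ 2 := by rw [hu']; congr 1; ring
  have hpos := Real.exp_pos (t - 1)
  have hlow : t ≤ Real.exp (t - 1) := by have := Real.add_one_le_exp (t - 1); linarith
  have hinv : 2 - t ≤ (Real.exp (t - 1))⁻¹ := by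
    rw [← Real.exp_neg]; have := Real.add_one_le_exp (-(t - 1)); linarith
  rw [hE, hL, hq]
  set e := Real.exp (t - 1)
  have ht2 : 0 < t ^ 2 := by positivity
  constructor
  · have hkey : e - 1 ≤ e * (2 * (t - 1) / t) := by
      have h3 : e * (2 - t) ≤ 1 := by
        calc e * (2 - t) ≤ e * e⁻¹ := by gcongr
          _ = 1 := mul_inv_cancel₀ hpos.ne'
      rw [mul_div_assoc', le_div_iff₀ (by linarith)]
      nlinarith
    refine hkey.trans ?_
    have : 2 * (e * ((t ^ 2 - 1) / t ^ 2)) = e * (2 * (t ^ 2 - 1) / t ^ 2) := by ring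
    rw [this]
    gcongr e * ?_
    rw [div_le_div_iff₀ (by linarith) ht2]
    nlinarith [mul_nonneg (sub_nonneg.2 h1) (show (0:ℝ) ≤ t by linarith)]
  · rw [mul_div_assoc', div_le_iff₀ ht2]
    nlinarith [mul_nonneg (sub_nonneg.2 hlow) (show 0 ≤ t ^ 2 + 1 by positivity),
      mul_nonneg (show 0 ≤ t by linarith) (sq_nonneg (t - 1))]

/-- A pathwise second-order expansion in which the term linear in `g` is kept exactly, so that its
mean can be taken afterwards. Apart from `γ⁴`, every error carries a factor `lyapunov`. A bare `γ²`
would spoil the rate of the fourth moment. -/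
theorem lyapunov_step {E : Type*} [NormedAddCommGroup E] [InnerProductSpace ℝ E] {D g : E}
    {γ R : ℝ} (hγ : 0 ≤ γ) (hγ1 : γ ≤ 1) (hsmall : γ * R + γ * R ^ 2 ≤ 1) (hg : ‖g‖ ≤ R) :
    lyapunov (‖D - γ • g‖ ^ 2) ^ 2 ≤ lyapunov (‖D‖ ^ 2) ^ 2
      - 2 * γ * (lyapunov (‖D‖ ^ 2) * (1 + lyapunov (‖D‖ ^ 2)))
        * (inner ℝ D g / √(1 + ‖D‖ ^ 2))
      + (25 * R ^ 2 + 5 * R ^ 4) * γ ^ 2 * (lyapunov (‖D‖ ^ 2) + lyapunov (‖D‖ ^ 2) ^ 2)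
      + 4 * R ^ 4 * γ ^ 4 := by
  have hR : 0 ≤ R := (norm_nonneg g).trans hg
  have hu : 0 ≤ ‖D‖ ^ 2 := sq_nonneg _
  have hnu : ‖D - γ • g‖ ^ 2 = ‖D‖ ^ 2 - 2 * γ * inner ℝ D g + γ ^ 2 * ‖g‖ ^ 2 := by
    rw [norm_sub_sq_real, inner_smul_right, norm_smul, mul_pow, Real.norm_eq_abs, sq_abs]
    ring
  have hinner : inner ℝ D g ^ 2 ≤ R ^ 2 * ‖D‖ ^ 2 := by
    have h := abs_real_inner_le_norm D g
    calc inner ℝ D g ^ 2 = |inner ℝ D g| ^ 2 := (sq_abs _).symm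
      _ ≤ (‖D‖ * ‖g‖) ^ 2 := by gcongr
      _ ≤ (‖D‖ * R) ^ 2 := by gcongr
      _ = _ := by ring
  have hg2 : ‖g‖ ^ 2 ≤ R ^ 2 := by gcongr
  have hu' : 0 ≤ ‖D - γ • g‖ ^ 2 := sq_nonneg _
  have hZ := lyapunov_nonneg hu
  have hZ' := lyapunov_nonneg hu'
  obtain ⟨-, hcomp⟩ := lyapunov_comparison hu
  generalize ‖D - γ • g‖ ^ 2 = u' at *
  generalize ‖D‖ ^ 2 = u at *
  generalize ‖g‖ ^ 2 = G at *
  have h1 : 1 ≤ √(1 + u) := Real.one_le_sqrt.2 (by linarith)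
  have h2 := Real.sq_sqrt (show 0 ≤ 1 + u by linarith)
  set t := √(1 + u) with ht
  have ht0 : 0 < t := by linarith
  set a := inner ℝ D g / t with ha
  have hat : inner ℝ D g = a * t := by rw [ha]; field_simp
  have ha2 : a ^ 2 ≤ R ^ 2 * (u / (1 + u)) := by
    rw [ha, div_pow, h2, mul_div_assoc']
    gcongr
  set q := u / (1 + u) with hq
  have hq0 : 0 ≤ q := by positivity
  have hq1 : q ≤ 1 := by rw [hq, div_le_one (by linarith)]; linarith
  have ha1 : |a| ≤ R := by
    apply abs_le_of_sq_le_sq _ hR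
    nlinarith [sq_nonneg R]
  obtain ⟨ha3, ha4⟩ := abs_le.1 ha1
  -- `η` bounds the increment of `√(1 + ‖D‖²)`: the square of `t + η` reproduces `1 + ‖D - γ g‖²` up
  -- to nonnegative terms, because `t ≥ 1`.
  set η := -(γ * a) + γ ^ 2 * R ^ 2 / 2 with hη
  have hγ2 : γ ^ 2 ≤ γ := by nlinarith
  have hγR : γ ^ 2 * R ^ 2 ≤ γ * R ^ 2 := by gcongr
  have hη1 : |η| ≤ 1 := by
    rw [abs_le]
    have h5 : γ * a ≤ γ * R := by gcongr
    have h6 : γ * (-R) ≤ γ * a := by gcongr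
    have h7 : 0 ≤ γ * R ^ 2 := by positivity
    have h8 : 0 ≤ γ ^ 2 * R ^ 2 := by positivity
    constructor <;> rw [hη] <;> linarith
  obtain ⟨hηl, hηu⟩ := abs_le.1 hη1
  have hs : √(1 + u') ≤ t + η := by
    rw [Real.sqrt_le_left (by linarith), hnu, hat]
    have h5 : γ ^ 2 * G ≤ γ ^ 2 * R ^ 2 * t := by
      calc γ ^ 2 * G ≤ γ ^ 2 * R ^ 2 := by gcongr
        _ ≤ γ ^ 2 * R ^ 2 * t := le_mul_of_one_le_right (by positivity) h1
    have h6 : (t + η) ^ 2 = t ^ 2 - 2 * γ * (a * t) + γ ^ 2 * R ^ 2 * t + η ^ 2 := by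
      rw [hη]; ring
    rw [h6, h2]
    linarith [sq_nonneg η]
  set Z := lyapunov u with hZdef
  have hexp : Real.exp (t - 1) = 1 + Z := by rw [hZdef, lyapunov]; ring
  have hexpη := Real.abs_exp_sub_one_sub_id_le hη1
  have hexpη1 := Real.abs_exp_sub_one_le hη1
  set δ := Real.exp η - 1 with hδ
  have hδ1 : δ ≤ η + η ^ 2 := by have := (abs_le.1 hexpη).2; linarith
  have hδ2 : δ ^ 2 ≤ 4 * η ^ 2 := by
    calc δ ^ 2 = |δ| ^ 2 := (sq_abs _).symm
      _ ≤ (2 * |η|) ^ 2 := by gcongr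
      _ = 4 * η ^ 2 := by rw [mul_pow, sq_abs]; norm_num
  have hZ1 : lyapunov u' ≤ Z + (1 + Z) * δ := by
    have : Real.exp (√(1 + u') - 1) ≤ Real.exp (t - 1) * Real.exp η := by
      rw [← Real.exp_add]
      exact Real.exp_le_exp.2 (by linarith)
    rw [hexp] at this
    rw [lyapunov, hδ]
    linarith
  -- The main part keeps the factor `q = u / (1 + u)`, so that `(1 + Z) * q ≤ 2 * Z` makes it vanish
  -- with `D`.
  have hη2 : η ^ 2 ≤ 2 * γ ^ 2 * R ^ 2 * q + γ ^ 4 * R ^ 4 / 2 := by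
    have h5 : γ ^ 2 * a ^ 2 ≤ γ ^ 2 * (R ^ 2 * q) := by gcongr
    have h6 : η ^ 2 ≤ 2 * (γ ^ 2 * a ^ 2) + 2 * (γ ^ 2 * R ^ 2 / 2) ^ 2 := by
      rw [hη, ← sub_nonneg]
      refine (sq_nonneg (γ * a + γ ^ 2 * R ^ 2 / 2)).trans_eq ?_
      ring
    calc η ^ 2 ≤ 2 * (γ ^ 2 * a ^ 2) + 2 * (γ ^ 2 * R ^ 2 / 2) ^ 2 := h6
      _ ≤ 2 * (γ ^ 2 * (R ^ 2 * q)) + 2 * (γ ^ 2 * R ^ 2 / 2) ^ 2 := by gcongr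
      _ = _ := by ring
  have hγ4 : γ ^ 4 ≤ γ ^ 2 := by nlinarith [sq_nonneg γ]
  have hR4 : 0 ≤ R ^ 4 := by positivity
  calc lyapunov u' ^ 2 ≤ (Z + (1 + Z) * δ) ^ 2 := by gcongr
    _ = Z ^ 2 + 2 * Z * (1 + Z) * δ + (1 + Z) ^ 2 * δ ^ 2 := by ring
    _ ≤ Z ^ 2 + 2 * Z * (1 + Z) * (η + η ^ 2) + (1 + Z) ^ 2 * (4 * η ^ 2) := by gcongr
    _ ≤ Z ^ 2 + 2 * Z * (1 + Z) * (η + (2 * γ ^ 2 * R ^ 2 * q + γ ^ 4 * R ^ 4 / 2))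
        + (1 + Z) ^ 2 * (4 * (2 * γ ^ 2 * R ^ 2 * q + γ ^ 4 * R ^ 4 / 2)) := by gcongr
    _ = Z ^ 2 - 2 * γ * (Z * (1 + Z)) * a + γ ^ 2 * R ^ 2 * (Z + Z ^ 2)
        + 4 * (γ ^ 2 * R ^ 2) * Z * ((1 + Z) * q) + R ^ 4 * (Z + Z ^ 2) * γ ^ 4
        + 8 * (γ ^ 2 * R ^ 2) * (1 + Z) * ((1 + Z) * q)
        + 2 * (1 + Z) ^ 2 * R ^ 4 * γ ^ 4 := by rw [hη]; ring
    _ ≤ Z ^ 2 - 2 * γ * (Z * (1 + Z)) * a + γ ^ 2 * R ^ 2 * (Z + Z ^ 2)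
        + 4 * (γ ^ 2 * R ^ 2) * Z * (2 * Z) + R ^ 4 * (Z + Z ^ 2) * γ ^ 2
        + 8 * (γ ^ 2 * R ^ 2) * (1 + Z) * (2 * Z)
        + (2 * R ^ 4 * γ ^ 4 + 4 * R ^ 4 * (Z + Z ^ 2) * γ ^ 2) := by
      have h9 : 2 * (1 + Z) ^ 2 * R ^ 4 * γ ^ 4
          ≤ 2 * R ^ 4 * γ ^ 4 + 4 * R ^ 4 * (Z + Z ^ 2) * γ ^ 2 := by
        have e1 : 2 * (1 + Z) ^ 2 * R ^ 4 * γ ^ 4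
          = 2 * R ^ 4 * γ ^ 4 + R ^ 4 * (4 * Z + 2 * Z ^ 2) * γ ^ 4 := by ring
        have e2 : R ^ 4 * (4 * Z + 2 * Z ^ 2) * γ ^ 4 ≤ R ^ 4 * (4 * Z + 4 * Z ^ 2) * γ ^ 2 := by
          gcongr
          norm_num
        rw [e1]
        linarith
      gcongr
    -- The coefficient of `γ² R² Z²` is `1 + 8 + 16 = 25`, that of `γ² R⁴ (Z + Z²)` is `1 + 4 = 5`.
    -- The slack is `8 γ² R² Z + 2 γ⁴ R⁴`.
    _ ≤ _ := by
      have h10 : 0 ≤ γ ^ 2 * R ^ 2 * Z := by positivity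
      have h11 : 0 ≤ γ ^ 4 * R ^ 4 := by positivity
      rw [← sub_nonneg]
      refine (add_nonneg (mul_nonneg (by norm_num : (0 : ℝ) ≤ 8) h10)
        (mul_nonneg (by norm_num : (0 : ℝ) ≤ 2) h11)).trans_eq ?_
      ring

end LogisticSGD
end

noncomputable section
namespace LogisticSGD

/-! ### Differentiation of integrals of ridge functions -/

section Ridge

variable {E F Ω : Type*} [NormedAddCommGroup E] [InnerProductSpace ℝ E] [NormedAddCommGroup F]
  [NormedSpace ℝ F] [MeasurableSpace Ω] {P : Measure Ω} {Z : Ω → E} {L : Ω → F}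
  {R B C : ℝ} {φ φ' : ℝ → ℝ}

theorem abs_le_of_hasDerivAt (hφ : ∀ t, HasDerivAt φ (φ' t) t) (hC : ∀ t, |φ' t| ≤ C) (t : ℝ) :
    |φ t| ≤ |φ 0| + C * |t| := by
  have := Convex.norm_image_sub_le_of_norm_hasDerivWithin_le (f := φ) (f' := φ') (s := Set.univ)
    (x := 0) (y := t) (fun x _ => (hφ x).hasDerivWithinAt) (fun x _ => hC x) convex_univ
    trivial trivial
  rw [sub_zero, Real.norm_eq_abs, Real.norm_eq_abs] at this
  have h2 := abs_sub_abs_le_abs_sub (φ t) (φ 0)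
  linarith

theorem aestronglyMeasurable_ridge (hφ : Continuous φ) (hZ : AEStronglyMeasurable Z P)
    (hL : AEStronglyMeasurable L P) (θ : E) :
    AEStronglyMeasurable (fun ω => φ (inner ℝ (Z ω) θ) • L ω) P :=
  (hφ.comp_aestronglyMeasurable (hZ.inner aestronglyMeasurable_const)).smul hL

theorem integrable_ridge [IsFiniteMeasure P] (hφ : Continuous φ) (hC : ∀ t, |φ t| ≤ C)
    (hZ : AEStronglyMeasurable Z P) (hL : AEStronglyMeasurable L P)
    (hLB : ∀ᵐ ω ∂P, ‖L ω‖ ≤ B) (θ : E) :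
    Integrable (fun ω => φ (inner ℝ (Z ω) θ) • L ω) P := by
  refine Integrable.of_bound (aestronglyMeasurable_ridge hφ hZ hL θ) (C * B) ?_
  filter_upwards [hLB] with ω h
  rw [norm_smul]
  have := hC (inner ℝ (Z ω) θ)
  rw [← Real.norm_eq_abs] at this
  gcongr
  exact (norm_nonneg _).trans this

theorem aestronglyMeasurable_innerSL_smulRight (hZ : AEStronglyMeasurable Z P)
    (hL : AEStronglyMeasurable L P) :
    AEStronglyMeasurable (fun ω => (innerSL ℝ (Z ω)).smulRight (L ω)) P := by
  have : Continuous fun p : E × F => (innerSL ℝ p.1).smulRight p.2 := by fun_prop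
  exact this.comp_aestronglyMeasurable (hZ.prodMk hL)

theorem norm_innerSL_smulRight_le (hZR : ∀ᵐ ω ∂P, ‖Z ω‖ ≤ R) (hLB : ∀ᵐ ω ∂P, ‖L ω‖ ≤ B) :
    ∀ᵐ ω ∂P, ‖(innerSL ℝ (Z ω)).smulRight (L ω)‖ ≤ R * B := by
  filter_upwards [hZR, hLB] with ω h1 h2
  rw [ContinuousLinearMap.norm_smulRight_apply, innerSL_apply_norm]
  have : 0 ≤ R := (norm_nonneg _).trans h1
  gcongr

/-- The derivative is again a ridge integral, with `φ'` for `φ` and `⟪Z, ·⟫ ⊗ L` for `L`, so the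
statement can be iterated. Only `φ'` is bounded, because the logistic loss itself grows linearly. -/
theorem hasFDerivAt_integral_ridge [IsFiniteMeasure P] (hφ : ∀ t, HasDerivAt φ (φ' t) t)
    (hφ' : Continuous φ')
    (hC : ∀ t, |φ' t| ≤ C) (hZ : AEStronglyMeasurable Z P) (hZR : ∀ᵐ ω ∂P, ‖Z ω‖ ≤ R)
    (hL : AEStronglyMeasurable L P) (hLB : ∀ᵐ ω ∂P, ‖L ω‖ ≤ B) (θ : E) :
    HasFDerivAt (fun θ => ∫ ω, φ (inner ℝ (Z ω) θ) • L ω ∂P)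
      (∫ ω, φ' (inner ℝ (Z ω) θ) • (innerSL ℝ (Z ω)).smulRight (L ω) ∂P) θ := by
  have hφc : Continuous φ := continuous_iff_continuousAt.2 fun t => (hφ t).continuousAt
  have hC0 : 0 ≤ C := (abs_nonneg _).trans (hC 0)
  have hsm := aestronglyMeasurable_innerSL_smulRight hZ hL
  refine hasFDerivAt_integral_of_dominated_of_fderiv_le (s := Set.univ)
    (F' := fun θ ω => φ' (inner ℝ (Z ω) θ) • (innerSL ℝ (Z ω)).smulRight (L ω))
    (bound := fun _ => C * (R * B)) univ_mem ?_ ?_ ?_ ?_ ?_ ?_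
  · exact Eventually.of_forall fun θ => aestronglyMeasurable_ridge hφc hZ hL θ
  · refine Integrable.of_bound (aestronglyMeasurable_ridge hφc hZ hL θ)
      ((|φ 0| + C * (R * ‖θ‖)) * B) ?_
    filter_upwards [hZR, hLB] with ω h1 h2
    rw [norm_smul]
    have h3 : |inner ℝ (Z ω) θ| ≤ R * ‖θ‖ :=
      (abs_real_inner_le_norm _ _).trans (by gcongr)
    have h4 : ‖φ (inner ℝ (Z ω) θ)‖ ≤ |φ 0| + C * (R * ‖θ‖) :=
      (abs_le_of_hasDerivAt hφ hC _).trans (by gcongr)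
    have h5 : 0 ≤ |φ 0| + C * (R * ‖θ‖) := (norm_nonneg _).trans h4
    gcongr
  · exact (hφ'.comp_aestronglyMeasurable (hZ.inner aestronglyMeasurable_const)).smul hsm
  · filter_upwards [hZR, hLB] with ω h1 h2 x _
    rw [norm_smul, ContinuousLinearMap.norm_smulRight_apply, innerSL_apply_norm]
    have := hC (inner ℝ (Z ω) x)
    rw [← Real.norm_eq_abs] at this
    have : 0 ≤ R := (norm_nonneg _).trans h1
    gcongr
  · exact integrable_const _
  · refine Eventually.of_forall fun ω x _ => ?_
    have h1 : HasFDerivAt (fun x : E => inner ℝ (Z ω) x) (innerSL ℝ (Z ω)) x :=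
      (innerSL ℝ (Z ω)).hasFDerivAt
    have h2 := ((hφ (inner ℝ (Z ω) x)).comp_hasFDerivAt x h1).smul_const (L ω)
    convert! h2 using 1
    ext v
    simp [mul_smul]

theorem norm_integral_ridge_le [IsProbabilityMeasure P] (hC : ∀ t, |φ t| ≤ C)
    (hLB : ∀ᵐ ω ∂P, ‖L ω‖ ≤ B) (θ : E) :
    ‖∫ ω, φ (inner ℝ (Z ω) θ) • L ω ∂P‖ ≤ C * B := by
  have : ∀ᵐ ω ∂P, ‖φ (inner ℝ (Z ω) θ) • L ω‖ ≤ C * B := by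
    filter_upwards [hLB] with ω h
    rw [norm_smul]
    have := hC (inner ℝ (Z ω) θ)
    rw [← Real.norm_eq_abs] at this
    gcongr
    exact (norm_nonneg _).trans this
  simpa using norm_integral_le_of_norm_le_const this

end Ridge

/-! ### The logistic loss in one variable -/

theorem hasDerivAt_logisticLoss (t : ℝ) :
    HasDerivAt (fun t => Real.log (1 + Real.exp (-t))) (Real.sigmoid t - 1) t := by
  have h : HasDerivAt (fun t => 1 + Real.exp (-t)) (-Real.exp (-t)) t := by
    simpa using ((hasDerivAt_neg t).exp).const_add 1
  convert! h.log (by positivity) using 1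
  rw [Real.sigmoid_def]
  field_simp
  ring

theorem hasDerivAt_sigmoid_sub_one (t : ℝ) :
    HasDerivAt (fun t => Real.sigmoid t - 1) (Real.sigmoid t * (1 - Real.sigmoid t)) t :=
  (Real.hasDerivAt_sigmoid t).sub_const 1

theorem hasDerivAt_sigmoid_variance (t : ℝ) :
    HasDerivAt (fun t => Real.sigmoid t * (1 - Real.sigmoid t))
      (Real.sigmoid t * (1 - Real.sigmoid t) * (1 - 2 * Real.sigmoid t)) t := by
  have h := Real.hasDerivAt_sigmoid t
  convert! h.mul (h.const_sub 1) using 1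
  ring

theorem abs_sigmoid_sub_one_le (t : ℝ) : |Real.sigmoid t - 1| ≤ 1 := by
  have := Real.sigmoid_pos t
  have := Real.sigmoid_lt_one t
  rw [abs_le]; constructor <;> linarith

theorem abs_sigmoid_variance_le (t : ℝ) : |Real.sigmoid t * (1 - Real.sigmoid t)| ≤ 1 := by
  have := Real.sigmoid_pos t
  have := Real.sigmoid_lt_one t
  rw [abs_le]; constructor <;> nlinarith

theorem abs_sigmoid_variance_deriv_le (t : ℝ) :
    |Real.sigmoid t * (1 - Real.sigmoid t) * (1 - 2 * Real.sigmoid t)| ≤ 1 := by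
  have h1 := Real.sigmoid_pos t
  have h2 := Real.sigmoid_lt_one t
  rw [abs_mul]
  refine mul_le_one₀ (abs_sigmoid_variance_le t) (abs_nonneg _) ?_
  rw [abs_le]; constructor <;> linarith

theorem continuous_sigmoid : Continuous Real.sigmoid :=
  continuous_iff_continuousAt.2 fun t => (Real.hasDerivAt_sigmoid t).continuousAt

theorem abs_sigmoid_sub_le (s t : ℝ) : |Real.sigmoid s - Real.sigmoid t| ≤ |s - t| := by
  have := Convex.norm_image_sub_le_of_norm_hasDerivWithin_le (f := Real.sigmoid)
    (s := Set.univ) (x := t) (y := s)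
    (fun x _ => (Real.hasDerivAt_sigmoid x).hasDerivWithinAt)
    (fun x _ => abs_sigmoid_variance_le x) convex_univ trivial trivial
  simpa using this

/-- This ridge integral is the second derivative of the risk. Differentiating it once more gives a
derivative bounded by `R ^ 3`. -/
theorem lipschitzWith_integral_ridge_sigmoid {E Ω : Type*} [NormedAddCommGroup E]
    [InnerProductSpace ℝ E] [MeasurableSpace Ω] {P : Measure Ω} [IsProbabilityMeasure P]
    {Z : Ω → E} {R : ℝ} (hR : 0 ≤ R) (hZ : AEStronglyMeasurable Z P)
    (hZR : ∀ᵐ ω ∂P, ‖Z ω‖ ≤ R) :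
    LipschitzWith (R ^ 3).toNNReal (fun θ =>
      ∫ ω, (Real.sigmoid (inner ℝ (Z ω) θ) * (1 - Real.sigmoid (inner ℝ (Z ω) θ))) •
        (innerSL ℝ (Z ω)).smulRight ((innerSL ℝ (Z ω)).smulRight (1 : ℝ)) ∂P) := by
  have hm1 := aestronglyMeasurable_innerSL_smulRight hZ
    (aestronglyMeasurable_const (b := (1 : ℝ)))
  have hm2 := aestronglyMeasurable_innerSL_smulRight hZ hm1
  have hb1 := norm_innerSL_smulRight_le (P := P) (L := fun _ => (1 : ℝ)) (B := 1) hZR (by simp)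
  have hb2 := norm_innerSL_smulRight_le hZR hb1
  have hb3 := norm_innerSL_smulRight_le hZR hb2
  have hd := fun θ => hasFDerivAt_integral_ridge
    (φ := fun t => Real.sigmoid t * (1 - Real.sigmoid t)) hasDerivAt_sigmoid_variance
    ((continuous_sigmoid.mul (continuous_const.sub continuous_sigmoid)).mul
      (continuous_const.sub (continuous_const.mul continuous_sigmoid)))
    abs_sigmoid_variance_deriv_le hZ hZR hm2 hb2 θ
  refine lipschitzWith_of_nnnorm_fderiv_le (𝕜 := ℝ) (fun θ => (hd θ).differentiableAt) fun θ => ?_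
  rw [(hd θ).fderiv, ← NNReal.coe_le_coe, coe_nnnorm,
    Real.coe_toNNReal _ (pow_nonneg hR 3)]
  refine (norm_integral_ridge_le
    (φ := fun t => Real.sigmoid t * (1 - Real.sigmoid t) * (1 - 2 * Real.sigmoid t))
    abs_sigmoid_variance_deriv_le hb3 θ).trans_eq ?_
  ring

/-- Both `σ t` and `1 - σ t = σ (-t)` are at least `σ (-B)`. -/
theorem exists_sigmoid_variance_ge (B : ℝ) :
    ∃ c : ℝ, 0 < c ∧ ∀ t, |t| ≤ B → c ≤ Real.sigmoid t * (1 - Real.sigmoid t) := by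
  refine ⟨Real.sigmoid (-B) * Real.sigmoid (-B),
    mul_pos (Real.sigmoid_pos _) (Real.sigmoid_pos _), fun t ht => ?_⟩
  obtain ⟨h1, h2⟩ := abs_le.1 ht
  have h3 : Real.sigmoid (-B) ≤ Real.sigmoid t := Real.sigmoid_le h1
  have h4 : Real.sigmoid (-B) ≤ 1 - Real.sigmoid t := by
    rw [← Real.sigmoid_neg]; exact Real.sigmoid_le (by linarith)
  have := Real.sigmoid_pos (-B)
  have := Real.sigmoid_pos t
  gcongr

/-- Uniform strict monotonicity of the sigmoid around points of a bounded set. -/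
theorem exists_sigmoid_monotone_ge (B : ℝ) :
    ∃ c : ℝ, 0 < c ∧ ∀ b z, |b| ≤ B →
      c * (z ^ 2 / (1 + |z|)) ≤ z * (Real.sigmoid (b + z) - Real.sigmoid b) := by
  -- Steps of length at most 1 from a point of `[-B, B]` stay in `[-(B + 1), B + 1]`, where the
  -- derivative is at least `c`. Longer steps are handled by monotonicity alone, which is why the
  -- gain is only linear for large `z`.
  obtain ⟨c, hc, hcB⟩ := exists_sigmoid_variance_ge (B + 1)
  have hsmall : ∀ b z, |b| ≤ B → 0 ≤ z → z ≤ 1 →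
      c * z ≤ Real.sigmoid (b + z) - Real.sigmoid b ∧
      c * z ≤ Real.sigmoid b - Real.sigmoid (b - z) := by
    intro b z hb hz hz1
    obtain ⟨hb1, hb2⟩ := abs_le.1 hb
    have key : ∀ x y, -(B + 1) ≤ x → x ≤ y → y ≤ B + 1 →
        c * (y - x) ≤ Real.sigmoid y - Real.sigmoid x := by
      intro x y hx hxy hy
      refine (convex_Icc x y).mul_sub_le_image_sub_of_le_deriv
        continuous_sigmoid.continuousOn
        (fun t _ => (Real.hasDerivAt_sigmoid t).differentiableAt.differentiableWithinAt)
        (fun t ht => ?_) x (Set.left_mem_Icc.2 hxy) y (Set.right_mem_Icc.2 hxy) hxy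
      rw [(Real.hasDerivAt_sigmoid t).deriv]
      have := interior_subset ht
      exact hcB t (abs_le.2 ⟨hx.trans this.1, this.2.trans hy⟩)
    constructor
    · have := key b (b + z) (by linarith) (by linarith) (by linarith)
      simpa using this
    · have := key (b - z) b (by linarith) (by linarith) (by linarith)
      simpa using this
  have hpos : ∀ b z, |b| ≤ B → 0 ≤ z →
      c * (z / (1 + z)) ≤ Real.sigmoid (b + z) - Real.sigmoid b ∧
      c * (z / (1 + z)) ≤ Real.sigmoid b - Real.sigmoid (b - z) := by
    intro b z hb hz
    rcases le_total z 1 with h | h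
    · have h2 : z / (1 + z) ≤ z := div_le_self hz (by linarith)
      have h3 : c * (z / (1 + z)) ≤ c * z := by gcongr
      exact ⟨h3.trans (hsmall b z hb hz h).1, h3.trans (hsmall b z hb hz h).2⟩
    · have h2 : z / (1 + z) ≤ 1 := by rw [div_le_one (by linarith)]; linarith
      have h3 : c * (z / (1 + z)) ≤ c * 1 := by gcongr
      obtain ⟨h4, h5⟩ := hsmall b 1 hb zero_le_one le_rfl
      have h6 : Real.sigmoid (b + 1) ≤ Real.sigmoid (b + z) := Real.sigmoid_le (by linarith)
      have h7 : Real.sigmoid (b - z) ≤ Real.sigmoid (b - 1) := Real.sigmoid_le (by linarith)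
      constructor <;> linarith
  refine ⟨c, hc, fun b z hb => ?_⟩
  rcases le_total 0 z with h | h
  · rw [abs_of_nonneg h]
    calc c * (z ^ 2 / (1 + z)) = z * (c * (z / (1 + z))) := by ring
      _ ≤ _ := by gcongr; exact (hpos b z hb h).1
  · rw [abs_of_nonpos h]
    have := (hpos b (-z) hb (by linarith)).2
    rw [sub_neg_eq_add] at this
    calc c * (z ^ 2 / (1 + -z)) = (-z) * (c * (-z / (1 + -z))) := by ring
      _ ≤ (-z) * (Real.sigmoid b - Real.sigmoid (b + z)) :=
        mul_le_mul_of_nonneg_left this (by linarith)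
      _ = _ := by ring

end LogisticSGD
end

noncomputable section
namespace LogisticSGD

/-! ### The logistic risk -/

/-- The assumptions on the distribution of the observation `(X, Y)`. -/
structure BoundedLogistic {d : ℕ} {Ω : Type*} [MeasurableSpace Ω] (P : Measure Ω)
    (X : Ω → EuclideanSpace ℝ (Fin d)) (Y : Ω → ℝ) (θs : EuclideanSpace ℝ (Fin d)) (R : ℝ) :
    Prop where
  measurable_X : Measurable X
  measurable_Y : Measurable Y
  norm_le : ∀ᵐ ω ∂P, ‖X ω‖ ≤ R
  variance_pos : ∀ e : EuclideanSpace ℝ (Fin d), ‖e‖ = 1 →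
    0 < variance (fun ω => inner ℝ (X ω) e) P
  model : IsLogisticModel P X Y θs

/-- The stochastic gradient depends on the observation only through `y • x`, for any real `y`; this
is its ridge form. -/
theorem neg_descentDir_eq {d : ℕ} (θ x : EuclideanSpace ℝ (Fin d)) (y : ℝ) :
    -descentDir θ x y = (Real.sigmoid (inner ℝ (y • x) θ) - 1) • (y • x) := by
  rw [descentDir, inner_smul_left, Real.sigmoid_def, smul_smul, ← neg_smul, real_inner_comm]
  congr 1
  simp only [conj_trivial]
  rw [Real.exp_neg]
  have := Real.exp_pos (y * inner ℝ x θ)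
  field_simp
  ring

namespace BoundedLogistic

variable {d : ℕ} {Ω : Type*} [MeasurableSpace Ω] {P : Measure Ω}
  {X : Ω → EuclideanSpace ℝ (Fin d)} {Y : Ω → ℝ} {θs : EuclideanSpace ℝ (Fin d)} {R : ℝ}

theorem aestronglyMeasurable_smul (h : BoundedLogistic P X Y θs R) :
    AEStronglyMeasurable (fun ω => Y ω • X ω) P :=
  (h.measurable_Y.smul h.measurable_X).aestronglyMeasurable

theorem norm_smul_le (h : BoundedLogistic P X Y θs R) : ∀ᵐ ω ∂P, ‖Y ω • X ω‖ ≤ R := by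
  filter_upwards [h.norm_le, h.model.values] with ω h1 h2
  rcases h2 with h2 | h2 <;> simpa [norm_smul, h2] using h1

theorem nonneg_R [IsProbabilityMeasure P] (h : BoundedLogistic P X Y θs R) : 0 ≤ R := by
  obtain ⟨ω, hω⟩ := h.norm_le.exists
  exact (norm_nonneg _).trans hω

/-- The scalar factor `1` gives the shape `φ ⟪Z, θ⟫ • L` required by the ridge lemmas, with `Z = Y •
X`. -/
theorem risk_eq :
    logisticRisk P X Y = fun θ =>
      ∫ ω, Real.log (1 + Real.exp (-(inner ℝ (Y ω • X ω) θ))) • (1 : ℝ) ∂P := by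
  ext θ
  simp [logisticRisk, inner_smul_left]

theorem hasFDerivAt_risk [IsProbabilityMeasure P] (h : BoundedLogistic P X Y θs R)
    (θ : EuclideanSpace ℝ (Fin d)) :
    HasFDerivAt (logisticRisk P X Y)
      (∫ ω, (Real.sigmoid (inner ℝ (Y ω • X ω) θ) - 1) •
        (innerSL ℝ (Y ω • X ω)).smulRight (1 : ℝ) ∂P) θ := by
  rw [risk_eq]
  exact hasFDerivAt_integral_ridge (φ := fun t => Real.log (1 + Real.exp (-t)))
    (φ' := fun t => Real.sigmoid t - 1) (B := 1)
    hasDerivAt_logisticLoss (continuous_sigmoid.sub continuous_const) abs_sigmoid_sub_one_le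
    h.aestronglyMeasurable_smul h.norm_smul_le aestronglyMeasurable_const (by simp) θ

theorem fderiv_risk [IsProbabilityMeasure P] (h : BoundedLogistic P X Y θs R) :
    fderiv ℝ (logisticRisk P X Y) = fun θ =>
      ∫ ω, (Real.sigmoid (inner ℝ (Y ω • X ω) θ) - 1) •
        (innerSL ℝ (Y ω • X ω)).smulRight (1 : ℝ) ∂P :=
  funext fun θ => (h.hasFDerivAt_risk θ).fderiv

theorem hasFDerivAt_fderiv_risk [IsProbabilityMeasure P] (h : BoundedLogistic P X Y θs R)
    (θ : EuclideanSpace ℝ (Fin d)) :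
    HasFDerivAt (fderiv ℝ (logisticRisk P X Y))
      (∫ ω, (Real.sigmoid (inner ℝ (Y ω • X ω) θ) *
          (1 - Real.sigmoid (inner ℝ (Y ω • X ω) θ))) •
        (innerSL ℝ (Y ω • X ω)).smulRight
          ((innerSL ℝ (Y ω • X ω)).smulRight (1 : ℝ)) ∂P) θ := by
  rw [h.fderiv_risk]
  exact hasFDerivAt_integral_ridge (φ := fun t => Real.sigmoid t - 1)
    (φ' := fun t => Real.sigmoid t * (1 - Real.sigmoid t))
    hasDerivAt_sigmoid_sub_one
    (continuous_sigmoid.mul (continuous_const.sub continuous_sigmoid)) abs_sigmoid_variance_le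
    h.aestronglyMeasurable_smul h.norm_smul_le
    (aestronglyMeasurable_innerSL_smulRight h.aestronglyMeasurable_smul
        aestronglyMeasurable_const)
    (norm_innerSL_smulRight_le h.norm_smul_le (B := 1) (by simp)) θ

theorem fderiv_fderiv_risk [IsProbabilityMeasure P] (h : BoundedLogistic P X Y θs R) :
    fderiv ℝ (fderiv ℝ (logisticRisk P X Y)) = fun θ =>
      ∫ ω, (Real.sigmoid (inner ℝ (Y ω • X ω) θ) *
          (1 - Real.sigmoid (inner ℝ (Y ω • X ω) θ))) •
        (innerSL ℝ (Y ω • X ω)).smulRight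
          ((innerSL ℝ (Y ω • X ω)).smulRight (1 : ℝ)) ∂P :=
  funext fun θ => (h.hasFDerivAt_fderiv_risk θ).fderiv

theorem norm_fderiv_fderiv_risk_le [IsProbabilityMeasure P] (h : BoundedLogistic P X Y θs R)
    (θ : EuclideanSpace ℝ (Fin d)) :
    ‖fderiv ℝ (fderiv ℝ (logisticRisk P X Y)) θ‖ ≤ R ^ 2 := by
  rw [h.fderiv_fderiv_risk]
  refine (norm_integral_ridge_le (φ := fun t => Real.sigmoid t * (1 - Real.sigmoid t))
    abs_sigmoid_variance_le (norm_innerSL_smulRight_le h.norm_smul_le (norm_innerSL_smulRight_le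
      h.norm_smul_le (B := 1) (by simp)))
    θ).trans_eq ?_
  ring

theorem norm_fderiv_risk_le [IsProbabilityMeasure P] (h : BoundedLogistic P X Y θs R)
    (θ : EuclideanSpace ℝ (Fin d)) :
    ‖fderiv ℝ (logisticRisk P X Y) θ‖ ≤ R := by
  rw [h.fderiv_risk]
  refine (norm_integral_ridge_le (φ := fun t => Real.sigmoid t - 1)
    abs_sigmoid_sub_one_le (norm_innerSL_smulRight_le h.norm_smul_le (B := 1) (by simp))
      θ).trans_eq ?_
  ring

theorem lipschitzWith_fderiv_fderiv_risk [IsProbabilityMeasure P]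
    (h : BoundedLogistic P X Y θs R) :
    LipschitzWith (R ^ 3).toNNReal (fderiv ℝ (fderiv ℝ (logisticRisk P X Y))) := by
  rw [h.fderiv_fderiv_risk]
  exact lipschitzWith_integral_ridge_sigmoid h.nonneg_R h.aestronglyMeasurable_smul
    h.norm_smul_le

theorem contDiff_risk [IsProbabilityMeasure P] (h : BoundedLogistic P X Y θs R) :
    ContDiff ℝ 2 (logisticRisk P X Y) := by
  have e : (2 : WithTop ℕ∞) = 1 + 1 := by norm_num
  rw [e, contDiff_succ_iff_fderiv]
  refine ⟨fun θ => (h.hasFDerivAt_risk θ).differentiableAt, by simp, ?_⟩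
  rw [contDiff_one_iff_fderiv]
  exact ⟨fun θ => (h.hasFDerivAt_fderiv_risk θ).differentiableAt,
    h.lipschitzWith_fderiv_fderiv_risk.continuous⟩

theorem inner_gradient_risk [IsProbabilityMeasure P] (h : BoundedLogistic P X Y θs R)
    (θ v : EuclideanSpace ℝ (Fin d)) :
    inner ℝ (gradient (logisticRisk P X Y) θ) v =
      ∫ ω, (Real.sigmoid (inner ℝ (Y ω • X ω) θ) - 1) * inner ℝ (Y ω • X ω) v ∂P := by
  rw [gradient, InnerProductSpace.toDual_symm_apply, h.fderiv_risk]
  rw [ContinuousLinearMap.integral_apply]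
  · simp only [_root_.smul_apply, ContinuousLinearMap.smulRight_apply,
      innerSL_apply_apply, smul_eq_mul, mul_one]
  · exact integrable_ridge (φ := fun t => Real.sigmoid t - 1)
      (continuous_sigmoid.sub continuous_const) abs_sigmoid_sub_one_le
      h.aestronglyMeasurable_smul (aestronglyMeasurable_innerSL_smulRight
        h.aestronglyMeasurable_smul
        aestronglyMeasurable_const)
      (norm_innerSL_smulRight_le h.norm_smul_le (B := 1) (by simp)) θ

theorem fderiv_fderiv_risk_apply [IsProbabilityMeasure P] (h : BoundedLogistic P X Y θs R)
    (θ v w : EuclideanSpace ℝ (Fin d)) :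
    fderiv ℝ (fderiv ℝ (logisticRisk P X Y)) θ v w =
      ∫ ω, (Real.sigmoid (inner ℝ (Y ω • X ω) θ) *
          (1 - Real.sigmoid (inner ℝ (Y ω • X ω) θ))) *
        (inner ℝ (Y ω • X ω) v * inner ℝ (Y ω • X ω) w) ∂P := by
  have hint := integrable_ridge (φ := fun t => Real.sigmoid t * (1 - Real.sigmoid t))
      (continuous_sigmoid.mul (continuous_const.sub continuous_sigmoid)) abs_sigmoid_variance_le
      h.aestronglyMeasurable_smul (aestronglyMeasurable_innerSL_smulRight
        h.aestronglyMeasurable_smul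
        (aestronglyMeasurable_innerSL_smulRight h.aestronglyMeasurable_smul
        (aestronglyMeasurable_const (b := (1 : ℝ)))))
      (norm_innerSL_smulRight_le h.norm_smul_le (norm_innerSL_smulRight_le h.norm_smul_le (B := 1)
        (by simp))) θ
  rw [h.fderiv_fderiv_risk]
  rw [ContinuousLinearMap.integral_apply hint, ContinuousLinearMap.integral_apply]
  · simp [inner_smul_left]
  · exact hint.apply_continuousLinearMap v

theorem gradient_risk_eq [IsProbabilityMeasure P] (h : BoundedLogistic P X Y θs R)
    (θ : EuclideanSpace ℝ (Fin d)) :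
    gradient (logisticRisk P X Y) θ = ∫ ω, -descentDir θ (X ω) (Y ω) ∂P := by
  simp_rw [neg_descentDir_eq]
  have hint := integrable_ridge (φ := fun t => Real.sigmoid t - 1)
      (continuous_sigmoid.sub continuous_const) abs_sigmoid_sub_one_le
      h.aestronglyMeasurable_smul h.aestronglyMeasurable_smul h.norm_smul_le θ
  refine ext_inner_right ℝ fun v => ?_
  rw [h.inner_gradient_risk, real_inner_comm, ← integral_inner hint]
  refine integral_congr_ae (Eventually.of_forall fun ω => ?_)
  simp only [inner_smul_right, real_inner_comm v]

theorem convexOn_risk [IsProbabilityMeasure P] (h : BoundedLogistic P X Y θs R) :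
    ConvexOn ℝ Set.univ (logisticRisk P X Y) := by
  have hconv : ConvexOn ℝ Set.univ (fun t => Real.log (1 + Real.exp (-t))) := by
    refine MonotoneOn.convexOn_of_deriv convex_univ ?_ ?_ ?_
    · exact fun t _ => (hasDerivAt_logisticLoss t).continuousAt.continuousWithinAt
    · exact fun t _ => (hasDerivAt_logisticLoss t).differentiableAt.differentiableWithinAt
    · intro s _ t _ hst
      rw [(hasDerivAt_logisticLoss s).deriv, (hasDerivAt_logisticLoss t).deriv]
      have := Real.sigmoid_le hst
      linarith
  have hint : ∀ θ, Integrable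
      (fun ω => Real.log (1 + Real.exp (-(inner ℝ (Y ω • X ω) θ)))) P := fun θ => by
    have hc : Continuous fun t : ℝ => Real.log (1 + Real.exp (-t)) :=
      continuous_iff_continuousAt.2 fun t => (hasDerivAt_logisticLoss t).continuousAt
    refine Integrable.of_bound (hc.comp_aestronglyMeasurable
      (h.aestronglyMeasurable_smul.inner aestronglyMeasurable_const))
      (|Real.log (1 + Real.exp (-0))| + 1 * (R * ‖θ‖)) ?_
    filter_upwards [h.norm_smul_le] with ω hω
    refine (abs_le_of_hasDerivAt hasDerivAt_logisticLoss abs_sigmoid_sub_one_le _).trans ?_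
    gcongr
    exact (abs_real_inner_le_norm _ _).trans (by gcongr)
  rw [risk_eq]
  simp only [smul_eq_mul, mul_one]
  refine ⟨convex_univ, fun x _ y _ a b ha hb hab => ?_⟩
  simp only [smul_eq_mul]
  rw [← integral_const_mul, ← integral_const_mul, ← integral_add
    ((hint x).const_mul a) ((hint y).const_mul b)]
  refine integral_mono (hint _) (((hint x).const_mul a).add ((hint y).const_mul b)) fun ω => ?_
  simp only [inner_add_right, inner_smul_right]
  exact hconv.2 trivial trivial ha hb hab

end BoundedLogistic

end LogisticSGD
end

/-! ### Consequences of the model and of ellipticity: drift, Hessian at `θs`, behaviour at infinity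
-/

noncomputable section
namespace LogisticSGD

/-- Translates between the matrix and the bilinear form. With this order of `w` and `v` no symmetry
of the second derivative is needed. -/
theorem inner_hessian_mulVec {d : ℕ} (f : EuclideanSpace ℝ (Fin d) → ℝ)
    (θ v w : EuclideanSpace ℝ (Fin d)) :
    inner ℝ w (WithLp.toLp 2 (Matrix.mulVec (hessian f θ) v.ofLp)) =
      fderiv ℝ (fderiv ℝ f) θ w v := by
  have hv := (EuclideanSpace.basisFun (Fin d) ℝ).sum_repr v
  have hw := (EuclideanSpace.basisFun (Fin d) ℝ).sum_repr w
  simp only [EuclideanSpace.basisFun_apply, EuclideanSpace.basisFun_repr] at hv hw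
  conv_rhs => rw [← hv, ← hw]
  simp only [map_sum, map_smul, FunLike.coe_sum, Finset.sum_apply, smul_apply]
  simp only [PiLp.inner_apply, Matrix.mulVec, dotProduct, hessian, Matrix.of_apply, smul_eq_mul,
    RCLike.inner_apply, conj_trivial, Finset.mul_sum, Finset.sum_mul]
  rw [Finset.sum_comm]
  refine Finset.sum_congr rfl fun i _ => Finset.sum_congr rfl fun j _ => ?_
  ring

namespace BoundedLogistic

variable {d : ℕ} {Ω : Type*} [MeasurableSpace Ω] {P : Measure Ω}
  {X : Ω → EuclideanSpace ℝ (Fin d)} {Y : Ω → ℝ} {θs : EuclideanSpace ℝ (Fin d)} {R : ℝ}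

theorem risk_nonneg (θ : EuclideanSpace ℝ (Fin d)) : 0 ≤ logisticRisk P X Y θ :=
  integral_nonneg fun ω => Real.log_nonneg (by
    have := Real.exp_pos (-(Y ω * inner ℝ (X ω) θ)); linarith)

variable [IsProbabilityMeasure P]

/-- The second moment dominates the variance, hence is positive in each direction. It is continuous
on the unit sphere, so compactness gives a uniform bound, and homogeneity extends it. -/
theorem exists_second_moment_ge (h : BoundedLogistic P X Y θs R) :
    ∃ κ : ℝ, 0 < κ ∧ ∀ v : EuclideanSpace ℝ (Fin d), κ * ‖v‖ ^ 2 ≤ ∫ ω, inner ℝ (X ω) v ^ 2 ∂P := by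
  have hXm : AEStronglyMeasurable X P := h.measurable_X.aestronglyMeasurable
  have hcont : ContinuousOn (fun v : EuclideanSpace ℝ (Fin d) => ∫ ω, inner ℝ (X ω) v ^ 2 ∂P)
      (Metric.sphere 0 1) := by
    refine continuousOn_of_dominated (bound := fun _ => R ^ 2) (fun v _ => ?_) (fun v hv => ?_)
      (integrable_const _) ?_
    · exact (hXm.inner aestronglyMeasurable_const).pow 2
    · filter_upwards [h.norm_le] with ω hω
      rw [norm_pow]
      have h1 : ‖v‖ = 1 := by simpa using hv
      have := norm_inner_le_norm (𝕜 := ℝ) (X ω) v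
      rw [h1, mul_one] at this
      have h2 := this.trans hω
      gcongr
    · exact Eventually.of_forall fun ω => by fun_prop
  have hpos : ∃ κ : ℝ, 0 < κ ∧ ∀ v ∈ Metric.sphere (0 : EuclideanSpace ℝ (Fin d)) 1,
      κ ≤ ∫ ω, inner ℝ (X ω) v ^ 2 ∂P := by
    rcases (Metric.sphere (0 : EuclideanSpace ℝ (Fin d)) 1).eq_empty_or_nonempty with he | hne
    -- The sphere is empty when `d = 0`.
    · exact ⟨1, one_pos, by simp [he]⟩
    · obtain ⟨e, he, hmin⟩ := (isCompact_sphere _ _).exists_isMinOn hne hcont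
      refine ⟨_, ?_, hmin⟩
      refine (h.variance_pos e (by simpa using he)).trans_le ?_
      exact variance_le_expectation_sq (hXm.inner aestronglyMeasurable_const)
  obtain ⟨κ, hκ, hκ'⟩ := hpos
  refine ⟨κ, hκ, fun v => ?_⟩
  rcases eq_or_ne v 0 with rfl | hv
  · simp
  · have hn : ‖v‖ ≠ 0 := norm_ne_zero_iff.2 hv
    have := hκ' (‖v‖⁻¹ • v) (by simp [norm_smul, hn])
    simp_rw [inner_smul_right, mul_pow] at this
    rw [integral_const_mul] at this
    calc κ * ‖v‖ ^ 2 ≤ ((‖v‖⁻¹) ^ 2 * ∫ ω, inner ℝ (X ω) v ^ 2 ∂P) * ‖v‖ ^ 2 := by gcongr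
      _ = _ := by field_simp

theorem integrable_sigmoid_mul_inner (h : BoundedLogistic P X Y θs R)
    (θ v : EuclideanSpace ℝ (Fin d)) :
    Integrable (fun ω => Real.sigmoid (inner ℝ (X ω) θ) * inner ℝ (X ω) v) P := by
  have hXm : AEStronglyMeasurable X P := h.measurable_X.aestronglyMeasurable
  refine integrable_ridge (C := 1) (B := R * ‖v‖) continuous_sigmoid (fun t => ?_) hXm
    (hXm.inner aestronglyMeasurable_const) ?_ θ
  · rw [abs_of_pos (Real.sigmoid_pos t)]
    exact Real.sigmoid_le_one t
  · filter_upwards [h.norm_le] with ω hω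
    exact (norm_inner_le_norm _ _).trans (by gcongr)

/-- The only use of the conditional law of `Y`: the factor `⟪X, v⟫` is `σ(X)`-measurable and can be
taken out of the conditional expectation of the indicator. -/
theorem integral_indicator_mul_inner (h : BoundedLogistic P X Y θs R)
    (v : EuclideanSpace ℝ (Fin d)) :
    Integrable (fun ω => inner ℝ (X ω) v * (Y ⁻¹' {1}).indicator (fun _ => (1 : ℝ)) ω) P ∧
    ∫ ω, inner ℝ (X ω) v * (Y ⁻¹' {1}).indicator (fun _ => (1 : ℝ)) ω ∂P =
      ∫ ω, Real.sigmoid (inner ℝ (X ω) θs) * inner ℝ (X ω) v ∂P := by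
  have hXm : AEStronglyMeasurable X P := h.measurable_X.aestronglyMeasurable
  have hle : MeasurableSpace.comap X inferInstance ≤ ‹MeasurableSpace Ω› :=
    h.measurable_X.comap_le
  have hset : MeasurableSet (Y ⁻¹' {1}) := h.measurable_Y (measurableSet_singleton 1)
  have hg : Integrable ((Y ⁻¹' {1}).indicator (fun _ => (1 : ℝ))) P :=
    (integrable_const _).indicator hset
  have hf : StronglyMeasurable[MeasurableSpace.comap X inferInstance]
      (fun ω => inner ℝ (X ω) v) := by
    have : Measurable fun x : EuclideanSpace ℝ (Fin d) => inner ℝ x v := by fun_prop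
    exact (this.comp (comap_measurable X)).stronglyMeasurable
  have hfg : Integrable ((fun ω => inner ℝ (X ω) v) *
      (Y ⁻¹' {1}).indicator (fun _ => (1 : ℝ))) P := by
    refine hg.bdd_mul (c := R * ‖v‖) (hXm.inner aestronglyMeasurable_const) ?_
    filter_upwards [h.norm_le] with ω hω
    exact (norm_inner_le_norm _ _).trans (by gcongr)
  refine ⟨hfg, ?_⟩
  have h1 := condExp_mul_of_stronglyMeasurable_left hf hfg hg
  have h2 := integral_condExp (μ := P) hle
    (f := (fun ω => inner ℝ (X ω) v) * (Y ⁻¹' {1}).indicator (fun _ => (1 : ℝ)))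
  change ∫ ω, ((fun ω => inner ℝ (X ω) v) * (Y ⁻¹' {1}).indicator (fun _ => (1 : ℝ))) ω ∂P = _
  rw [← h2]
  refine integral_congr_ae ?_
  filter_upwards [h1, h.model.condProb] with ω e1 e2
  rw [e1, Pi.mul_apply, e2, Real.sigmoid_def, one_div, mul_comm]

/-- For `Y = 1` and for `Y = -1` alike, the derivative of the loss in the direction `v` equals `⟪X,
v⟫ (σ ⟪X, θ⟫ - 1_{Y = 1})`, because `σ (-z) = 1 - σ z`. In the mean the indicator becomes `σ ⟪X,
θs⟫`. -/
theorem inner_gradient_risk_eq (h : BoundedLogistic P X Y θs R)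
    (θ v : EuclideanSpace ℝ (Fin d)) :
    inner ℝ (gradient (logisticRisk P X Y) θ) v =
      ∫ ω, inner ℝ (X ω) v *
        (Real.sigmoid (inner ℝ (X ω) θ) - Real.sigmoid (inner ℝ (X ω) θs)) ∂P := by
  obtain ⟨hi, he⟩ := h.integral_indicator_mul_inner v
  have h1 : ∫ ω, inner ℝ (X ω) v *
        (Real.sigmoid (inner ℝ (X ω) θ) - Real.sigmoid (inner ℝ (X ω) θs)) ∂P =
      ∫ ω, (Real.sigmoid (inner ℝ (X ω) θ) * inner ℝ (X ω) v -
        inner ℝ (X ω) v * (Y ⁻¹' {1}).indicator (fun _ => (1 : ℝ)) ω) ∂P := by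
    rw [integral_sub (h.integrable_sigmoid_mul_inner θ v) hi, he,
      ← integral_sub (h.integrable_sigmoid_mul_inner θ v) (h.integrable_sigmoid_mul_inner θs v)]
    congr 1
    ext ω
    ring
  rw [h.inner_gradient_risk, h1]
  refine integral_congr_ae ?_
  filter_upwards [h.model.values] with ω hω
  rcases hω with hω | hω
  · simp only [hω, one_smul, Set.indicator, Set.mem_preimage, Set.mem_singleton_iff, if_true]
    ring
  · have hne : ¬ ((-1 : ℝ) = 1) := by norm_num
    simp only [hω, neg_smul, one_smul, Set.indicator, Set.mem_preimage,
      Set.mem_singleton_iff, inner_neg_left, Real.sigmoid_neg, hne, if_false]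
    ring

/-- With `z = ⟪X, D⟫`, the integrand is at least `c z² / (1 + |z|)`, uniformly because `⟪X, θs⟫`
stays in a bounded set. Bounding `|z|` by `R ‖D‖` in the denominator leaves the second moment of
`⟪X, D⟫`, controlled by ellipticity. -/
theorem exists_drift (h : BoundedLogistic P X Y θs R) :
    ∃ c : ℝ, 0 < c ∧ ∀ D : EuclideanSpace ℝ (Fin d), c * (‖D‖ ^ 2 / (1 + R * ‖D‖)) ≤
      inner ℝ (gradient (logisticRisk P X Y) (θs + D)) D := by
  obtain ⟨κ, hκ, hκ'⟩ := h.exists_second_moment_ge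
  obtain ⟨c, hc, hc'⟩ := exists_sigmoid_monotone_ge (R * ‖θs‖)
  have hR := h.nonneg_R
  have hXm : AEStronglyMeasurable X P := h.measurable_X.aestronglyMeasurable
  refine ⟨c * κ, by positivity, fun D => ?_⟩
  rw [h.inner_gradient_risk_eq]
  have hsq : Integrable (fun ω => inner ℝ (X ω) D ^ 2) P := by
    refine Integrable.of_bound ((hXm.inner aestronglyMeasurable_const).pow 2) ((R * ‖D‖) ^ 2) ?_
    filter_upwards [h.norm_le] with ω hω
    rw [norm_pow]
    have : ‖inner ℝ (X ω) D‖ ≤ R * ‖D‖ := (norm_inner_le_norm _ _).trans (by gcongr)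
    gcongr
  have hint : Integrable (fun ω => inner ℝ (X ω) D *
        (Real.sigmoid (inner ℝ (X ω) (θs + D)) - Real.sigmoid (inner ℝ (X ω) θs))) P := by
    refine ((h.integrable_sigmoid_mul_inner (θs + D) D).sub
      (h.integrable_sigmoid_mul_inner θs D)).congr (Eventually.of_forall fun ω => ?_)
    simp only [Pi.sub_apply]
    ring
  have hden : 0 < 1 + R * ‖D‖ := by positivity
  calc c * κ * (‖D‖ ^ 2 / (1 + R * ‖D‖)) = c / (1 + R * ‖D‖) * (κ * ‖D‖ ^ 2) := by ring
    _ ≤ c / (1 + R * ‖D‖) * ∫ ω, inner ℝ (X ω) D ^ 2 ∂P := by gcongr; exact hκ' D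
    _ = ∫ ω, c / (1 + R * ‖D‖) * inner ℝ (X ω) D ^ 2 ∂P := (integral_const_mul _ _).symm
    _ ≤ _ := by
      refine integral_mono_ae (hsq.const_mul _) hint ?_
      filter_upwards [h.norm_le] with ω hω
      have h1 : |inner ℝ (X ω) θs| ≤ R * ‖θs‖ :=
        (abs_real_inner_le_norm _ _).trans (by gcongr)
      have h2 : |inner ℝ (X ω) D| ≤ R * ‖D‖ :=
        (abs_real_inner_le_norm _ _).trans (by gcongr)
      have h3 := hc' (inner ℝ (X ω) θs) (inner ℝ (X ω) D) h1
      rw [inner_add_right]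
      refine le_trans ?_ h3
      rw [div_mul_eq_mul_div, mul_div_assoc]
      gcongr

theorem gradient_risk_self (h : BoundedLogistic P X Y θs R) :
    gradient (logisticRisk P X Y) θs = 0 := by
  refine ext_inner_right ℝ fun v => ?_
  rw [h.inner_gradient_risk_eq]
  simp

theorem norm_gradient_risk_le (h : BoundedLogistic P X Y θs R) (θ : EuclideanSpace ℝ (Fin d)) :
    ‖gradient (logisticRisk P X Y) θ‖ ≤ R := by
  rw [gradient, LinearIsometryEquiv.norm_map]
  exact h.norm_fderiv_risk_le θ

theorem gradient_risk_zeros (h : BoundedLogistic P X Y θs R) :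
    {θ | gradient (logisticRisk P X Y) θ = 0} = {θs} := by
  ext θ
  simp only [Set.mem_ofPred_eq, Set.mem_singleton_iff]
  refine ⟨fun hθ => ?_, fun hθ => hθ ▸ h.gradient_risk_self⟩
  obtain ⟨c, hc, hc'⟩ := h.exists_drift
  have h1 := hc' (θ - θs)
  rw [add_sub_cancel, hθ, inner_zero_left] at h1
  by_contra hne
  have h2 : 0 < ‖θ - θs‖ := norm_pos_iff.2 (sub_ne_zero.2 hne)
  have := h.nonneg_R
  have : 0 < c * (‖θ - θs‖ ^ 2 / (1 + R * ‖θ - θs‖)) := by positivity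
  linarith

theorem exists_hessian_coercive (h : BoundedLogistic P X Y θs R) :
    ∃ c : ℝ, 0 < c ∧ ∀ v : EuclideanSpace ℝ (Fin d), c * ‖v‖ ^ 2 ≤
      fderiv ℝ (fderiv ℝ (logisticRisk P X Y)) θs v v := by
  obtain ⟨κ, hκ, hκ'⟩ := h.exists_second_moment_ge
  obtain ⟨c, hc, hc'⟩ := exists_sigmoid_variance_ge (R * ‖θs‖)
  have hZm := h.aestronglyMeasurable_smul
  refine ⟨c * κ, by positivity, fun v => ?_⟩
  have hb : ∀ᵐ ω ∂P, ‖inner ℝ (Y ω • X ω) v * inner ℝ (Y ω • X ω) v‖ ≤ (R * ‖v‖) ^ 2 := by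
    filter_upwards [h.norm_smul_le] with ω hω
    have : ‖inner ℝ (Y ω • X ω) v‖ ≤ R * ‖v‖ := (norm_inner_le_norm _ _).trans (by gcongr)
    rw [← sq, norm_pow]
    gcongr
  have hm : AEStronglyMeasurable
      (fun ω => inner ℝ (Y ω • X ω) v * inner ℝ (Y ω • X ω) v) P :=
    (hZm.inner aestronglyMeasurable_const).mul (hZm.inner aestronglyMeasurable_const)
  rw [h.fderiv_fderiv_risk_apply]
  calc c * κ * ‖v‖ ^ 2 ≤ c * ∫ ω, inner ℝ (X ω) v ^ 2 ∂P := by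
        rw [mul_assoc]; gcongr; exact hκ' v
    _ = ∫ ω, c * (inner ℝ (Y ω • X ω) v * inner ℝ (Y ω • X ω) v) ∂P := by
      rw [← integral_const_mul]
      refine integral_congr_ae ?_
      filter_upwards [h.model.values] with ω hω
      rcases hω with hω | hω <;> simp [hω, sq]
    _ ≤ _ := by
      refine integral_mono_ae ((Integrable.of_bound hm _ hb).const_mul c)
        (integrable_ridge (φ := fun t => Real.sigmoid t * (1 - Real.sigmoid t))
          (continuous_sigmoid.mul (continuous_const.sub continuous_sigmoid))
          abs_sigmoid_variance_le hZm hm hb θs) ?_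
      filter_upwards [h.norm_smul_le] with ω hω
      have := hc' (inner ℝ (Y ω • X ω) θs) ((abs_real_inner_le_norm _ _).trans (by gcongr))
      exact mul_le_mul_of_nonneg_right this (mul_self_nonneg _)

theorem tendsto_risk (h : BoundedLogistic P X Y θs R) :
    Tendsto (logisticRisk P X Y) (Bornology.cobounded (EuclideanSpace ℝ (Fin d))) atTop := by
  obtain ⟨c, hc, hc'⟩ := h.exists_drift
  have hR := h.nonneg_R
  -- Convexity on the line from `θs + D` to `θs + 2 D` gives `f (θs + 2 D) ≥ f (θs + D) + ⟪∇f (θs +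
  -- D), D⟫`. The first term is nonnegative and the second is bounded below by the drift.
  have hlow : ∀ D : EuclideanSpace ℝ (Fin d),
      c * (‖D‖ ^ 2 / (1 + R * ‖D‖)) ≤ logisticRisk P X Y (θs + ((2 : ℝ) • D)) := fun D => by
    have hder : HasDerivAt (fun t : ℝ => logisticRisk P X Y (θs + D + t • D))
        (inner ℝ (gradient (logisticRisk P X Y) (θs + D)) D) 0 := by
      have h1 : HasDerivAt (fun t : ℝ => θs + D + t • D) D 0 := by
        simpa using ((hasDerivAt_id (0 : ℝ)).smul_const D).const_add (θs + D)
      have h2 := (h.hasFDerivAt_risk (θs + D)).differentiableAt.hasFDerivAt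
      have h3 : θs + D = θs + D + (0 : ℝ) • D := by simp
      rw [gradient, InnerProductSpace.toDual_symm_apply]
      rw [h3] at h2
      have h4 := h2.comp_hasDerivAt (0 : ℝ) h1
      rwa [← h3] at h4
    have hcv : ConvexOn ℝ Set.univ (fun t : ℝ => logisticRisk P X Y (θs + D + t • D)) := by
      have := h.convexOn_risk.comp_affineMap (AffineMap.lineMap (θs + D) (θs + D + D))
      refine this.congr fun t _ => ?_
      simp [AffineMap.lineMap_apply, add_comm]
    have := hcv.le_slope_of_hasDerivAt (x := 0) (y := 1) trivial trivial one_pos hder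
    rw [slope_def_field] at this
    have h5 : θs + (2 : ℝ) • D = θs + D + (1 : ℝ) • D := by rw [two_smul, one_smul, add_assoc]
    have h6 := risk_nonneg (P := P) (X := X) (Y := Y) (θs + D + (0 : ℝ) • D)
    rw [h5]
    have h7 := hc' D
    simp only [sub_zero, div_one] at this
    linarith
  have hnorm : Tendsto (fun θ : EuclideanSpace ℝ (Fin d) => ‖(2 : ℝ)⁻¹ • (θ - θs)‖)
      (Bornology.cobounded _) atTop := by
    simp_rw [norm_smul]
    refine Tendsto.const_mul_atTop (by norm_num) ?_
    refine tendsto_atTop_mono (fun θ => norm_sub_norm_le θ θs) ?_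
    exact tendsto_atTop_add_const_right _ _ tendsto_norm_cobounded_atTop
  have hreal : Tendsto (fun t : ℝ => c / (1 + R) * t) atTop atTop :=
    tendsto_id.const_mul_atTop (by positivity)
  refine tendsto_atTop_mono' _ ?_ (hreal.comp hnorm)
  filter_upwards [hnorm.eventually_ge_atTop 1] with θ hθ
  have h1 := hlow ((2 : ℝ)⁻¹ • (θ - θs))
  rw [smul_smul, mul_inv_cancel₀ two_ne_zero, one_smul, add_sub_cancel] at h1
  refine le_trans ?_ h1
  simp only [Function.comp_apply]
  set t := ‖(2 : ℝ)⁻¹ • (θ - θs)‖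
  have ht : 0 ≤ t := zero_le_one.trans hθ
  have h2 : t / (1 + R) ≤ t ^ 2 / (1 + R * t) := by
    rw [div_le_div_iff₀ (by positivity) (by positivity)]
    nlinarith
  calc c / (1 + R) * t = c * (t / (1 + R)) := by ring
    _ ≤ _ := by gcongr

theorem exists_eventually_norm_gradient_ge (h : BoundedLogistic P X Y θs R) :
    ∃ c : ℝ, 0 < c ∧ ∀ᶠ θ in Bornology.cobounded (EuclideanSpace ℝ (Fin d)),
      c ≤ ‖gradient (logisticRisk P X Y) θ‖ := by
  obtain ⟨c, hc, hc'⟩ := h.exists_drift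
  have hR := h.nonneg_R
  have hnorm : Tendsto (fun θ : EuclideanSpace ℝ (Fin d) => ‖θ - θs‖)
      (Bornology.cobounded _) atTop := by
    refine tendsto_atTop_mono (fun θ => norm_sub_norm_le θ θs) ?_
    exact tendsto_atTop_add_const_right _ _ tendsto_norm_cobounded_atTop
  refine ⟨c / (1 + R), by positivity, ?_⟩
  filter_upwards [hnorm.eventually_ge_atTop 1] with θ hθ
  have h1 := hc' (θ - θs)
  rw [add_sub_cancel] at h1
  have h2 := h1.trans (real_inner_le_norm _ _)
  set t := ‖θ - θs‖
  set G := ‖gradient (logisticRisk P X Y) θ‖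
  have ht : 0 < t := by linarith
  have h3 : c * (t / (1 + R * t)) ≤ G := by
    refine le_of_mul_le_mul_right ?_ ht
    calc c * (t / (1 + R * t)) * t = c * (t ^ 2 / (1 + R * t)) := by ring
      _ ≤ G * t := h2
  refine le_trans ?_ h3
  rw [div_eq_mul_one_div]
  gcongr c * ?_
  rw [div_le_div_iff₀ (by positivity) (by positivity)]
  nlinarith

theorem isUnit_hessian (h : BoundedLogistic P X Y θs R) :
    IsUnit (hessian (logisticRisk P X Y) θs) := by
  rw [← Matrix.mulVec_injective_iff_isUnit]
  refine (injective_iff_map_eq_zero (Matrix.mulVecLin (hessian (logisticRisk P X Y) θs))).2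
    fun v hv => ?_
  obtain ⟨c, hc, hc'⟩ := h.exists_hessian_coercive
  have h1 := hc' (WithLp.toLp 2 v)
  have h2 := inner_hessian_mulVec (logisticRisk P X Y) θs (WithLp.toLp 2 v) (WithLp.toLp 2 v)
  rw [Matrix.mulVecLin_apply] at hv
  simp only [hv, WithLp.toLp_zero, inner_zero_right] at h2
  rw [← h2] at h1
  have h3 : ‖(WithLp.toLp 2 v : EuclideanSpace ℝ (Fin d))‖ = 0 := by
    have := sq_nonneg ‖(WithLp.toLp 2 v : EuclideanSpace ℝ (Fin d))‖
    rw [← sq_eq_zero_iff]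
    nlinarith
  simpa using h3

/-- For `r = 0` the factor `(f θ - f θs) ^ (-r)` is 1, so both conditions at infinity reduce to
bounds on `‖∇f‖` alone. -/
theorem globalKL (h : BoundedLogistic P X Y θs R) :
    GlobalKL 0 (logisticRisk P X Y) θs where
  exponent_mem := by norm_num
  contDiff := h.contDiff_risk
  hessian_bounded := ⟨_, h.norm_fderiv_fderiv_risk_le⟩
  hessian_lipschitz := ⟨_, h.lipschitzWith_fderiv_fderiv_risk⟩
  hessian_invertible := h.isUnit_hessian
  liminf_pos := by
    obtain ⟨c, hc, hc'⟩ := h.exists_eventually_norm_gradient_ge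
    refine (ENNReal.ofReal_pos.2 hc).trans_le (le_liminf_of_le (by isBoundedDefault) ?_)
    filter_upwards [hc'] with θ hθ
    simpa using ENNReal.ofReal_le_ofReal hθ
  limsup_lt_top := by
    refine lt_of_le_of_lt (limsup_le_of_le (by isBoundedDefault)
      (Eventually.of_forall fun θ => ?_)) (ENNReal.ofReal_lt_top (r := R))
    simpa using ENNReal.ofReal_le_ofReal (h.norm_gradient_risk_le θ)

end BoundedLogistic

end LogisticSGD
end

noncomputable section
namespace LogisticSGD

/-! ### Samples and functions of the past -/

section Past

variable {S Ω : Type*} [MeasurableSpace S]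

/-- The `σ`-algebra generated by the observations `W 0, …, W (n - 1)`. -/
@[reducible] def past (W : ℕ → Ω → S) (n : ℕ) : MeasurableSpace Ω :=
  ⨆ k ∈ Set.Iio n, MeasurableSpace.comap (W k) inferInstance

/-- `W` is a sequence of independent observations of law `μ`. -/
structure IsSample [MeasurableSpace Ω] (P : Measure Ω) (W : ℕ → Ω → S) (μ : Measure S) : Prop where
  measurable : ∀ n, Measurable (W n)
  indep : iIndepFun W P
  law : ∀ n, P.map (W n) = μ

/-- Bounded random vectors that are functions of the first `n` observations. -/
structure PastBounded {F : Type*} [NormedAddCommGroup F] [MeasurableSpace F] (W : ℕ → Ω → S)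
    (n : ℕ) (V : Ω → F) : Prop where
  measurable : Measurable[past W n] V
  bounded : ∃ C : ℝ, ∀ ω, ‖V ω‖ ≤ C

theorem past_mono {W : ℕ → Ω → S} {m n : ℕ} (h : m ≤ n) : past W m ≤ past W n :=
  biSup_mono fun _ hk => lt_of_lt_of_le hk h

theorem measurable_past_succ {W : ℕ → Ω → S} (n : ℕ) : Measurable[past W (n + 1)] (W n) := by
  have h : MeasurableSpace.comap (W n) inferInstance ≤ past W (n + 1) :=
    le_biSup (fun k => MeasurableSpace.comap (W k) inferInstance)
      (show n ∈ Set.Iio (n + 1) from Nat.lt_succ_self n)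
  exact (comap_measurable (W n)).mono h le_rfl

theorem IsSample.past_le [mΩ : MeasurableSpace Ω] {P : Measure Ω} {W : ℕ → Ω → S} {μ : Measure S}
    (hW : IsSample P W μ)
    (n : ℕ) : past W n ≤ mΩ :=
  iSup₂_le fun k _ => (hW.measurable k).comap_le

theorem IsSample.isProbabilityMeasure [MeasurableSpace Ω] {P : Measure Ω} [IsProbabilityMeasure P]
    {W : ℕ → Ω → S}
    {μ : Measure S} (hW : IsSample P W μ) : IsProbabilityMeasure μ :=
  hW.law 0 ▸ Measure.isProbabilityMeasure_map (hW.measurable 0).aemeasurable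

theorem IsSample.indepFun {T : Type*} [MeasurableSpace T] [MeasurableSpace Ω] {P : Measure Ω}
    {W : ℕ → Ω → S}
    {μ : Measure S} (hW : IsSample P W μ) {n : ℕ} {V : Ω → T} (hV : Measurable[past W n] V) :
    IndepFun V (W n) P := by
  have h1 : iIndep (fun k => MeasurableSpace.comap (W k) inferInstance) P :=
    (iIndepFun_iff_iIndep _ _ _).1 hW.indep
  have h2 := indep_iSup_of_disjoint (fun k => (hW.measurable k).comap_le) h1
    (S := Set.Iio n) (T := {n}) (by simp)
  rw [IndepFun_iff_Indep]
  refine indep_of_indep_of_le_left (indep_of_indep_of_le_right h2 ?_) ?_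
  · simp
  · exact hV.comap_le

/-- Freezing lemma: `V` depends on the past and is independent of `W n`, so the joint law is a
product and Fubini applies. It plays the role of conditioning on the past throughout. -/
theorem IsSample.integral_comp {T F : Type*} [MeasurableSpace T] [MeasurableSpace Ω]
    [NormedAddCommGroup F]
    [NormedSpace ℝ F] [MeasurableSpace F] [BorelSpace F] [SecondCountableTopology F]
    {P : Measure Ω} [IsProbabilityMeasure P] {W : ℕ → Ω → S} {μ : Measure S}
    (hW : IsSample P W μ) {n : ℕ} {V : Ω → T} (hV : Measurable[past W n] V) {h : T → S → F}
    (hm : Measurable (Function.uncurry h)) (hint : Integrable (fun ω => h (V ω) (W n ω)) P) :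
    ∫ ω, h (V ω) (W n ω) ∂P = ∫ ω, ∫ w, h (V ω) w ∂μ ∂P := by
  have hV' : Measurable V := hV.mono (hW.past_le n) le_rfl
  have := hW.isProbabilityMeasure
  have hprod := (indepFun_iff_map_prod_eq_prod_map_map hV'.aemeasurable
    (hW.measurable n).aemeasurable).1 (hW.indepFun hV)
  rw [hW.law n] at hprod
  have : IsProbabilityMeasure (P.map V) := Measure.isProbabilityMeasure_map hV'.aemeasurable
  have hpair : AEMeasurable (fun ω => (V ω, W n ω)) P :=
    (hV'.prodMk (hW.measurable n)).aemeasurable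
  have hint' : Integrable (Function.uncurry h) ((P.map V).prod μ) := by
    rw [← hprod]
    exact (integrable_map_measure hm.aestronglyMeasurable hpair).2 hint
  calc ∫ ω, h (V ω) (W n ω) ∂P
      = ∫ z, Function.uncurry h z ∂(P.map fun ω => (V ω, W n ω)) :=
        (integral_map hpair hm.aestronglyMeasurable).symm
    _ = ∫ z, Function.uncurry h z ∂((P.map V).prod μ) := by rw [hprod]
    _ = ∫ t, ∫ w, h t w ∂μ ∂(P.map V) := integral_prod _ hint'
    _ = _ := integral_map hV'.aemeasurable
        (hm.stronglyMeasurable.integral_prod_right).aestronglyMeasurable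

namespace PastBounded

variable {F : Type*} [NormedAddCommGroup F] [MeasurableSpace F] [BorelSpace F]
  [SecondCountableTopology F] {W : ℕ → Ω → S} {n m : ℕ} {U V : Ω → F}

omit [BorelSpace F] [SecondCountableTopology F] in
theorem mono (hV : PastBounded W m V) (h : m ≤ n) : PastBounded W n V :=
  ⟨hV.measurable.mono (past_mono h) le_rfl, hV.bounded⟩

omit [BorelSpace F] [SecondCountableTopology F] in
theorem const (v : F) : PastBounded W n (fun _ => v) :=
  ⟨measurable_const, ‖v‖, fun _ => le_rfl⟩

theorem add (hU : PastBounded W n U) (hV : PastBounded W n V) :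
    PastBounded W n (fun ω => U ω + V ω) := by
  obtain ⟨B, hB⟩ := hU.bounded
  obtain ⟨C, hC⟩ := hV.bounded
  exact ⟨hU.measurable.add hV.measurable, B + C,
    fun ω => (norm_add_le _ _).trans (add_le_add (hB ω) (hC ω))⟩

theorem sub (hU : PastBounded W n U) (hV : PastBounded W n V) :
    PastBounded W n (fun ω => U ω - V ω) := by
  obtain ⟨B, hB⟩ := hU.bounded
  obtain ⟨C, hC⟩ := hV.bounded
  exact ⟨hU.measurable.sub hV.measurable, B + C,
    fun ω => (norm_sub_le _ _).trans (add_le_add (hB ω) (hC ω))⟩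

theorem sum {ι : Type*} {s : Finset ι} {f : ι → Ω → F} (hf : ∀ i ∈ s, PastBounded W n (f i)) :
    PastBounded W n (fun ω => ∑ i ∈ s, f i ω) := by
  classical
  induction s using Finset.induction_on with
  | empty => simpa using const (0 : F)
  | insert i s hi ih =>
    simp_rw [Finset.sum_insert hi]
    exact (hf i (Finset.mem_insert_self i s)).add
      (ih fun j hj => hf j (Finset.mem_insert_of_mem hj))

theorem smul [NormedSpace ℝ F] {a : Ω → ℝ} (ha : PastBounded W n a) (hV : PastBounded W n V) :
    PastBounded W n (fun ω => a ω • V ω) := by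
  obtain ⟨B, hB⟩ := ha.bounded
  obtain ⟨C, hC⟩ := hV.bounded
  refine ⟨ha.measurable.smul hV.measurable, B * C, fun ω => ?_⟩
  rw [norm_smul]
  exact mul_le_mul (hB ω) (hC ω) (norm_nonneg _) ((norm_nonneg _).trans (hB ω))

theorem const_smul [NormedSpace ℝ F] (a : ℝ) (hV : PastBounded W n V) :
    PastBounded W n (fun ω => a • V ω) := (const a).smul hV

omit [SecondCountableTopology F] in
theorem norm (hV : PastBounded W n V) : PastBounded W n (fun ω => ‖V ω‖) := by
  obtain ⟨C, hC⟩ := hV.bounded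
  exact ⟨measurable_norm.comp hV.measurable, C, fun ω => by rw [norm_norm]; exact hC ω⟩

theorem pow {a : Ω → ℝ} (ha : PastBounded W n a) (k : ℕ) :
    PastBounded W n (fun ω => a ω ^ k) := by
  obtain ⟨C, hC⟩ := ha.bounded
  refine ⟨ha.measurable.pow_const k, C ^ k, fun ω => ?_⟩
  rw [norm_pow]
  exact pow_le_pow_left₀ (norm_nonneg _) (hC ω) k

theorem inner [InnerProductSpace ℝ F] (hU : PastBounded W n U) (hV : PastBounded W n V) :
    PastBounded W n (fun ω => inner ℝ (U ω) (V ω)) := by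
  obtain ⟨B, hB⟩ := hU.bounded
  obtain ⟨C, hC⟩ := hV.bounded
  refine ⟨hU.measurable.inner hV.measurable, B * C, fun ω => ?_⟩
  exact (norm_inner_le_norm _ _).trans
    (mul_le_mul (hB ω) (hC ω) (norm_nonneg _) ((norm_nonneg _).trans (hB ω)))

omit [SecondCountableTopology F] in
theorem clm {F' : Type*} [NormedAddCommGroup F'] [NormedSpace ℝ F'] [MeasurableSpace F']
    [BorelSpace F'] [NormedSpace ℝ F] (L : F →L[ℝ] F') (hV : PastBounded W n V) :
    PastBounded W n (fun ω => L (V ω)) := by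
  obtain ⟨C, hC⟩ := hV.bounded
  exact ⟨L.measurable.comp hV.measurable, ‖L‖ * C,
    fun ω => (L.le_opNorm _).trans (mul_le_mul_of_nonneg_left (hC ω) (norm_nonneg _))⟩

/-- Continuous functions preserve boundedness since closed balls are compact. -/
theorem continuous_comp {f : ℝ → ℝ} (hf : Continuous f) {a : Ω → ℝ} (ha : PastBounded W n a) :
    PastBounded W n (fun ω => f (a ω)) := by
  obtain ⟨C, hC⟩ := ha.bounded
  obtain ⟨B, hB⟩ := (isCompact_Icc (a := -C) (b := C)).exists_bound_of_continuousOn hf.continuousOn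
  exact ⟨hf.measurable.comp ha.measurable, B, fun ω => hB _ (abs_le.1 (hC ω))⟩

theorem integrable [MeasurableSpace Ω] {P : Measure Ω} [IsProbabilityMeasure P] {μ : Measure S}
    (hV : PastBounded W n V) (hW : IsSample P W μ) : Integrable V P := by
  obtain ⟨C, hC⟩ := hV.bounded
  exact Integrable.of_bound
    (hV.measurable.mono (hW.past_le n) le_rfl).aestronglyMeasurable C (Eventually.of_forall hC)

end PastBounded

end Past

end LogisticSGD
end

noncomputable section
namespace LogisticSGD

set_option linter.unusedSectionVars false

/-! ### Stochastic approximation with a bounded field -/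

/-- A bounded stochastic field `g θ w` with mean `∫ w, g θ w ∂μ` vanishing at `θs`, linearized there
by the coercive operator `H` with left inverse `A`. -/
structure StochasticField {E S : Type*} [NormedAddCommGroup E] [InnerProductSpace ℝ E]
    [MeasurableSpace E] [MeasurableSpace S] (μ : Measure S) (g : E → S → E) (H A : E →L[ℝ] E)
    (θs : E) (R c κ K : ℝ) : Prop where
  measurable : Measurable (Function.uncurry g)
  R_pos : 0 < R
  norm_le : ∀ θ w, ‖g θ w‖ ≤ R
  c_pos : 0 < c
  drift : ∀ θ, c * (‖θ - θs‖ ^ 2 / √(1 + ‖θ - θs‖ ^ 2)) ≤ inner ℝ (θ - θs) (∫ w, g θ w ∂μ)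
  κ_pos : 0 < κ
  coercive : ∀ v, κ * ‖v‖ ^ 2 ≤ inner ℝ v (H v)
  K_nonneg : 0 ≤ K
  remainder : ∀ θ, ‖∫ w, g θ w ∂μ - H (θ - θs)‖ ≤ K * ‖θ - θs‖ ^ 2
  lipschitz : ∀ θ w, ‖g θ w - g θs w‖ ≤ K * ‖θ - θs‖
  left_inv : ∀ v, A (H v) = v

variable {E S Ω : Type*} [NormedAddCommGroup E] [InnerProductSpace ℝ E]

/-- The recursion `θ (n + 1) = θ n - γ (n + 1) ^ (- 3 / 4) g (θ n, W n)`. -/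
def iterate (g : E → S → E) (γ : ℝ) (θ₀ : E) (W : ℕ → Ω → S) : ℕ → Ω → E
  | 0 => fun _ => θ₀
  | n + 1 => fun ω => iterate g γ θ₀ W n ω
      - (γ * stepProfile n) • g (iterate g γ θ₀ W n ω) (W n ω)

section

variable [MeasurableSpace S]

/-- The martingale increment `∫ g (θ n, w) dμ(w) - g (θ n, W n)`. -/
def increment (μ : Measure S) (g : E → S → E) (γ : ℝ) (θ₀ : E) (W : ℕ → Ω → S) (n : ℕ) (ω : Ω) :
    E :=
  ∫ w, g (iterate g γ θ₀ W n ω) w ∂μ - g (iterate g γ θ₀ W n ω) (W n ω)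

/-- The martingale, sum of the increments. -/
def martingaleSum (μ : Measure S) (g : E → S → E) (γ : ℝ) (θ₀ : E) (W : ℕ → Ω → S) (n : ℕ)
    (ω : Ω) : E :=
  ∑ k ∈ Finset.range n, increment μ g γ θ₀ W k ω

/-- The error of the linearization of the mean field at `θ n`. -/
def linError (μ : Measure S) (g : E → S → E) (H : E →L[ℝ] E) (θs : E) (γ : ℝ) (θ₀ : E)
    (W : ℕ → Ω → S) (n : ℕ) (ω : Ω) : E :=
  ∫ w, g (iterate g γ θ₀ W n ω) w ∂μ - H (iterate g γ θ₀ W n ω - θs)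

end

variable [FiniteDimensional ℝ E] [MeasurableSpace E] [BorelSpace E] [MeasurableSpace S]
  [MeasurableSpace Ω] {P : Measure Ω} [IsProbabilityMeasure P] {μ : Measure S}
  {g : E → S → E} {H A : E →L[ℝ] E} {θs : E} {R c κ K γ : ℝ} {θ₀ : E} {W : ℕ → Ω → S}

namespace StochasticField

theorem norm_mean_le [IsProbabilityMeasure μ] (h : StochasticField μ g H A θs R c κ K) (θ : E) :
    ‖∫ w, g θ w ∂μ‖ ≤ R := by
  simpa using norm_integral_le_of_norm_le_const (μ := μ) (Eventually.of_forall (h.norm_le θ))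

theorem measurable_mean [IsProbabilityMeasure μ] (h : StochasticField μ g H A θs R c κ K) :
    Measurable fun θ => ∫ w, g θ w ∂μ :=
  (h.measurable.stronglyMeasurable.integral_prod_right).measurable

theorem integrable [IsProbabilityMeasure μ] (h : StochasticField μ g H A θs R c κ K) (θ : E) :
    Integrable (g θ) μ :=
  Integrable.of_bound (h.measurable.comp measurable_prodMk_left).aestronglyMeasurable R
    (Eventually.of_forall (h.norm_le θ))

/-- The linearization error is bounded by a multiple of `‖θ - θs‖²`, which is zero at `θs`. -/
theorem mean_self (h : StochasticField μ g H A θs R c κ K) : ∫ w, g θs w ∂μ = 0 := by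
  have := h.remainder θs
  simpa using this

/-- Since the field is bounded, each iterate is bounded by a deterministic constant. The constant
depends on `n`, but it settles all questions of integrability. -/
theorem pastBounded_iterate (h : StochasticField μ g H A θs R c κ K) (n : ℕ) :
    PastBounded W n (iterate g γ θ₀ W n) := by
  induction n with
  | zero => exact PastBounded.const θ₀
  | succ n ih =>
    have ih' := ih.mono (Nat.le_succ n)
    refine ih'.sub (PastBounded.const_smul _ ⟨?_, R, fun ω => h.norm_le _ _⟩)
    exact h.measurable.comp (ih'.measurable.prodMk (measurable_past_succ n))

theorem pastBounded_error (h : StochasticField μ g H A θs R c κ K) (n : ℕ) :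
    PastBounded W n (fun ω => iterate g γ θ₀ W n ω - θs) :=
  (h.pastBounded_iterate n).sub (PastBounded.const θs)

theorem pastBounded_field (h : StochasticField μ g H A θs R c κ K) (n : ℕ) :
    PastBounded W (n + 1) (fun ω => g (iterate g γ θ₀ W n ω) (W n ω)) :=
  ⟨h.measurable.comp (((h.pastBounded_iterate n).mono (Nat.le_succ n)).measurable.prodMk
    (measurable_past_succ n)), R, fun _ => h.norm_le _ _⟩

theorem pastBounded_mean [IsProbabilityMeasure μ] (h : StochasticField μ g H A θs R c κ K)
    (n : ℕ) : PastBounded W n (fun ω => ∫ w, g (iterate g γ θ₀ W n ω) w ∂μ) :=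
  ⟨h.measurable_mean.comp (h.pastBounded_iterate n).measurable, R, fun _ => h.norm_mean_le _⟩

theorem pastBounded_increment [IsProbabilityMeasure μ] (h : StochasticField μ g H A θs R c κ K)
    (n : ℕ) : PastBounded W (n + 1) (increment μ g γ θ₀ W n) :=
  ((h.pastBounded_mean n).mono (Nat.le_succ n)).sub (h.pastBounded_field n)

theorem pastBounded_martingaleSum [IsProbabilityMeasure μ]
    (h : StochasticField μ g H A θs R c κ K) (n : ℕ) :
    PastBounded W n (martingaleSum μ g γ θ₀ W n) :=
  PastBounded.sum fun k hk => (h.pastBounded_increment k).mono (Finset.mem_range.1 hk)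

theorem pastBounded_linError [IsProbabilityMeasure μ] (h : StochasticField μ g H A θs R c κ K)
    (n : ℕ) : PastBounded W n (linError μ g H θs γ θ₀ W n) :=
  (h.pastBounded_mean n).sub ((h.pastBounded_error n).clm H)

theorem norm_increment_le [IsProbabilityMeasure μ] (h : StochasticField μ g H A θs R c κ K)
    (n : ℕ) (ω : Ω) : ‖increment μ g γ θ₀ W n ω‖ ≤ 2 * R := by
  have h1 := h.norm_mean_le (iterate g γ θ₀ W n ω)
  have h2 := h.norm_le (iterate g γ θ₀ W n ω) (W n ω)
  exact (norm_sub_le _ _).trans (by linarith)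

/-- The increments are orthogonal to the past. -/
theorem integral_inner_increment (h : StochasticField μ g H A θs R c κ K)
    (hW : IsSample P W μ) {n : ℕ} {V : Ω → E} (hV : PastBounded W n V) :
    ∫ ω, inner ℝ (V ω) (increment μ g γ θ₀ W n ω) ∂P = 0 := by
  have := hW.isProbabilityMeasure
  have hT : Measurable[past W n] fun ω => (V ω, iterate g γ θ₀ W n ω) :=
    hV.measurable.prodMk (h.pastBounded_iterate n).measurable
  have hm : Measurable (Function.uncurry fun (p : E × E) (w : S) =>
      inner ℝ p.1 (∫ w, g p.2 w ∂μ - g p.2 w)) := by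
    have h1 : Measurable fun z : (E × E) × S => z.1.2 := measurable_snd.comp measurable_fst
    have h2 : Measurable fun z : (E × E) × S => z.1.1 := measurable_fst.comp measurable_fst
    exact h2.inner ((h.measurable_mean.comp h1).sub
      (h.measurable.comp (h1.prodMk measurable_snd)))
  have hint := (((hV.mono (Nat.le_succ n)).inner
    (h.pastBounded_increment (γ := γ) (θ₀ := θ₀) n)).integrable hW)
  have key := hW.integral_comp hT hm hint
  refine key.trans ?_
  have hz : ∀ ω, ∫ w, inner ℝ (V ω) (∫ w, g (iterate g γ θ₀ W n ω) w ∂μ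
      - g (iterate g γ θ₀ W n ω) w) ∂μ = 0 := fun ω => by
    have hi : Integrable (fun w => ∫ w, g (iterate g γ θ₀ W n ω) w ∂μ
        - g (iterate g γ θ₀ W n ω) w) μ := (integrable_const _).sub (h.integrable _)
    rw [integral_inner hi, integral_sub (integrable_const _) (h.integrable _)]
    simp
  simp only [hz, integral_zero]

theorem integral_smul_increment (h : StochasticField μ g H A θs R c κ K)
    (hW : IsSample P W μ) {n : ℕ} {a : Ω → ℝ} (ha : PastBounded W n a) :
    ∫ ω, a ω • increment μ g γ θ₀ W n ω ∂P = 0 := by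
  have := hW.isProbabilityMeasure
  have hint := (((ha.mono (Nat.le_succ n)).smul
    (h.pastBounded_increment (γ := γ) (θ₀ := θ₀) n)).integrable hW)
  refine ext_inner_left ℝ fun v => ?_
  rw [← integral_inner hint, inner_zero_right]
  refine Eq.trans ?_ (h.integral_inner_increment (γ := γ) (θ₀ := θ₀) hW
    (ha.smul (PastBounded.const v)))
  simp only [inner_smul_left, inner_smul_right, conj_trivial]

theorem integral_inner_clm_increment (h : StochasticField μ g H A θs R c κ K)
    (hW : IsSample P W μ) {n : ℕ} {V : Ω → E} (hV : PastBounded W n V) (L : E →L[ℝ] E) :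
    ∫ ω, inner ℝ (V ω) (L (increment μ g γ θ₀ W n ω)) ∂P = 0 := by
  refine Eq.trans ?_ (h.integral_inner_increment (γ := γ) (θ₀ := θ₀) hW
    (hV.clm (ContinuousLinearMap.adjoint L)))
  simp only [ContinuousLinearMap.adjoint_inner_left]

/-! ### Fourth moment of the error -/

/-- Expectation of `lyapunov_step`: the field is its mean minus a martingale increment, the mean
contracts by the drift, and the increment is orthogonal to the past. -/
theorem integral_lyapunov_succ_le (h : StochasticField μ g H A θs R c κ K)
    (hW : IsSample P W μ) {n : ℕ} (hγ : 0 ≤ γ * stepProfile n) (hγ1 : γ * stepProfile n ≤ 1)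
    (hγ2 : γ * stepProfile n * R + γ * stepProfile n * R ^ 2 ≤ 1)
    (hγ3 : (25 * R ^ 2 + 5 * R ^ 4) * (γ * stepProfile n) ≤ c / 4) :
    ∫ ω, lyapunov (‖iterate g γ θ₀ W (n + 1) ω - θs‖ ^ 2) ^ 2 ∂P ≤
      (1 - c / 2 * (γ * stepProfile n)) *
        ∫ ω, lyapunov (‖iterate g γ θ₀ W n ω - θs‖ ^ 2) ^ 2 ∂P +
      ((25 * R ^ 2 + 5 * R ^ 4) ^ 2 / c + 4 * R ^ 4) * (γ * stepProfile n) ^ 3 := by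
  have := hW.isProbabilityMeasure
  have hc := h.c_pos
  have hlc : Continuous lyapunov := by unfold lyapunov; fun_prop
  set B := 25 * R ^ 2 + 5 * R ^ 4 with hB
  have hB0 : 0 ≤ B := by positivity
  set δ := γ * stepProfile n with hδ
  set D : Ω → E := fun ω => iterate g γ θ₀ W n ω - θs with hD
  set Z : Ω → ℝ := fun ω => lyapunov (‖D ω‖ ^ 2) with hZ
  have hDb : PastBounded W n D := h.pastBounded_error n
  have hZb : PastBounded W n Z := PastBounded.continuous_comp hlc (hDb.norm.pow 2)
  -- `V` is half the gradient of `Z ^ 2` as a function of `D`.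
  set V : Ω → E := fun ω => (Z ω * (1 + Z ω) * (√(1 + ‖D ω‖ ^ 2))⁻¹) • D ω with hV
  have hVb : PastBounded W n V := by
    have h1 : PastBounded W n fun ω => (√(1 + ‖D ω‖ ^ 2))⁻¹ := by
      have hcont : Continuous fun x : ℝ => (√(1 + x ^ 2))⁻¹ :=
        Continuous.inv₀ (by fun_prop) fun x => by positivity
      exact PastBounded.continuous_comp hcont hDb.norm
    exact ((hZb.smul ((PastBounded.const (1 : ℝ)).add hZb)).smul h1).smul hDb
  have hZ2 : Integrable (fun ω => Z ω ^ 2) P := (hZb.pow 2).integrable hW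
  have hInc := h.integral_inner_increment (γ := γ) (θ₀ := θ₀) hW hVb
  have hIncInt : Integrable (fun ω => inner ℝ (V ω) (increment μ g γ θ₀ W n ω)) P :=
    ((hVb.mono (Nat.le_succ n)).inner (h.pastBounded_increment n)).integrable hW
  have hlhs : Integrable (fun ω => lyapunov (‖iterate g γ θ₀ W (n + 1) ω - θs‖ ^ 2) ^ 2) P :=
    ((PastBounded.continuous_comp hlc ((h.pastBounded_error (n + 1)).norm.pow 2)).pow 2).integrable
      hW
  have hpt : ∀ ω, lyapunov (‖iterate g γ θ₀ W (n + 1) ω - θs‖ ^ 2) ^ 2 ≤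
      ((1 - c / 2 * δ) * Z ω ^ 2 + (B ^ 2 / c + 4 * R ^ 4) * δ ^ 3)
        + 2 * δ * inner ℝ (V ω) (increment μ g γ θ₀ W n ω) := by
    intro ω
    have e1 : iterate g γ θ₀ W (n + 1) ω - θs = D ω - δ • g (iterate g γ θ₀ W n ω) (W n ω) := by
      simp only [iterate, hD, hδ]
      abel
    have hstep := lyapunov_step (D := D ω) hγ hγ1 hγ2 (h.norm_le (iterate g γ θ₀ W n ω) (W n ω))
    rw [e1]
    refine hstep.trans ?_
    have hu : 0 ≤ ‖D ω‖ ^ 2 := sq_nonneg _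
    have hz : 0 ≤ Z ω := lyapunov_nonneg hu
    have hcomp := (lyapunov_comparison hu).1
    change _ ≤ 2 * ((1 + Z ω) * _) at hcomp
    change Z ω ≤ _ at hcomp
    have hdr := h.drift (iterate g γ θ₀ W n ω)
    have e2 : inner ℝ (V ω) (increment μ g γ θ₀ W n ω) = Z ω * (1 + Z ω) *
        (inner ℝ (D ω) (∫ w, g (iterate g γ θ₀ W n ω) w ∂μ) / √(1 + ‖D ω‖ ^ 2))
        - Z ω * (1 + Z ω) *
        (inner ℝ (D ω) (g (iterate g γ θ₀ W n ω) (W n ω)) / √(1 + ‖D ω‖ ^ 2)) := by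
      simp only [hV, increment, inner_smul_left, inner_sub_right, conj_trivial]
      ring
    rw [e2]
    change c * (‖D ω‖ ^ 2 / √(1 + ‖D ω‖ ^ 2)) ≤ inner ℝ (D ω) _ at hdr
    have hs : 0 < √(1 + ‖D ω‖ ^ 2) := Real.sqrt_pos.2 (by positivity)
    have hdr2 : c * (‖D ω‖ ^ 2 / (1 + ‖D ω‖ ^ 2)) ≤
        inner ℝ (D ω) (∫ w, g (iterate g γ θ₀ W n ω) w ∂μ) / √(1 + ‖D ω‖ ^ 2) := by
      rw [le_div_iff₀ hs]
      refine le_trans (le_of_eq ?_) hdr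
      have hsq := Real.mul_self_sqrt (show 0 ≤ 1 + ‖D ω‖ ^ 2 by positivity)
      generalize √(1 + ‖D ω‖ ^ 2) = s at *
      rw [← hsq]
      field_simp
    generalize inner ℝ (D ω) (∫ w, g (iterate g γ θ₀ W n ω) w ∂μ) / √(1 + ‖D ω‖ ^ 2) = a at *
    generalize inner ℝ (D ω) (g (iterate g γ θ₀ W n ω) (W n ω)) / √(1 + ‖D ω‖ ^ 2) = b at *
    change Z ω ^ 2 - 2 * δ * (Z ω * (1 + Z ω)) * b + B * δ ^ 2 * (Z ω + Z ω ^ 2)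
      + 4 * R ^ 4 * δ ^ 4 ≤ _
    generalize Z ω = z at *
    generalize ‖D ω‖ ^ 2 / (1 + ‖D ω‖ ^ 2) = q at *
    have i1 : c * z ^ 2 ≤ 2 * (z * (1 + z)) * a := by
      calc c * z ^ 2 = c * (z * z) := by ring
        _ ≤ c * (z * (2 * ((1 + z) * q))) := by gcongr
        _ = 2 * (z * (1 + z)) * (c * q) := by ring
        _ ≤ _ := by gcongr
    -- The drift provides `c δ z²`. One quarter of it pays for the term in `δ² z²`, another quarter
    -- for the term in `δ² z` through Young's inequality, which leaves the remainder `B² / c δ³`.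
    -- Half of the drift remains.
    have i2 : δ * (c * z ^ 2) ≤ δ * (2 * (z * (1 + z)) * a) := by gcongr
    have i3 : B * δ ^ 2 * z ^ 2 ≤ c / 4 * δ * z ^ 2 := by
      calc B * δ ^ 2 * z ^ 2 = (B * δ) * (δ * z ^ 2) := by ring
        _ ≤ c / 4 * (δ * z ^ 2) := by gcongr
        _ = _ := by ring
    have i4 : B * δ ^ 2 * z ≤ c / 4 * δ * z ^ 2 + B ^ 2 / c * δ ^ 3 := by
      have : 0 ≤ δ / c * (c / 2 * z - B * δ) ^ 2 := by positivity
      have e : δ / c * (c / 2 * z - B * δ) ^ 2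
          = c / 4 * δ * z ^ 2 + B ^ 2 / c * δ ^ 3 - B * δ ^ 2 * z := by
        field_simp
        ring
      linarith
    have i5 : 4 * R ^ 4 * δ ^ 4 ≤ 4 * R ^ 4 * δ ^ 3 := by
      have : δ ^ 4 ≤ δ ^ 3 := pow_le_pow_of_le_one hγ hγ1 (by norm_num)
      gcongr
    linarith
  have hi1 : Integrable (fun ω => (1 - c / 2 * δ) * Z ω ^ 2
      + (B ^ 2 / c + 4 * R ^ 4) * δ ^ 3) P := (hZ2.const_mul _).add (integrable_const _)
  have hi2 := hIncInt.const_mul (2 * δ)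
  calc ∫ ω, lyapunov (‖iterate g γ θ₀ W (n + 1) ω - θs‖ ^ 2) ^ 2 ∂P
      ≤ ∫ ω, (((1 - c / 2 * δ) * Z ω ^ 2 + (B ^ 2 / c + 4 * R ^ 4) * δ ^ 3)
        + 2 * δ * inner ℝ (V ω) (increment μ g γ θ₀ W n ω)) ∂P :=
        integral_mono hlhs (hi1.add hi2) hpt
    _ = (1 - c / 2 * δ) * ∫ ω, Z ω ^ 2 ∂P + (B ^ 2 / c + 4 * R ^ 4) * δ ^ 3 := by
        rw [integral_add hi1 hi2, integral_add (hZ2.const_mul _) (integrable_const _),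
          integral_const_mul,
          integral_const_mul (2 * δ), hInc]
        simp

theorem exists_fourth_moment_le (h : StochasticField μ g H A θs R c κ K)
    (hW : IsSample P W μ) (hγ : 0 < γ) (θ₀ : E) :
    ∃ C : ℝ, 0 < C ∧ ∀ n, ∫ ω, ‖iterate g γ θ₀ W n ω - θs‖ ^ 4 ∂P ≤ C * stepProfile n ^ 2 := by
  have := hW.isProbabilityMeasure
  have hc := h.c_pos
  have hlc : Continuous lyapunov := by unfold lyapunov; fun_prop
  set B := 25 * R ^ 2 + 5 * R ^ 4 with hB
  have hsmall : ∀ b a : ℝ, 0 < a → ∀ᶠ n in atTop, b * (γ * stepProfile n) ≤ a := fun b a ha => by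
    have := (tendsto_stepProfile.const_mul γ).const_mul b
    rw [mul_zero, mul_zero] at this
    exact (this.eventually_lt_const ha).mono fun n hn => hn.le
  obtain ⟨C, hC, hC'⟩ := le_of_eventually_recursion_sq
    (v := fun n => ∫ ω, lyapunov (‖iterate g γ θ₀ W n ω - θs‖ ^ 2) ^ 2 ∂P)
    (a := c / 2 * γ) (C := (B ^ 2 / c + 4 * R ^ 4) * γ ^ 3) (by positivity) (by
      filter_upwards [hsmall 1 1 one_pos, hsmall (R + R ^ 2) 1 one_pos,
        hsmall B (c / 4) (by positivity)] with n h1 h2 h3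
      have hp := stepProfile_pos n
      refine (h.integral_lyapunov_succ_le hW (by positivity) (by linarith) (by linarith)
        h3).trans (le_of_eq ?_)
      ring)
  refine ⟨4 * C, by positivity, fun n => ?_⟩
  have hZb := (PastBounded.continuous_comp hlc
    ((h.pastBounded_error (W := W) (γ := γ) (θ₀ := θ₀) n).norm.pow 2)).pow 2
  calc ∫ ω, ‖iterate g γ θ₀ W n ω - θs‖ ^ 4 ∂P
      ≤ ∫ ω, 4 * lyapunov (‖iterate g γ θ₀ W n ω - θs‖ ^ 2) ^ 2 ∂P := by
        refine integral_mono (((h.pastBounded_error n).norm.pow 4).integrable hW)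
          ((hZb.integrable hW).const_mul 4) fun ω => ?_
        have := le_two_mul_lyapunov (sq_nonneg ‖iterate g γ θ₀ W n ω - θs‖)
        calc ‖iterate g γ θ₀ W n ω - θs‖ ^ 4 = (‖iterate g γ θ₀ W n ω - θs‖ ^ 2) ^ 2 := by ring
          _ ≤ (2 * lyapunov (‖iterate g γ θ₀ W n ω - θs‖ ^ 2)) ^ 2 := by gcongr
          _ = _ := by ring
    _ = 4 * ∫ ω, lyapunov (‖iterate g γ θ₀ W n ω - θs‖ ^ 2) ^ 2 ∂P := integral_const_mul _ _
    _ ≤ 4 * (C * stepProfile n ^ 2) := by gcongr; exact hC' n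
    _ = _ := by ring

end StochasticField

end LogisticSGD
end

/-! ### Lower moments of the error and second moment of the martingale -/

noncomputable section
namespace LogisticSGD

set_option linter.unusedSectionVars false

theorem stepProfile_eq_sq (n : ℕ) :
    stepProfile n = (((n : ℝ) + 1) ^ (-(3 / 8) : ℝ)) ^ 2 := by
  rw [stepProfile, ← Real.rpow_natCast, ← Real.rpow_mul (by positivity)]
  norm_num

theorem succ_mul_stepProfile_sq_le (n : ℕ) : ((n : ℝ) + 1) * stepProfile n ^ 2 ≤ 1 := by
  have h : ((n : ℝ) + 1) * stepProfile n ^ 2 = ((n : ℝ) + 1) ^ (-(1 / 2) : ℝ) := by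
    rw [stepProfile, ← Real.rpow_natCast, ← Real.rpow_mul (by positivity)]
    nth_rewrite 1 [← Real.rpow_one ((n : ℝ) + 1)]
    rw [← Real.rpow_add (by positivity)]
    norm_num
  rw [h]
  exact Real.rpow_le_one_of_one_le_of_nonpos (by simp) (by norm_num)

theorem mul_le_weighted_sq (a b : ℝ) {t : ℝ} (ht : 0 < t) : 2 * (a * b) ≤ t * a ^ 2 + b ^ 2 / t :=
    by
  have h : 0 ≤ (t * a - b) ^ 2 / t := by positivity
  have e : (t * a - b) ^ 2 / t = t * a ^ 2 + b ^ 2 / t - 2 * (a * b) := by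
    field_simp
    ring
  linarith

section

variable {E S Ω : Type*} [NormedAddCommGroup E] [InnerProductSpace ℝ E]
  [FiniteDimensional ℝ E] [MeasurableSpace E] [BorelSpace E] [MeasurableSpace S]
  [MeasurableSpace Ω] {P : Measure Ω} [IsProbabilityMeasure P] {μ : Measure S}
  {W : ℕ → Ω → S}

/-- Minkowski's inequality in `L²` for a weighted sum. -/
theorem integral_norm_sum_sq_le (hW : IsSample P W μ) {m n : ℕ} {f : ℕ → Ω → E}
    (hf : ∀ k < n, PastBounded W m (f k)) {b s : ℕ → ℝ} (hb : ∀ k, 0 ≤ b k) (hs : ∀ k, 0 < s k)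
    {C : ℝ} (hC : ∀ k < n, ∫ ω, ‖f k ω‖ ^ 2 ∂P ≤ C * s k ^ 2) :
    ∫ ω, ‖∑ k ∈ Finset.range n, b k • f k ω‖ ^ 2 ∂P ≤
      C * (∑ k ∈ Finset.range n, b k * s k) ^ 2 := by
  have hint : ∀ k ∈ Finset.range n, Integrable (fun ω => b k / s k * ‖f k ω‖ ^ 2) P :=
    fun k hk => (((hf k (Finset.mem_range.1 hk)).norm.pow 2).integrable hW).const_mul _
  have hsum : PastBounded W m (fun ω => ∑ k ∈ Finset.range n, b k • f k ω) :=
    PastBounded.sum fun k hk => (hf k (Finset.mem_range.1 hk)).const_smul (b k)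
  -- Cauchy-Schwarz with `b = √(b s) √(b / s)`: the weight `s k` is the expected size of `f k`, so
  -- both factors are of the same order after integration.
  have hpt : ∀ ω, ‖∑ k ∈ Finset.range n, b k • f k ω‖ ^ 2 ≤
      (∑ k ∈ Finset.range n, b k * s k) * ∑ k ∈ Finset.range n, b k / s k * ‖f k ω‖ ^ 2 := by
    intro ω
    have h1 : ‖∑ k ∈ Finset.range n, b k • f k ω‖ ≤ ∑ k ∈ Finset.range n, b k * ‖f k ω‖ := by
      refine (norm_sum_le _ _).trans (le_of_eq (Finset.sum_congr rfl fun k _ => ?_))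
      rw [norm_smul, Real.norm_of_nonneg (hb k)]
    refine (pow_le_pow_left₀ (norm_nonneg _) h1 2).trans ?_
    refine Finset.sum_sq_le_sum_mul_sum_of_sq_le_mul _
      (fun k _ => mul_nonneg (hb k) (hs k).le)
      (fun k _ => mul_nonneg (div_nonneg (hb k) (hs k).le) (sq_nonneg _)) fun k _ => ?_
    have := (hs k).ne'
    refine le_of_eq ?_
    field_simp
  have hS : 0 ≤ ∑ k ∈ Finset.range n, b k * s k :=
    Finset.sum_nonneg fun k _ => mul_nonneg (hb k) (hs k).le
  calc ∫ ω, ‖∑ k ∈ Finset.range n, b k • f k ω‖ ^ 2 ∂P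
      ≤ ∫ ω, (∑ k ∈ Finset.range n, b k * s k) *
          ∑ k ∈ Finset.range n, b k / s k * ‖f k ω‖ ^ 2 ∂P :=
        integral_mono ((hsum.norm.pow 2).integrable hW)
          ((integrable_finsetSum _ hint).const_mul _) hpt
    _ = (∑ k ∈ Finset.range n, b k * s k) *
          ∑ k ∈ Finset.range n, b k / s k * ∫ ω, ‖f k ω‖ ^ 2 ∂P := by
        rw [integral_const_mul, integral_finsetSum _ hint]
        simp_rw [integral_const_mul]
    _ ≤ (∑ k ∈ Finset.range n, b k * s k) *
          ∑ k ∈ Finset.range n, b k / s k * (C * s k ^ 2) := by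
        refine mul_le_mul_of_nonneg_left (Finset.sum_le_sum fun k hk => ?_) hS
        exact mul_le_mul_of_nonneg_left (hC k (Finset.mem_range.1 hk))
          (div_nonneg (hb k) (hs k).le)
    _ = (∑ k ∈ Finset.range n, b k * s k) * (C * ∑ k ∈ Finset.range n, b k * s k) := by
        rw [Finset.mul_sum (a := C)]
        congr 1
        refine Finset.sum_congr rfl fun k _ => ?_
        have := (hs k).ne'
        field_simp
    _ = _ := by ring

variable {g : E → S → E} {H A : E →L[ℝ] E} {θs : E} {R c κ K γ : ℝ} {θ₀ : E}

namespace StochasticField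

/-- In place of Jensen, `2 x² ≤ γₙ + x⁴ / γₙ`, with the step itself as optimal weight. The first
moment is obtained likewise, with weight the square root of the step profile. -/
theorem exists_second_moment_le (h : StochasticField μ g H A θs R c κ K)
    (hW : IsSample P W μ) (hγ : 0 < γ) (θ₀ : E) :
    ∃ C : ℝ, 0 < C ∧ ∀ n, ∫ ω, ‖iterate g γ θ₀ W n ω - θs‖ ^ 2 ∂P ≤ C * stepProfile n := by
  obtain ⟨C, hC, hC'⟩ := h.exists_fourth_moment_le hW hγ θ₀
  refine ⟨(1 + C) / 2, by positivity, fun n => ?_⟩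
  have hx := stepProfile_pos n
  have hD := (h.pastBounded_error (W := W) (γ := γ) (θ₀ := θ₀) n).norm
  have hi := ((hD.pow 4).integrable hW).const_mul ((stepProfile n)⁻¹ / 2)
  calc ∫ ω, ‖iterate g γ θ₀ W n ω - θs‖ ^ 2 ∂P
      ≤ ∫ ω, (stepProfile n / 2
        + (stepProfile n)⁻¹ / 2 * ‖iterate g γ θ₀ W n ω - θs‖ ^ 4) ∂P := by
        refine integral_mono ((hD.pow 2).integrable hW) ((integrable_const _).add hi) fun ω => ?_
        have := mul_le_weighted_sq 1 (‖iterate g γ θ₀ W n ω - θs‖ ^ 2) hx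
        simp only
        rw [← pow_mul] at this
        have e : (stepProfile n)⁻¹ / 2 * ‖iterate g γ θ₀ W n ω - θs‖ ^ 4
          = ‖iterate g γ θ₀ W n ω - θs‖ ^ (2 * 2) / stepProfile n / 2 := by ring
        rw [e]
        linarith
    _ = stepProfile n / 2
        + (stepProfile n)⁻¹ / 2 * ∫ ω, ‖iterate g γ θ₀ W n ω - θs‖ ^ 4 ∂P := by
        rw [integral_add (integrable_const _) hi, integral_const_mul]
        simp
    _ ≤ stepProfile n / 2 + (stepProfile n)⁻¹ / 2 * (C * stepProfile n ^ 2) := by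
        gcongr
        exact hC' n
    _ = _ := by field_simp

theorem exists_first_moment_le (h : StochasticField μ g H A θs R c κ K)
    (hW : IsSample P W μ) (hγ : 0 < γ) (θ₀ : E) :
    ∃ C : ℝ, 0 < C ∧ ∀ n, ∫ ω, ‖iterate g γ θ₀ W n ω - θs‖ ∂P ≤
      C * ((n : ℝ) + 1) ^ (-(3 / 8) : ℝ) := by
  obtain ⟨C, hC, hC'⟩ := h.exists_second_moment_le hW hγ θ₀
  refine ⟨(1 + C) / 2, by positivity, fun n => ?_⟩
  have hx : 0 < ((n : ℝ) + 1) ^ (-(3 / 8) : ℝ) := by positivity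
  have hn := hC' n
  rw [stepProfile_eq_sq] at hn
  set y := ((n : ℝ) + 1) ^ (-(3 / 8) : ℝ)
  have hD := (h.pastBounded_error (W := W) (γ := γ) (θ₀ := θ₀) n).norm
  have hi := ((hD.pow 2).integrable hW).const_mul (y⁻¹ / 2)
  calc ∫ ω, ‖iterate g γ θ₀ W n ω - θs‖ ∂P
      ≤ ∫ ω, (y / 2 + y⁻¹ / 2 * ‖iterate g γ θ₀ W n ω - θs‖ ^ 2) ∂P := by
        refine integral_mono (hD.integrable hW) ((integrable_const _).add hi) fun ω => ?_
        have := mul_le_weighted_sq 1 (‖iterate g γ θ₀ W n ω - θs‖) hx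
        simp only
        have e : y⁻¹ / 2 * ‖iterate g γ θ₀ W n ω - θs‖ ^ 2
          = ‖iterate g γ θ₀ W n ω - θs‖ ^ 2 / y / 2 := by ring
        rw [e]
        linarith
    _ = y / 2 + y⁻¹ / 2 * ∫ ω, ‖iterate g γ θ₀ W n ω - θs‖ ^ 2 ∂P := by
        rw [integral_add (integrable_const _) hi, integral_const_mul]
        simp
    _ ≤ y / 2 + y⁻¹ / 2 * (C * y ^ 2) := by gcongr
    _ = _ := by field_simp

/-! ### The martingale -/

/-- Pythagoras: each new increment is orthogonal to the preceding sum, also after applying `L`. -/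
theorem integral_norm_martingaleSum_sq (h : StochasticField μ g H A θs R c κ K)
    (hW : IsSample P W μ) (L : E →L[ℝ] E) (n : ℕ) :
    ∫ ω, ‖L (martingaleSum μ g γ θ₀ W n ω)‖ ^ 2 ∂P =
      ∑ k ∈ Finset.range n, ∫ ω, ‖L (increment μ g γ θ₀ W k ω)‖ ^ 2 ∂P := by
  have := hW.isProbabilityMeasure
  induction n with
  | zero => simp [martingaleSum]
  | succ n ih =>
    rw [Finset.sum_range_succ, ← ih]
    have hM := (h.pastBounded_martingaleSum (W := W) (γ := γ) (θ₀ := θ₀) n).clm L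
    have hξ := (h.pastBounded_increment (W := W) (γ := γ) (θ₀ := θ₀) n).clm L
    have e : ∀ ω, ‖L (martingaleSum μ g γ θ₀ W (n + 1) ω)‖ ^ 2 =
        ‖L (martingaleSum μ g γ θ₀ W n ω)‖ ^ 2
        + 2 * inner ℝ (L (martingaleSum μ g γ θ₀ W n ω)) (L (increment μ g γ θ₀ W n ω))
        + ‖L (increment μ g γ θ₀ W n ω)‖ ^ 2 := fun ω => by
      rw [martingaleSum, Finset.sum_range_succ, map_add, norm_add_sq_real]
      rfl
    simp_rw [e]
    have i1 := (hM.norm.pow 2).integrable hW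
    have i2 := (((hM.mono (Nat.le_succ n)).inner hξ).integrable hW).const_mul 2
    have i3 := (hξ.norm.pow 2).integrable hW
    have i12 : Integrable (fun ω => ‖L (martingaleSum μ g γ θ₀ W n ω)‖ ^ 2
        + 2 * inner ℝ (L (martingaleSum μ g γ θ₀ W n ω)) (L (increment μ g γ θ₀ W n ω))) P :=
      i1.add i2
    rw [integral_add i12 i3, integral_add i1 i2, integral_const_mul,
      h.integral_inner_clm_increment hW hM L]
    ring

theorem integral_norm_martingaleSum_sq_le (h : StochasticField μ g H A θs R c κ K)
    (hW : IsSample P W μ) (L : E →L[ℝ] E) (n : ℕ) :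
    ∫ ω, ‖L (martingaleSum μ g γ θ₀ W n ω)‖ ^ 2 ∂P ≤ n * (‖L‖ * (2 * R)) ^ 2 := by
  have := hW.isProbabilityMeasure
  rw [h.integral_norm_martingaleSum_sq hW]
  have hk : ∀ k ∈ Finset.range n, ∫ ω, ‖L (increment μ g γ θ₀ W k ω)‖ ^ 2 ∂P ≤
      (‖L‖ * (2 * R)) ^ 2 := fun k _ => by
    have hξ := (h.pastBounded_increment (W := W) (γ := γ) (θ₀ := θ₀) k).clm L
    have := integral_mono ((hξ.norm.pow 2).integrable hW)
      (integrable_const ((‖L‖ * (2 * R)) ^ 2)) fun ω => by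
        have h1 := h.norm_increment_le (γ := γ) (θ₀ := θ₀) (W := W) k ω
        have h2 : ‖L (increment μ g γ θ₀ W k ω)‖ ≤ ‖L‖ * (2 * R) :=
          (L.le_opNorm _).trans (by gcongr)
        exact pow_le_pow_left₀ (norm_nonneg _) h2 2
    simpa using this
  simpa using Finset.sum_le_sum hk

/-- At `θs` the increment is `-g θs w`, since the mean field vanishes there. The difference of
squares is at most the difference `2 K ‖L‖ ‖θ - θs‖` times the sum `3 R ‖L‖`, hence the factor 6. -/
theorem integral_norm_increment_sq_le (h : StochasticField μ g H A θs R c κ K)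
    (hW : IsSample P W μ) (L : E →L[ℝ] E) (n : ℕ) :
    ∫ ω, ‖L (increment μ g γ θ₀ W n ω)‖ ^ 2 ∂P ≤ ∫ w, ‖L (g θs w)‖ ^ 2 ∂μ +
      6 * K * R * ‖L‖ ^ 2 * ∫ ω, ‖iterate g γ θ₀ W n ω - θs‖ ∂P := by
  have := hW.isProbabilityMeasure
  have hK := h.K_nonneg
  have hR := h.R_pos
  have hξ := (h.pastBounded_increment (W := W) (γ := γ) (θ₀ := θ₀) n).clm L
  have hD := (h.pastBounded_error (W := W) (γ := γ) (θ₀ := θ₀) n).norm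
  have hgm : Measurable fun w => ‖L (g θs w)‖ ^ 2 :=
    ((L.measurable.comp (h.measurable.comp measurable_prodMk_left)).norm).pow_const 2
  have hnorm : ∀ θ w, ‖L (g θ w)‖ ≤ ‖L‖ * R := fun θ w =>
    (L.le_opNorm _).trans (mul_le_mul_of_nonneg_left (h.norm_le θ w) (norm_nonneg _))
  have i1 : Integrable (fun ω => ‖L (g θs (W n ω))‖ ^ 2) P := by
    refine Integrable.of_bound (hgm.comp (hW.measurable n)).aestronglyMeasurable ((‖L‖ * R) ^ 2)
      (Eventually.of_forall fun ω => ?_)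
    rw [norm_pow, norm_norm]
    exact pow_le_pow_left₀ (norm_nonneg _) (hnorm _ _) 2
  have i2 := (hD.integrable hW).const_mul (6 * K * R * ‖L‖ ^ 2)
  have hmean : ∀ θ, ‖∫ w, g θ w ∂μ‖ ≤ K * ‖θ - θs‖ := fun θ => by
    have e : ∫ w, g θ w ∂μ = ∫ w, (g θ w - g θs w) ∂μ := by
      rw [integral_sub (h.integrable θ) (h.integrable θs), h.mean_self, sub_zero]
    rw [e]
    simpa using norm_integral_le_of_norm_le_const (μ := μ) (Eventually.of_forall (h.lipschitz θ))
  have hpt : ∀ ω, ‖L (increment μ g γ θ₀ W n ω)‖ ^ 2 ≤ ‖L (g θs (W n ω))‖ ^ 2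
      + 6 * K * R * ‖L‖ ^ 2 * ‖iterate g γ θ₀ W n ω - θs‖ := fun ω => by
    set θ := iterate g γ θ₀ W n ω
    set w := W n ω
    have h1 : ‖L (increment μ g γ θ₀ W n ω) + L (g θs w)‖ ≤ ‖L‖ * (2 * K * ‖θ - θs‖) := by
      rw [← map_add]
      refine (L.le_opNorm _).trans (mul_le_mul_of_nonneg_left ?_ (norm_nonneg _))
      have e : increment μ g γ θ₀ W n ω + g θs w = ∫ w, g θ w ∂μ - (g θ w - g θs w) := by
        simp only [increment, θ, w]
        abel
      rw [e]
      refine (norm_sub_le _ _).trans ?_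
      have := hmean θ
      have := h.lipschitz θ w
      linarith
    have h2 : ‖L (increment μ g γ θ₀ W n ω)‖ ≤ ‖L‖ * (2 * R) :=
      (L.le_opNorm _).trans
        (mul_le_mul_of_nonneg_left (h.norm_increment_le n ω) (norm_nonneg _))
    have h3 := hnorm θs w
    have h4 : ‖L (increment μ g γ θ₀ W n ω)‖ - ‖L (g θs w)‖ ≤ ‖L‖ * (2 * K * ‖θ - θs‖) := by
      have := norm_sub_norm_le (L (increment μ g γ θ₀ W n ω)) (-L (g θs w))
      rw [norm_neg, sub_neg_eq_add] at this
      exact this.trans h1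
    have h5 : 0 ≤ ‖L‖ * (2 * K * ‖θ - θs‖) := by positivity
    have h6 := norm_nonneg (L (increment μ g γ θ₀ W n ω))
    have h7 := norm_nonneg (L (g θs w))
    have h8 : (‖L (increment μ g γ θ₀ W n ω)‖ - ‖L (g θs w)‖) *
        (‖L (increment μ g γ θ₀ W n ω)‖ + ‖L (g θs w)‖) ≤
        ‖L‖ * (2 * K * ‖θ - θs‖) * (‖L‖ * (2 * R) + ‖L‖ * R) := by gcongr
    have e1 : (‖L (increment μ g γ θ₀ W n ω)‖ - ‖L (g θs w)‖) *
        (‖L (increment μ g γ θ₀ W n ω)‖ + ‖L (g θs w)‖) =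
        ‖L (increment μ g γ θ₀ W n ω)‖ ^ 2 - ‖L (g θs w)‖ ^ 2 := by ring
    have e2 : ‖L‖ * (2 * K * ‖θ - θs‖) * (‖L‖ * (2 * R) + ‖L‖ * R) =
        6 * K * R * ‖L‖ ^ 2 * ‖θ - θs‖ := by ring
    linarith
  calc ∫ ω, ‖L (increment μ g γ θ₀ W n ω)‖ ^ 2 ∂P
      ≤ ∫ ω, (‖L (g θs (W n ω))‖ ^ 2
          + 6 * K * R * ‖L‖ ^ 2 * ‖iterate g γ θ₀ W n ω - θs‖) ∂P :=
        integral_mono ((hξ.norm.pow 2).integrable hW) (i1.add i2) hpt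
    _ = _ := by
        rw [integral_add i1 i2, integral_const_mul]
        congr 1
        rw [← hW.law n]
        exact (integral_map (hW.measurable n).aemeasurable hgm.aestronglyMeasurable).symm

theorem exists_integral_martingaleSum_le (h : StochasticField μ g H A θs R c κ K)
    (hW : IsSample P W μ) (hγ : 0 < γ) (θ₀ : E) (L : E →L[ℝ] E) :
    ∃ C : ℝ, 0 < C ∧ ∀ n : ℕ, ∫ ω, ‖L (martingaleSum μ g γ θ₀ W n ω)‖ ^ 2 ∂P ≤
      n * ∫ w, ‖L (g θs w)‖ ^ 2 ∂μ + C * ((n : ℝ) + 1) ^ (3 / 4 : ℝ) := by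
  obtain ⟨C, hC, hC'⟩ := h.exists_first_moment_le hW hγ θ₀
  have hK := h.K_nonneg
  have hR := h.R_pos
  -- Summing `k ^ (-3 / 8)` gives `n ^ (5 / 8) / (5 / 8)`, then weakened to the order `n ^ (3 / 4)`
  -- of the other error terms. The added 1 keeps the constant positive when `K` or `L` is zero.
  refine ⟨6 * K * R * ‖L‖ ^ 2 * C / (5 / 8) + 1, by positivity, fun n => ?_⟩
  rw [h.integral_norm_martingaleSum_sq hW]
  have hs := sum_rpow_le (q := 5 / 8) (by norm_num) (by norm_num) n
  have hn : (n : ℝ) ^ (5 / 8 : ℝ) ≤ ((n : ℝ) + 1) ^ (3 / 4 : ℝ) :=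
    (Real.rpow_le_rpow (by positivity) (by linarith) (by norm_num)).trans
      (Real.rpow_le_rpow_of_exponent_le (by simp) (by norm_num))
  have he : (5 / 8 - 1 : ℝ) = -(3 / 8) := by norm_num
  rw [he] at hs
  calc ∑ k ∈ Finset.range n, ∫ ω, ‖L (increment μ g γ θ₀ W k ω)‖ ^ 2 ∂P
      ≤ ∑ k ∈ Finset.range n, (∫ w, ‖L (g θs w)‖ ^ 2 ∂μ +
        6 * K * R * ‖L‖ ^ 2 * (C * ((k : ℝ) + 1) ^ (-(3 / 8) : ℝ))) := by
        refine Finset.sum_le_sum fun k _ => (h.integral_norm_increment_sq_le hW L k).trans ?_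
        gcongr
        exact hC' k
    _ = n * ∫ w, ‖L (g θs w)‖ ^ 2 ∂μ + 6 * K * R * ‖L‖ ^ 2 * C *
        ∑ k ∈ Finset.range n, ((k : ℝ) + 1) ^ (-(3 / 8) : ℝ) := by
        rw [Finset.sum_add_distrib, Finset.mul_sum]
        simp only [Finset.sum_const, Finset.card_range, nsmul_eq_mul]
        congr 1
        exact Finset.sum_congr rfl fun k _ => by ring
    _ ≤ n * ∫ w, ‖L (g θs w)‖ ^ 2 ∂μ + 6 * K * R * ‖L‖ ^ 2 * C *
        (((n : ℝ) + 1) ^ (3 / 4 : ℝ) / (5 / 8)) := by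
        gcongr
        exact hs.trans (by gcongr)
    _ ≤ _ := by
        have : 0 ≤ ((n : ℝ) + 1) ^ (3 / 4 : ℝ) := by positivity
        have e : (6 * K * R * ‖L‖ ^ 2 * C / (5 / 8) + 1) * ((n : ℝ) + 1) ^ (3 / 4 : ℝ) =
          6 * K * R * ‖L‖ ^ 2 * C * (((n : ℝ) + 1) ^ (3 / 4 : ℝ) / (5 / 8))
            + ((n : ℝ) + 1) ^ (3 / 4 : ℝ) := by ring
        rw [e]
        linarith

end StochasticField

end

end LogisticSGD
end

/-! ### Correlation between the martingale and the error -/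

noncomputable section
namespace LogisticSGD

set_option linter.unusedSectionVars false

variable {E S Ω : Type*} [NormedAddCommGroup E] [InnerProductSpace ℝ E]
  [FiniteDimensional ℝ E] [MeasurableSpace E] [BorelSpace E] [MeasurableSpace S]
  [MeasurableSpace Ω] {P : Measure Ω} [IsProbabilityMeasure P] {μ : Measure S}
  {W : ℕ → Ω → S} {g : E → S → E} {H A : E →L[ℝ] E} {θs : E} {R c κ K γ : ℝ} {θ₀ : E}

/-- Symmetry of `H` is not assumed. In the squared norm the quadratic term costs at most half of the
decrease `2 t κ`, and `1 - t κ ≤ (1 - κ / 2 * t) ^ 2`. -/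
theorem norm_sub_smul_le_of_coercive {κ t : ℝ} (hκ : ∀ v, κ * ‖v‖ ^ 2 ≤ inner ℝ v (H v))
    (ht : 0 ≤ t) (ht1 : t * κ ≤ 1) (ht2 : t * ‖H‖ ^ 2 ≤ κ) (v : E) :
    ‖v - t • H v‖ ≤ (1 - κ / 2 * t) * ‖v‖ := by
  refine le_of_sq_le_sq ?_ (mul_nonneg (by linarith) (norm_nonneg _))
  have h1 : ‖v - t • H v‖ ^ 2 = ‖v‖ ^ 2 - 2 * t * inner ℝ v (H v) + t ^ 2 * ‖H v‖ ^ 2 := by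
    rw [norm_sub_sq_real, inner_smul_right, norm_smul, mul_pow, Real.norm_eq_abs, sq_abs]
    ring
  have h2 : ‖H v‖ ^ 2 ≤ ‖H‖ ^ 2 * ‖v‖ ^ 2 := by
    rw [← mul_pow]; exact pow_le_pow_left₀ (norm_nonneg _) (H.le_opNorm v) 2
  have h3 : t ^ 2 * ‖H v‖ ^ 2 ≤ t * κ * ‖v‖ ^ 2 := by
    calc t ^ 2 * ‖H v‖ ^ 2 ≤ t ^ 2 * (‖H‖ ^ 2 * ‖v‖ ^ 2) := by gcongr
      _ = t * (t * ‖H‖ ^ 2) * ‖v‖ ^ 2 := by ring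
      _ ≤ t * κ * ‖v‖ ^ 2 := by gcongr
  have h4 : t * (κ * ‖v‖ ^ 2) ≤ t * inner ℝ v (H v) := by gcongr; exact hκ v
  rw [h1, mul_pow]
  have h5 : 0 ≤ (κ / 2 * t) ^ 2 * ‖v‖ ^ 2 := by positivity
  linarith

namespace StochasticField

theorem norm_linError_le (h : StochasticField μ g H A θs R c κ K) (n : ℕ) (ω : Ω) :
    ‖linError μ g H θs γ θ₀ W n ω‖ ≤ K * ‖iterate g γ θ₀ W n ω - θs‖ ^ 2 :=
  h.remainder _

/-- The reason why a fourth moment is needed: the linearization error is quadratic in `θ n - θs`. -/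
theorem exists_integral_linError_sq_le (h : StochasticField μ g H A θs R c κ K)
    (hW : IsSample P W μ) (hγ : 0 < γ) (θ₀ : E) :
    ∃ C : ℝ, 0 < C ∧ ∀ n, ∫ ω, ‖linError μ g H θs γ θ₀ W n ω‖ ^ 2 ∂P ≤ C * stepProfile n ^ 2 := by
  have := hW.isProbabilityMeasure
  obtain ⟨C, hC, hC'⟩ := h.exists_fourth_moment_le hW hγ θ₀
  refine ⟨K ^ 2 * C + 1, by positivity, fun n => ?_⟩
  have hD := (h.pastBounded_error (W := W) (γ := γ) (θ₀ := θ₀) n).norm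
  have hr := (h.pastBounded_linError (W := W) (γ := γ) (θ₀ := θ₀) n).norm
  calc ∫ ω, ‖linError μ g H θs γ θ₀ W n ω‖ ^ 2 ∂P
      ≤ ∫ ω, K ^ 2 * ‖iterate g γ θ₀ W n ω - θs‖ ^ 4 ∂P := by
        refine integral_mono ((hr.pow 2).integrable hW)
          (((hD.pow 4).integrable hW).const_mul _) fun ω => ?_
        refine (pow_le_pow_left₀ (norm_nonneg _) (h.norm_linError_le n ω) 2).trans_eq ?_
        ring
    _ = K ^ 2 * ∫ ω, ‖iterate g γ θ₀ W n ω - θs‖ ^ 4 ∂P := integral_const_mul _ _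
    _ ≤ K ^ 2 * (C * stepProfile n ^ 2) := by gcongr; exact hC' n
    _ ≤ _ := by nlinarith [sq_nonneg (stepProfile n)]

theorem integral_inner_increment_smul (h : StochasticField μ g H A θs R c κ K)
    (hW : IsSample P W μ) {n : ℕ} {U : Ω → E} (hU : PastBounded W n U) (e : E) :
    ∫ ω, inner ℝ (increment μ g γ θ₀ W n ω) e • U ω ∂P = 0 := by
  have := hW.isProbabilityMeasure
  have hξ := h.pastBounded_increment (W := W) (γ := γ) (θ₀ := θ₀) n
  have hint := ((hξ.inner (PastBounded.const e)).smul (hU.mono (Nat.le_succ n))).integrable hW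
  refine ext_inner_left ℝ fun v => ?_
  rw [← integral_inner hint, inner_zero_right]
  refine Eq.trans ?_ (h.integral_inner_increment (γ := γ) (θ₀ := θ₀) hW
    (((PastBounded.const v).inner hU).smul (PastBounded.const e)))
  simp only [inner_smul_left, inner_smul_right, conj_trivial, real_inner_comm e]
  congr 1
  ext ω
  ring

theorem iterate_succ_sub (n : ℕ) (ω : Ω) :
    iterate g γ θ₀ W (n + 1) ω - θs =
      ((iterate g γ θ₀ W n ω - θs) - (γ * stepProfile n) • H (iterate g γ θ₀ W n ω - θs)
        - (γ * stepProfile n) • linError μ g H θs γ θ₀ W n ω)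
        + (γ * stepProfile n) • increment μ g γ θ₀ W n ω := by
  simp only [iterate, linError, increment, smul_sub]
  abel

theorem martingaleSum_succ (n : ℕ) (ω : Ω) :
    martingaleSum μ g γ θ₀ W (n + 1) ω =
      martingaleSum μ g γ θ₀ W n ω + increment μ g γ θ₀ W n ω := by
  rw [martingaleSum, Finset.sum_range_succ]
  rfl

/-- The correlation between the martingale and the error is bounded. -/
theorem exists_norm_correlation_le (h : StochasticField μ g H A θs R c κ K)
    (hW : IsSample P W μ) (hγ : 0 < γ) (θ₀ : E) (e : E) :
    ∃ C : ℝ, 0 < C ∧ ∀ n, ‖∫ ω, inner ℝ (martingaleSum μ g γ θ₀ W n ω) e •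
      (iterate g γ θ₀ W n ω - θs) ∂P‖ ≤ C := by
  have := hW.isProbabilityMeasure
  obtain ⟨C, hC, hC'⟩ := h.exists_integral_linError_sq_le hW hγ θ₀
  have hκ := h.κ_pos
  have hR := h.R_pos
  set C₁ := ‖e‖ ^ 2 * (2 * R) ^ 2 + C with hC₁
  set C₂ := (2 * R) ^ 2 * ‖e‖ with hC₂
  have hsmall : ∀ b a : ℝ, 0 < a → ∀ᶠ n in atTop, (γ * stepProfile n) * b ≤ a := fun b a ha => by
    have := (tendsto_stepProfile.const_mul γ).mul_const b
    rw [mul_zero, zero_mul] at this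
    exact (this.eventually_lt_const ha).mono fun n hn => hn.le
  refine le_of_eventually_recursion (a := κ / 2 * γ) (C := γ * (C₁ + C₂)) (by positivity) ?_
  filter_upwards [hsmall κ 1 one_pos, hsmall (‖H‖ ^ 2) κ hκ] with n hn1 hn2
  have hx := stepProfile_pos n
  set δ := γ * stepProfile n with hδ
  have hδ0 : 0 < δ := by positivity
  have hM := h.pastBounded_martingaleSum (W := W) (γ := γ) (θ₀ := θ₀) n
  have hm : PastBounded W n (fun ω => inner ℝ (martingaleSum μ g γ θ₀ W n ω) e) :=
    hM.inner (PastBounded.const e)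
  have hξ := h.pastBounded_increment (W := W) (γ := γ) (θ₀ := θ₀) n
  have hD := h.pastBounded_error (W := W) (γ := γ) (θ₀ := θ₀) n
  have hr := h.pastBounded_linError (W := W) (γ := γ) (θ₀ := θ₀) n
  set m : Ω → ℝ := fun ω => inner ℝ (martingaleSum μ g γ θ₀ W n ω) e with hm_def
  set D : Ω → E := fun ω => iterate g γ θ₀ W n ω - θs with hD_def
  set r : Ω → E := linError μ g H θs γ θ₀ W n with hr_def
  set ξ : Ω → E := increment μ g γ θ₀ W n with hξ_def
  have hU : PastBounded W n (fun ω => D ω - δ • H (D ω) - δ • r ω) :=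
    (hD.sub ((hD.clm H).const_smul δ)).sub (hr.const_smul δ)
  have j1 := (hm.smul hD).integrable hW
  have j2 := (hm.smul hr).integrable hW
  have j3 := ((hm.mono (Nat.le_succ n)).smul hξ).integrable hW
  have j4 := ((hξ.inner (PastBounded.const e)).smul (hU.mono (Nat.le_succ n))).integrable hW
  have j5 := ((hξ.inner (PastBounded.const e)).smul hξ).integrable hW
  set L : E →L[ℝ] E := ContinuousLinearMap.id ℝ E - δ • H with hL
  -- In the expanded product, the martingale against the new increment and the new increment against
  -- the past part of the error both have mean zero. What remains is the contracted correlation and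
  -- two terms with a factor `δ`.
  have hexp : ∫ ω, inner ℝ (martingaleSum μ g γ θ₀ W (n + 1) ω) e •
      (iterate g γ θ₀ W (n + 1) ω - θs) ∂P =
      L (∫ ω, m ω • D ω ∂P) - δ • ∫ ω, m ω • r ω ∂P + δ • ∫ ω, inner ℝ (ξ ω) e • ξ ω ∂P := by
    have e1 : ∀ ω, inner ℝ (martingaleSum μ g γ θ₀ W (n + 1) ω) e •
        (iterate g γ θ₀ W (n + 1) ω - θs) =
        L (m ω • D ω) - δ • (m ω • r ω) + δ • (m ω • ξ ω) +
        inner ℝ (ξ ω) e • (D ω - δ • H (D ω) - δ • r ω) + δ • (inner ℝ (ξ ω) e • ξ ω) := by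
      intro ω
      rw [iterate_succ_sub (μ := μ) (H := H), martingaleSum_succ, inner_add_left, map_smul]
      simp only [L, _root_.sub_apply, ContinuousLinearMap.id_apply,
        _root_.smul_apply, m, D, r, ξ, δ]
      module
    have k1 : Integrable (fun ω => L (m ω • D ω)) P := L.integrable_comp j1
    have k2 : Integrable (fun ω => δ • (m ω • r ω)) P := j2.smul δ
    have k3 : Integrable (fun ω => δ • (m ω • ξ ω)) P := j3.smul δ
    have k5 : Integrable (fun ω => δ • (inner ℝ (ξ ω) e • ξ ω)) P := j5.smul δ
    have k12 : Integrable (fun ω => L (m ω • D ω) - δ • (m ω • r ω)) P := k1.sub k2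
    have k123 : Integrable (fun ω => L (m ω • D ω) - δ • (m ω • r ω) + δ • (m ω • ξ ω)) P :=
      k12.add k3
    have k1234 : Integrable (fun ω => L (m ω • D ω) - δ • (m ω • r ω) + δ • (m ω • ξ ω) +
        inner ℝ (ξ ω) e • (D ω - δ • H (D ω) - δ • r ω)) P := k123.add j4
    simp_rw [e1]
    rw [integral_add k1234 k5, integral_add k123 j4, integral_add k12 k3, integral_sub k1 k2,
      integral_smul, integral_smul, integral_smul, L.integral_comp_comm j1,
      h.integral_inner_increment_smul hW hU e, h.integral_smul_increment hW hm]
    simp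
  have b1 : ‖L (∫ ω, m ω • D ω ∂P)‖ ≤ (1 - κ / 2 * δ) * ‖∫ ω, m ω • D ω ∂P‖ :=
    norm_sub_smul_le_of_coercive h.coercive hδ0.le hn1 hn2 _
  -- Young's inequality with weight `1 / (n + 1)` balances `𝔼 ‖M‖² = O(n)` against `𝔼 ‖r‖² =
  -- O(γₙ²)`; the result is bounded because `(n + 1) γₙ²` is.
  have b2 : ‖∫ ω, m ω • r ω ∂P‖ ≤ C₁ := by
    have hp : (0 : ℝ) < (n : ℝ) + 1 := by positivity
    have l1 := ((hM.norm.pow 2).integrable hW).const_mul (((n : ℝ) + 1)⁻¹ * ‖e‖ ^ 2)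
    have l2 := ((hr.norm.pow 2).integrable hW).const_mul ((n : ℝ) + 1)
    have hMM := h.integral_norm_martingaleSum_sq_le (W := W) (γ := γ) (θ₀ := θ₀) hW
      (ContinuousLinearMap.id ℝ E) n
    have hid : ‖ContinuousLinearMap.id ℝ E‖ * (2 * R) ≤ 2 * R :=
      mul_le_of_le_one_left (by positivity) ContinuousLinearMap.norm_id_le
    have hMM' : ∫ ω, ‖martingaleSum μ g γ θ₀ W n ω‖ ^ 2 ∂P ≤ ((n : ℝ) + 1) * (2 * R) ^ 2 := by
      refine hMM.trans ?_
      gcongr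
      linarith
    have hrr := hC' n
    calc ‖∫ ω, m ω • r ω ∂P‖ ≤ ∫ ω, ‖m ω • r ω‖ ∂P := norm_integral_le_integral_norm _
      _ ≤ ∫ ω, (((n : ℝ) + 1)⁻¹ * ‖e‖ ^ 2 * ‖martingaleSum μ g γ θ₀ W n ω‖ ^ 2
            + ((n : ℝ) + 1) * ‖r ω‖ ^ 2) ∂P := by
          refine integral_mono j2.norm (l1.add l2) fun ω => ?_
          simp only
          rw [norm_smul]
          have q1 : ‖m ω‖ ≤ ‖martingaleSum μ g γ θ₀ W n ω‖ * ‖e‖ := norm_inner_le_norm _ _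
          have q2 := mul_le_weighted_sq (‖martingaleSum μ g γ θ₀ W n ω‖ * ‖e‖) ‖r ω‖
            (inv_pos.2 hp)
          rw [div_inv_eq_mul] at q2
          have q3 : ‖m ω‖ * ‖r ω‖ ≤ ‖martingaleSum μ g γ θ₀ W n ω‖ * ‖e‖ * ‖r ω‖ := by gcongr
          have q4 : 0 ≤ ‖martingaleSum μ g γ θ₀ W n ω‖ * ‖e‖ * ‖r ω‖ := by positivity
          have q5 : ((n : ℝ) + 1)⁻¹ * (‖martingaleSum μ g γ θ₀ W n ω‖ * ‖e‖) ^ 2 =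
            ((n : ℝ) + 1)⁻¹ * ‖e‖ ^ 2 * ‖martingaleSum μ g γ θ₀ W n ω‖ ^ 2 := by ring
          linarith
      _ = ((n : ℝ) + 1)⁻¹ * ‖e‖ ^ 2 * ∫ ω, ‖martingaleSum μ g γ θ₀ W n ω‖ ^ 2 ∂P
            + ((n : ℝ) + 1) * ∫ ω, ‖r ω‖ ^ 2 ∂P := by
          rw [integral_add l1 l2, integral_const_mul, integral_const_mul]
      _ ≤ ((n : ℝ) + 1)⁻¹ * ‖e‖ ^ 2 * (((n : ℝ) + 1) * (2 * R) ^ 2)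
            + ((n : ℝ) + 1) * (C * stepProfile n ^ 2) := by gcongr
      _ = ‖e‖ ^ 2 * (2 * R) ^ 2 + C * (((n : ℝ) + 1) * stepProfile n ^ 2) := by
          field_simp
      _ ≤ ‖e‖ ^ 2 * (2 * R) ^ 2 + C * 1 := by
          gcongr
          exact succ_mul_stepProfile_sq_le n
      _ = C₁ := by rw [hC₁, mul_one]
  have b3 : ‖∫ ω, inner ℝ (ξ ω) e • ξ ω ∂P‖ ≤ C₂ := by
    have : ∀ ω, ‖inner ℝ (ξ ω) e • ξ ω‖ ≤ C₂ := fun ω => by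
      have q1 := h.norm_increment_le (γ := γ) (θ₀ := θ₀) (W := W) n ω
      have q2 : ‖inner ℝ (ξ ω) e‖ ≤ 2 * R * ‖e‖ :=
        (norm_inner_le_norm _ _).trans (by gcongr)
      rw [norm_smul]
      calc ‖inner ℝ (ξ ω) e‖ * ‖ξ ω‖ ≤ 2 * R * ‖e‖ * (2 * R) := by gcongr
        _ = C₂ := by rw [hC₂]; ring
    simpa using norm_integral_le_of_norm_le_const (μ := P) (Eventually.of_forall this)
  rw [hexp]
  calc ‖L (∫ ω, m ω • D ω ∂P) - δ • ∫ ω, m ω • r ω ∂P + δ • ∫ ω, inner ℝ (ξ ω) e • ξ ω ∂P‖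
      ≤ ‖L (∫ ω, m ω • D ω ∂P)‖ + ‖δ • ∫ ω, m ω • r ω ∂P‖
        + ‖δ • ∫ ω, inner ℝ (ξ ω) e • ξ ω ∂P‖ :=
        (norm_add_le _ _).trans (add_le_add_left (norm_sub_le _ _) _)
    _ ≤ (1 - κ / 2 * δ) * ‖∫ ω, m ω • D ω ∂P‖ + δ * C₁ + δ * C₂ := by
        rw [norm_smul, norm_smul, Real.norm_of_nonneg hδ0.le]
        gcongr
    _ = _ := by rw [hδ]; ring

/-- Increments after time `k` are orthogonal to the error at time `k`, so the integral for `n ≥ k`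
equals its value at `n = k`. There an orthonormal basis reduces it to the vector correlations
already bounded. -/
theorem exists_abs_integral_inner_le (h : StochasticField μ g H A θs R c κ K)
    (hW : IsSample P W μ) (hγ : 0 < γ) (θ₀ : E) (L : E →L[ℝ] E) :
    ∃ C : ℝ, 0 < C ∧ ∀ k n, k ≤ n → |∫ ω, inner ℝ (L (martingaleSum μ g γ θ₀ W n ω))
      (L (iterate g γ θ₀ W k ω - θs)) ∂P| ≤ C := by
  have := hW.isProbabilityMeasure
  set b := stdOrthonormalBasis ℝ E with hb
  choose C hC hC' using fun i => h.exists_norm_correlation_le hW hγ θ₀ (b i)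
  have hdiag : ∀ k, |∫ ω, inner ℝ (L (martingaleSum μ g γ θ₀ W k ω))
      (L (iterate g γ θ₀ W k ω - θs)) ∂P| ≤ ∑ i, ‖L (b i)‖ * (‖L‖ * C i) := fun k => by
    have hM := h.pastBounded_martingaleSum (W := W) (γ := γ) (θ₀ := θ₀) k
    have hD := h.pastBounded_error (W := W) (γ := γ) (θ₀ := θ₀) k
    have hv := fun i => ((hM.inner (PastBounded.const (b i))).smul hD)
    have e1 : ∀ ω, inner ℝ (L (martingaleSum μ g γ θ₀ W k ω)) (L (iterate g γ θ₀ W k ω - θs)) =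
        ∑ i, inner ℝ (L (b i)) (L (inner ℝ (martingaleSum μ g γ θ₀ W k ω) (b i) •
          (iterate g γ θ₀ W k ω - θs))) := fun ω => by
      conv_lhs => rw [← b.sum_repr' (martingaleSum μ g γ θ₀ W k ω)]
      rw [map_sum, sum_inner]
      refine Finset.sum_congr rfl fun i _ => ?_
      rw [map_smul, map_smul, inner_smul_left, inner_smul_right, real_inner_comm]
      rfl
    have e2 : ∫ ω, inner ℝ (L (martingaleSum μ g γ θ₀ W k ω))
        (L (iterate g γ θ₀ W k ω - θs)) ∂P = ∑ i, inner ℝ (L (b i))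
        (L (∫ ω, inner ℝ (martingaleSum μ g γ θ₀ W k ω) (b i) •
          (iterate g γ θ₀ W k ω - θs) ∂P)) := by
      simp_rw [e1]
      rw [integral_finsetSum]
      · refine Finset.sum_congr rfl fun i _ => ?_
        rw [← L.integral_comp_comm ((hv i).integrable hW)]
        exact integral_inner (((hv i).clm L).integrable hW) _
      · exact fun i _ => ((PastBounded.const (L (b i))).inner ((hv i).clm L)).integrable hW
    rw [e2]
    refine (Finset.abs_sum_le_sum_abs _ _).trans (Finset.sum_le_sum fun i _ => ?_)
    refine (abs_real_inner_le_norm _ _).trans ?_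
    gcongr
    refine (L.le_opNorm _).trans ?_
    gcongr
    exact hC' i k
  -- The added 1 keeps the constant positive when the sum vanishes.
  refine ⟨∑ i, ‖L (b i)‖ * (‖L‖ * C i) + 1, ?_, fun k n hkn => ?_⟩
  · have : 0 ≤ ∑ i, ‖L (b i)‖ * (‖L‖ * C i) :=
      Finset.sum_nonneg fun i _ => by have := hC i; positivity
    linarith
  · refine le_trans ?_ ((hdiag k).trans (by linarith))
    refine le_of_eq ?_
    congr 1
    induction n, hkn using Nat.le_induction with
    | base => rfl
    | succ n hn ih =>
      rw [← ih]
      have hM := (h.pastBounded_martingaleSum (W := W) (γ := γ) (θ₀ := θ₀) n).clm L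
      have hξ := (h.pastBounded_increment (W := W) (γ := γ) (θ₀ := θ₀) n).clm L
      have hD := ((h.pastBounded_error (W := W) (γ := γ) (θ₀ := θ₀) k).mono hn).clm L
      have e1 : ∀ ω, inner ℝ (L (martingaleSum μ g γ θ₀ W (n + 1) ω))
          (L (iterate g γ θ₀ W k ω - θs)) =
          inner ℝ (L (martingaleSum μ g γ θ₀ W n ω)) (L (iterate g γ θ₀ W k ω - θs)) +
          inner ℝ (L (iterate g γ θ₀ W k ω - θs)) (L (increment μ g γ θ₀ W n ω)) := fun ω => by
        rw [martingaleSum_succ, map_add, inner_add_left]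
        congr 1
        exact real_inner_comm _ _
      simp_rw [e1]
      rw [integral_add ((hM.inner hD).integrable hW)
        (((hD.mono (Nat.le_succ n)).inner hξ).integrable hW),
        h.integral_inner_clm_increment hW hD L, add_zero]

end StochasticField

end LogisticSGD
end

/-! ### Summation by parts and the averaged error -/

noncomputable section
namespace LogisticSGD

set_option linter.unusedSectionVars false

theorem inv_stepProfile (n : ℕ) : (stepProfile n)⁻¹ = ((n : ℝ) + 1) ^ (3 / 4 : ℝ) := by
  rw [stepProfile, ← Real.rpow_neg (by positivity), neg_neg]

theorem inv_stepProfile_mono (n : ℕ) : (stepProfile n)⁻¹ ≤ (stepProfile (n + 1))⁻¹ := by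
  rw [inv_stepProfile, inv_stepProfile]
  refine Real.rpow_le_rpow (by positivity) ?_ (by norm_num)
  push_cast
  linarith

theorem stepProfile_succ_le (n : ℕ) : stepProfile (n + 1) ≤ stepProfile n :=
  (inv_le_inv₀ (stepProfile_pos n) (stepProfile_pos (n + 1))).1 (inv_stepProfile_mono n)

theorem inv_stepProfile_succ_sub_le (n : ℕ) :
    (stepProfile (n + 1))⁻¹ - (stepProfile n)⁻¹ ≤ ((n : ℝ) + 1) ^ (-(1 / 4) : ℝ) := by
  rw [inv_stepProfile, inv_stepProfile]
  have h := add_rpow_le (x := (n : ℝ) + 1) (t := 1) (q := 3 / 4) (by positivity) (by positivity)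
    (by norm_num) (by norm_num)
  have e : (3 / 4 - 1 : ℝ) = -(1 / 4) := by norm_num
  rw [e] at h
  have : 0 ≤ ((n : ℝ) + 1) ^ (-(1 / 4) : ℝ) := by positivity
  push_cast
  linarith

/-- Summation by parts. -/
theorem sum_smul_sub_succ {E : Type*} [AddCommGroup E] [Module ℝ E] (a : ℕ → ℝ) (D : ℕ → E)
    (n : ℕ) : ∑ k ∈ Finset.range n, a k • (D k - D (k + 1)) =
      a 0 • D 0 + (∑ k ∈ Finset.range n, (a (k + 1) - a k) • D (k + 1) - a n • D n) := by
  induction n with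
  | zero => simp
  | succ n ih =>
    rw [Finset.sum_range_succ, Finset.sum_range_succ, ih]
    module

variable {E S Ω : Type*} [NormedAddCommGroup E] [InnerProductSpace ℝ E]
  [FiniteDimensional ℝ E] [MeasurableSpace E] [BorelSpace E] [MeasurableSpace S]
  [MeasurableSpace Ω] {P : Measure Ω} [IsProbabilityMeasure P] {μ : Measure S}
  {W : ℕ → Ω → S} {g : E → S → E} {H A : E →L[ℝ] E} {θs : E} {R c κ K γ : ℝ} {θ₀ : E}

/-- The boundary and drift terms of the summation by parts. -/
def abelTerm (g : E → S → E) (A : E →L[ℝ] E) (θs : E) (γ : ℝ) (θ₀ : E) (W : ℕ → Ω → S) (n : ℕ)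
    (ω : Ω) : E :=
  A (γ⁻¹ • (∑ k ∈ Finset.range n, ((stepProfile (k + 1))⁻¹ - (stepProfile k)⁻¹) •
    (iterate g γ θ₀ W (k + 1) ω - θs) - (stepProfile n)⁻¹ • (iterate g γ θ₀ W n ω - θs)))

/-- The initial condition, the last error and the linearization errors. -/
def restTerm (μ : Measure S) (g : E → S → E) (H A : E →L[ℝ] E) (θs : E) (γ : ℝ) (θ₀ : E)
    (W : ℕ → Ω → S) (n : ℕ) (ω : Ω) : E :=
  (A (γ⁻¹ • (stepProfile 0)⁻¹ • (θ₀ - θs)) - (θ₀ - θs)) + (iterate g γ θ₀ W n ω - θs)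
    - A (∑ k ∈ Finset.range n, linError μ g H θs γ θ₀ W k ω)

namespace StochasticField

/-- One step of the recursion is solved for `H (D k)`, summed by parts and multiplied by the left
inverse `A`. The average starts at index 1, so passing from `D k` to `D (k + 1)` adds `D n - D 0`,
which goes into `restTerm`. -/
theorem sum_error_eq (h : StochasticField μ g H A θs R c κ K) (hγ : 0 < γ) (n : ℕ) (ω : Ω) :
    ∑ k ∈ Finset.range n, (iterate g γ θ₀ W (k + 1) ω - θs) =
      A (martingaleSum μ g γ θ₀ W n ω) + abelTerm g A θs γ θ₀ W n ω
        + restTerm μ g H A θs γ θ₀ W n ω := by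
  set D : ℕ → E := fun k => iterate g γ θ₀ W k ω - θs with hD
  have h1 : ∀ k, H (D k) = γ⁻¹ • (stepProfile k)⁻¹ • (D k - D (k + 1))
      + increment μ g γ θ₀ W k ω - linError μ g H θs γ θ₀ W k ω := fun k => by
    have e := iterate_succ_sub (μ := μ) (H := H) (g := g) (γ := γ) (θ₀ := θ₀) (W := W)
      (θs := θs) k ω
    have hx := (stepProfile_pos k).ne'
    have e2 : D k - D (k + 1) = γ • stepProfile k • (H (D k) + linError μ g H θs γ θ₀ W k ω
        - increment μ g γ θ₀ W k ω) := by
      simp only [hD]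
      rw [e]
      module
    rw [e2, smul_comm _ γ, inv_smul_smul₀ hx, inv_smul_smul₀ hγ.ne']
    abel
  have h2 : ∑ k ∈ Finset.range n, H (D k) =
      γ⁻¹ • ((stepProfile 0)⁻¹ • D 0 +
        (∑ k ∈ Finset.range n, ((stepProfile (k + 1))⁻¹ - (stepProfile k)⁻¹) • D (k + 1)
          - (stepProfile n)⁻¹ • D n)) + martingaleSum μ g γ θ₀ W n ω
        - ∑ k ∈ Finset.range n, linError μ g H θs γ θ₀ W k ω := by
    have hs := sum_smul_sub_succ (fun k => (stepProfile k)⁻¹) D n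
    beta_reduce at hs
    rw [← hs, martingaleSum, Finset.smul_sum, ← Finset.sum_add_distrib,
      ← Finset.sum_sub_distrib]
    exact Finset.sum_congr rfl fun k _ => h1 k
  have h3 : ∑ k ∈ Finset.range n, D k = A (∑ k ∈ Finset.range n, H (D k)) := by
    rw [map_sum]
    exact Finset.sum_congr rfl fun k _ => (h.left_inv _).symm
  have h4 : ∑ k ∈ Finset.range n, D (k + 1) = ∑ k ∈ Finset.range n, D k + D n - D 0 := by
    have := Finset.sum_range_succ' D n
    rw [Finset.sum_range_succ] at this
    rw [this]
    abel
  change ∑ k ∈ Finset.range n, D (k + 1) = _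
  rw [h4, h3, h2, abelTerm, restTerm]
  change _ = A (martingaleSum μ g γ θ₀ W n ω) + A (γ⁻¹ • (∑ k ∈ Finset.range n,
    ((stepProfile (k + 1))⁻¹ - (stepProfile k)⁻¹) • D (k + 1) - (stepProfile n)⁻¹ • D n))
    + ((A (γ⁻¹ • (stepProfile 0)⁻¹ • D 0) - D 0) + D n
      - A (∑ k ∈ Finset.range n, linError μ g H θs γ θ₀ W k ω))
  simp only [map_sub, map_add, smul_add]
  abel

theorem pastBounded_abelTerm (h : StochasticField μ g H A θs R c κ K) (n : ℕ) :
    PastBounded W n (abelTerm g A θs γ θ₀ W n) :=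
  (((PastBounded.sum fun k hk => ((h.pastBounded_error (k + 1)).mono
    (Finset.mem_range.1 hk)).const_smul _).sub
      ((h.pastBounded_error n).const_smul _)).const_smul _).clm A

theorem pastBounded_restTerm [IsProbabilityMeasure μ] (h : StochasticField μ g H A θs R c κ K)
    (n : ℕ) : PastBounded W n (restTerm μ g H A θs γ θ₀ W n) :=
  ((PastBounded.const _).add (h.pastBounded_error n)).sub
    ((PastBounded.sum fun k hk => (h.pastBounded_linError k).mono
      (Finset.mem_range.1 hk).le).clm A)

theorem norm_add_sq_le_two (x y : E) : ‖x + y‖ ^ 2 ≤ 2 * ‖x‖ ^ 2 + 2 * ‖y‖ ^ 2 := by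
  have h1 := norm_add_le x y
  have h2 : ‖x + y‖ ^ 2 ≤ (‖x‖ + ‖y‖) ^ 2 := pow_le_pow_left₀ (norm_nonneg _) h1 2
  nlinarith [sq_nonneg (‖x‖ - ‖y‖)]

/-- The increments of `1 / γ` are of order `k ^ (-1 / 4)` and the errors of order `k ^ (-3 / 8)` in
`L²`, so their sum is of order `n ^ (3 / 8)`. The boundary term contributes `γₙ⁻² γₙ`, of the same
order `n ^ (3 / 4)` after squaring. -/
theorem exists_integral_abelTerm_sq_le (h : StochasticField μ g H A θs R c κ K)
    (hW : IsSample P W μ) (hγ : 0 < γ) (θ₀ : E) :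
    ∃ C : ℝ, 0 < C ∧ ∀ n : ℕ, ∫ ω, ‖abelTerm g A θs γ θ₀ W n ω‖ ^ 2 ∂P ≤
      C * ((n : ℝ) + 1) ^ (3 / 4 : ℝ) := by
  obtain ⟨C, hC, hC'⟩ := h.exists_second_moment_le hW hγ θ₀
  set B := (‖A‖ * γ⁻¹) ^ 2 with hB
  refine ⟨B * (2 * (C * (1 / (3 / 8)) ^ 2) + 2 * C) + 1, by positivity, fun n => ?_⟩
  set f : ℕ → Ω → E := fun k ω => iterate g γ θ₀ W (k + 1) ω - θs with hf
  set b : ℕ → ℝ := fun k => (stepProfile (k + 1))⁻¹ - (stepProfile k)⁻¹ with hb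
  set s : ℕ → ℝ := fun k => ((k : ℝ) + 1) ^ (-(3 / 8) : ℝ) with hs
  have hfb : ∀ k < n, PastBounded W n (f k) := fun k hk => (h.pastBounded_error (k + 1)).mono hk
  have hb0 : ∀ k, 0 ≤ b k := fun k => sub_nonneg.2 (inv_stepProfile_mono k)
  have hs0 : ∀ k, 0 < s k := fun k => by simp only [hs]; positivity
  have h1 := integral_norm_sum_sq_le hW hfb hb0 hs0 (C := C) fun k _ => by
    refine (hC' (k + 1)).trans ?_
    simp only [hs]
    rw [← stepProfile_eq_sq]
    gcongr
    exact stepProfile_succ_le k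
  have h2 : ∑ k ∈ Finset.range n, b k * s k ≤ ((n : ℝ) + 1) ^ (3 / 8 : ℝ) * (1 / (3 / 8)) := by
    have hsum := sum_rpow_le (q := 3 / 8) (by norm_num) (by norm_num) n
    refine (Finset.sum_le_sum fun k _ => ?_).trans (hsum.trans ?_)
    · calc b k * s k ≤ ((k : ℝ) + 1) ^ (-(1 / 4) : ℝ) * s k :=
          mul_le_mul_of_nonneg_right (inv_stepProfile_succ_sub_le k) (hs0 k).le
        _ = _ := by
          simp only [hs]
          rw [← Real.rpow_add (by positivity)]
          norm_num
    · rw [div_eq_mul_one_div]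
      gcongr
      linarith
  have h3 : (((n : ℝ) + 1) ^ (3 / 8 : ℝ)) ^ 2 = ((n : ℝ) + 1) ^ (3 / 4 : ℝ) := by
    rw [← Real.rpow_natCast, ← Real.rpow_mul (by positivity)]
    norm_num
  have h_sum_nonneg : 0 ≤ ∑ k ∈ Finset.range n, b k * s k :=
    Finset.sum_nonneg fun k _ => mul_nonneg (hb0 k) (hs0 k).le
  have h4 : ∫ ω, ‖∑ k ∈ Finset.range n, b k • f k ω‖ ^ 2 ∂P ≤
      C * (1 / (3 / 8)) ^ 2 * ((n : ℝ) + 1) ^ (3 / 4 : ℝ) := by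
    refine h1.trans ?_
    calc C * (∑ k ∈ Finset.range n, b k * s k) ^ 2
        ≤ C * (((n : ℝ) + 1) ^ (3 / 8 : ℝ) * (1 / (3 / 8))) ^ 2 := by gcongr
      _ = _ := by rw [mul_pow, h3]; ring
  have hSb : PastBounded W n (fun ω => ∑ k ∈ Finset.range n, b k • f k ω) :=
    PastBounded.sum fun k hk => (hfb k (Finset.mem_range.1 hk)).const_smul _
  have hD := h.pastBounded_error (W := W) (γ := γ) (θ₀ := θ₀) n
  have i1 := ((hSb.norm.pow 2).integrable hW).const_mul (B * 2)
  have i2 := ((hD.norm.pow 2).integrable hW).const_mul (B * 2 * ((stepProfile n)⁻¹) ^ 2)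
  have hx := stepProfile_pos n
  calc ∫ ω, ‖abelTerm g A θs γ θ₀ W n ω‖ ^ 2 ∂P
      ≤ ∫ ω, (B * 2 * ‖∑ k ∈ Finset.range n, b k • f k ω‖ ^ 2
        + B * 2 * ((stepProfile n)⁻¹) ^ 2 * ‖iterate g γ θ₀ W n ω - θs‖ ^ 2) ∂P := by
        refine integral_mono (((h.pastBounded_abelTerm n).norm.pow 2).integrable hW)
          (i1.add i2) fun ω => ?_
        simp only [abelTerm]
        set u := ∑ k ∈ Finset.range n, b k • f k ω
        set v := iterate g γ θ₀ W n ω - θs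
        have q1 : ‖A (γ⁻¹ • (u - (stepProfile n)⁻¹ • v))‖ ≤
            (‖A‖ * γ⁻¹) * ‖u + -((stepProfile n)⁻¹ • v)‖ := by
          refine (A.le_opNorm _).trans_eq ?_
          rw [norm_smul, Real.norm_of_nonneg (inv_nonneg.2 hγ.le), mul_assoc, ← sub_eq_add_neg]
        have q2 := norm_add_sq_le_two u (-((stepProfile n)⁻¹ • v))
        rw [norm_neg, norm_smul, Real.norm_of_nonneg (inv_nonneg.2 hx.le), mul_pow] at q2
        calc ‖A (γ⁻¹ • (u - (stepProfile n)⁻¹ • v))‖ ^ 2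
            ≤ ((‖A‖ * γ⁻¹) * ‖u + -((stepProfile n)⁻¹ • v)‖) ^ 2 :=
              pow_le_pow_left₀ (norm_nonneg _) q1 2
          _ = B * ‖u + -((stepProfile n)⁻¹ • v)‖ ^ 2 := by rw [mul_pow]
          _ ≤ B * (2 * ‖u‖ ^ 2 + 2 * (((stepProfile n)⁻¹) ^ 2 * ‖v‖ ^ 2)) := by gcongr
          _ = _ := by ring
    _ = B * 2 * ∫ ω, ‖∑ k ∈ Finset.range n, b k • f k ω‖ ^ 2 ∂P
        + B * 2 * ((stepProfile n)⁻¹) ^ 2 * ∫ ω, ‖iterate g γ θ₀ W n ω - θs‖ ^ 2 ∂P := by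
        rw [integral_add i1 i2, integral_const_mul, integral_const_mul]
    _ ≤ B * 2 * (C * (1 / (3 / 8)) ^ 2 * ((n : ℝ) + 1) ^ (3 / 4 : ℝ))
        + B * 2 * ((stepProfile n)⁻¹) ^ 2 * (C * stepProfile n) := by
        gcongr
        exact hC' n
    _ = B * (2 * (C * (1 / (3 / 8)) ^ 2) + 2 * C) * ((n : ℝ) + 1) ^ (3 / 4 : ℝ) := by
        rw [← inv_stepProfile]
        field_simp
    _ ≤ _ := by
        have : 0 ≤ ((n : ℝ) + 1) ^ (3 / 4 : ℝ) := by positivity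
        linarith

/-- Each linearization error is of the order of the step in `L²`, so their sum is of order `n ^ (1 /
4)`; the other terms are bounded. -/
theorem exists_integral_restTerm_sq_le (h : StochasticField μ g H A θs R c κ K)
    (hW : IsSample P W μ) (hγ : 0 < γ) (θ₀ : E) :
    ∃ C : ℝ, 0 < C ∧ ∀ n : ℕ, ∫ ω, ‖restTerm μ g H A θs γ θ₀ W n ω‖ ^ 2 ∂P ≤
      C * ((n : ℝ) + 1) ^ (1 / 2 : ℝ) := by
  have := hW.isProbabilityMeasure
  obtain ⟨C, hC, hC'⟩ := h.exists_second_moment_le hW hγ θ₀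
  obtain ⟨C₄, hC₄, hC₄'⟩ := h.exists_integral_linError_sq_le hW hγ θ₀
  set z := A (γ⁻¹ • (stepProfile 0)⁻¹ • (θ₀ - θs)) - (θ₀ - θs) with hz
  refine ⟨4 * ‖z‖ ^ 2 + 4 * C + 2 * ‖A‖ ^ 2 * (C₄ * 4 ^ 2), by positivity, fun n => ?_⟩
  have h1 := integral_norm_sum_sq_le hW (f := linError μ g H θs γ θ₀ W) (b := fun _ => 1)
    (m := n) (n := n) (fun k hk => (h.pastBounded_linError k).mono hk.le)
    (fun _ => zero_le_one) stepProfile_pos fun k _ => hC₄' k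
  simp only [one_smul, one_mul] at h1
  have h2 : ∑ k ∈ Finset.range n, stepProfile k ≤ 4 * ((n : ℝ) + 1) ^ (1 / 4 : ℝ) := by
    have hsum := sum_rpow_le (q := 1 / 4) (by norm_num) (by norm_num) n
    have e : (1 / 4 - 1 : ℝ) = -(3 / 4) := by norm_num
    rw [e] at hsum
    refine hsum.trans ?_
    have : (n : ℝ) ^ (1 / 4 : ℝ) ≤ ((n : ℝ) + 1) ^ (1 / 4 : ℝ) :=
      Real.rpow_le_rpow (by positivity) (by linarith) (by norm_num)
    linarith
  have h3 : (((n : ℝ) + 1) ^ (1 / 4 : ℝ)) ^ 2 = ((n : ℝ) + 1) ^ (1 / 2 : ℝ) := by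
    rw [← Real.rpow_natCast, ← Real.rpow_mul (by positivity)]
    norm_num
  have h_sum_nonneg : 0 ≤ ∑ k ∈ Finset.range n, stepProfile k :=
    Finset.sum_nonneg fun k _ => (stepProfile_pos k).le
  have h4 : ∫ ω, ‖∑ k ∈ Finset.range n, linError μ g H θs γ θ₀ W k ω‖ ^ 2 ∂P ≤
      C₄ * 4 ^ 2 * ((n : ℝ) + 1) ^ (1 / 2 : ℝ) := by
    refine h1.trans ?_
    calc C₄ * (∑ k ∈ Finset.range n, stepProfile k) ^ 2
        ≤ C₄ * (4 * ((n : ℝ) + 1) ^ (1 / 4 : ℝ)) ^ 2 := by gcongr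
      _ = _ := by rw [mul_pow, h3]; ring
  have hSb : PastBounded W n (fun ω => ∑ k ∈ Finset.range n, linError μ g H θs γ θ₀ W k ω) :=
    PastBounded.sum fun k hk => (h.pastBounded_linError k).mono (Finset.mem_range.1 hk).le
  have hD := h.pastBounded_error (W := W) (γ := γ) (θ₀ := θ₀) n
  have i1 := ((hD.norm.pow 2).integrable hW).const_mul 4
  have i2 := ((hSb.norm.pow 2).integrable hW).const_mul (2 * ‖A‖ ^ 2)
  have i01 : Integrable (fun ω => 4 * ‖z‖ ^ 2 + 4 * ‖iterate g γ θ₀ W n ω - θs‖ ^ 2) P :=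
    (integrable_const _).add i1
  have hone : 1 ≤ ((n : ℝ) + 1) ^ (1 / 2 : ℝ) :=
    Real.one_le_rpow (by simp) (by norm_num)
  have hx1 := stepProfile_le_one n
  calc ∫ ω, ‖restTerm μ g H A θs γ θ₀ W n ω‖ ^ 2 ∂P
      ≤ ∫ ω, (4 * ‖z‖ ^ 2 + 4 * ‖iterate g γ θ₀ W n ω - θs‖ ^ 2 + 2 * ‖A‖ ^ 2 *
        ‖∑ k ∈ Finset.range n, linError μ g H θs γ θ₀ W k ω‖ ^ 2) ∂P := by
        refine integral_mono (((h.pastBounded_restTerm n).norm.pow 2).integrable hW)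
          (i01.add i2) fun ω => ?_
        simp only [restTerm]
        set u := ∑ k ∈ Finset.range n, linError μ g H θs γ θ₀ W k ω
        set v := iterate g γ θ₀ W n ω - θs
        have q1 := norm_add_sq_le_two (z + v) (-(A u))
        have q2 := norm_add_sq_le_two z v
        have q3 : ‖A u‖ ^ 2 ≤ ‖A‖ ^ 2 * ‖u‖ ^ 2 := by
          rw [← mul_pow]; exact pow_le_pow_left₀ (norm_nonneg _) (A.le_opNorm u) 2
        rw [norm_neg, ← sub_eq_add_neg] at q1
        linarith
    _ = 4 * ‖z‖ ^ 2 + 4 * ∫ ω, ‖iterate g γ θ₀ W n ω - θs‖ ^ 2 ∂P + 2 * ‖A‖ ^ 2 *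
        ∫ ω, ‖∑ k ∈ Finset.range n, linError μ g H θs γ θ₀ W k ω‖ ^ 2 ∂P := by
        rw [integral_add i01 i2, integral_add (integrable_const _) i1,
          integral_const_mul 4 fun ω => ‖iterate g γ θ₀ W n ω - θs‖ ^ 2,
          integral_const_mul (2 * ‖A‖ ^ 2)]
        simp
    _ ≤ 4 * ‖z‖ ^ 2 * ((n : ℝ) + 1) ^ (1 / 2 : ℝ) + 4 * (C * ((n : ℝ) + 1) ^ (1 / 2 : ℝ))
        + 2 * ‖A‖ ^ 2 * (C₄ * 4 ^ 2 * ((n : ℝ) + 1) ^ (1 / 2 : ℝ)) := by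
        have q := hC' n
        have q' : C * stepProfile n ≤ C * ((n : ℝ) + 1) ^ (1 / 2 : ℝ) := by
          gcongr
          linarith
        have q'' : 4 * ‖z‖ ^ 2 ≤ 4 * ‖z‖ ^ 2 * ((n : ℝ) + 1) ^ (1 / 2 : ℝ) :=
          le_mul_of_one_le_right (by positivity) hone
        gcongr
        linarith
    _ = _ := by ring

/-- Cauchy-Schwarz would lose a factor `n ^ (1 / 8)`. Here the correlations are bounded uniformly in
`k ≤ n` and the nonnegative increments of `1 / γ` telescope to at most `1 / γₙ`. -/
theorem exists_abs_integral_inner_abelTerm_le (h : StochasticField μ g H A θs R c κ K)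
    (hW : IsSample P W μ) (hγ : 0 < γ) (θ₀ : E) :
    ∃ C : ℝ, 0 < C ∧ ∀ n : ℕ, ∫ ω, inner ℝ (A (martingaleSum μ g γ θ₀ W n ω))
      (abelTerm g A θs γ θ₀ W n ω) ∂P ≤ C * ((n : ℝ) + 1) ^ (3 / 4 : ℝ) := by
  have := hW.isProbabilityMeasure
  obtain ⟨C, hC, hC'⟩ := h.exists_abs_integral_inner_le hW hγ θ₀ A
  refine ⟨γ⁻¹ * (2 * C), by positivity, fun n => ?_⟩
  have hM := (h.pastBounded_martingaleSum (W := W) (γ := γ) (θ₀ := θ₀) n).clm A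
  have hin : ∀ k ≤ n, Integrable (fun ω => inner ℝ (A (martingaleSum μ g γ θ₀ W n ω))
      (A (iterate g γ θ₀ W k ω - θs))) P := fun k hk =>
    (hM.inner (((h.pastBounded_error k).mono hk).clm A)).integrable hW
  have hx := stepProfile_pos n
  have e1 : ∀ ω, inner ℝ (A (martingaleSum μ g γ θ₀ W n ω)) (abelTerm g A θs γ θ₀ W n ω) =
      γ⁻¹ * (∑ k ∈ Finset.range n, ((stepProfile (k + 1))⁻¹ - (stepProfile k)⁻¹) *
        inner ℝ (A (martingaleSum μ g γ θ₀ W n ω)) (A (iterate g γ θ₀ W (k + 1) ω - θs))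
        - (stepProfile n)⁻¹ * inner ℝ (A (martingaleSum μ g γ θ₀ W n ω))
          (A (iterate g γ θ₀ W n ω - θs))) := fun ω => by
    rw [abelTerm, map_smul, inner_smul_right, map_sub, map_sum, inner_sub_right, inner_sum,
      map_smul, inner_smul_right]
    simp only [map_smul, inner_smul_right]
  simp_rw [e1]
  have j1 : ∀ k ∈ Finset.range n, Integrable (fun ω =>
      ((stepProfile (k + 1))⁻¹ - (stepProfile k)⁻¹) *
        inner ℝ (A (martingaleSum μ g γ θ₀ W n ω)) (A (iterate g γ θ₀ W (k + 1) ω - θs))) P :=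
    fun k hk => (hin (k + 1) (Finset.mem_range.1 hk)).const_mul _
  rw [integral_const_mul, integral_sub (integrable_finsetSum _ j1)
    ((hin n le_rfl).const_mul _), integral_finsetSum _ j1, integral_const_mul]
  simp_rw [integral_const_mul]
  rw [mul_assoc]
  gcongr
  have b1 : ∑ k ∈ Finset.range n, ((stepProfile (k + 1))⁻¹ - (stepProfile k)⁻¹) *
      ∫ ω, inner ℝ (A (martingaleSum μ g γ θ₀ W n ω)) (A (iterate g γ θ₀ W (k + 1) ω - θs)) ∂P
      ≤ C * (stepProfile n)⁻¹ := by
    calc _ ≤ ∑ k ∈ Finset.range n, ((stepProfile (k + 1))⁻¹ - (stepProfile k)⁻¹) * C := by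
          refine Finset.sum_le_sum fun k hk => ?_
          exact mul_le_mul_of_nonneg_left
            ((le_abs_self _).trans (hC' (k + 1) n (Finset.mem_range.1 hk)))
            (sub_nonneg.2 (inv_stepProfile_mono k))
      _ = C * ((stepProfile n)⁻¹ - (stepProfile 0)⁻¹) := by
          rw [← Finset.sum_mul, Finset.sum_range_sub (fun k => (stepProfile k)⁻¹), mul_comm]
      _ ≤ _ := by
          have := inv_pos.2 (stepProfile_pos 0)
          gcongr
          linarith
  have b2 : -((stepProfile n)⁻¹ * ∫ ω, inner ℝ (A (martingaleSum μ g γ θ₀ W n ω))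
      (A (iterate g γ θ₀ W n ω - θs)) ∂P) ≤ (stepProfile n)⁻¹ * C := by
    rw [← mul_neg]
    exact mul_le_mul_of_nonneg_left ((neg_le_abs _).trans (hC' n n le_rfl)) (inv_nonneg.2 hx.le)
  rw [← inv_stepProfile]
  linarith

/-- The optimal non-asymptotic bound for the averaged algorithm. -/
theorem exists_integral_sum_error_sq_le (h : StochasticField μ g H A θs R c κ K)
    (hW : IsSample P W μ) (hγ : 0 < γ) (θ₀ : E) :
    ∃ C : ℝ, 0 < C ∧ ∀ n : ℕ,
      ∫ ω, ‖∑ k ∈ Finset.range n, (iterate g γ θ₀ W (k + 1) ω - θs)‖ ^ 2 ∂P ≤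
        n * ∫ w, ‖A (g θs w)‖ ^ 2 ∂μ + C * ((n : ℝ) + 1) ^ (3 / 4 : ℝ) := by
  have := hW.isProbabilityMeasure
  obtain ⟨C₁, hC₁, h1⟩ := h.exists_integral_martingaleSum_le hW hγ θ₀ A
  obtain ⟨C₂, hC₂, h2⟩ := h.exists_integral_abelTerm_sq_le hW hγ θ₀
  obtain ⟨C₃, hC₃, h3⟩ := h.exists_integral_restTerm_sq_le hW hγ θ₀
  obtain ⟨C₄, hC₄, h4⟩ := h.exists_abs_integral_inner_abelTerm_le hW hγ θ₀
  set B := (‖A‖ * (2 * R)) ^ 2 with hB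
  refine ⟨C₁ + 2 * C₄ + B + C₃ + 2 * C₂ + 2 * C₃, by positivity, fun n => ?_⟩
  have hM := (h.pastBounded_martingaleSum (W := W) (γ := γ) (θ₀ := θ₀) n).clm A
  have hF := h.pastBounded_abelTerm (W := W) (γ := γ) (θ₀ := θ₀) n
  have hN := h.pastBounded_restTerm (W := W) (γ := γ) (θ₀ := θ₀) n
  have hp : (0 : ℝ) < (n : ℝ) + 1 := by positivity
  -- `τ` is the weight in Young's inequality between the martingale and `restTerm`: `τ n` and `τ⁻¹ n
  -- ^ (1 / 2)` are both of order `n ^ (3 / 4)`.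
  set τ := ((n : ℝ) + 1) ^ (-(1 / 4) : ℝ) with hτ
  have hτ0 : 0 < τ := by positivity
  set p := ((n : ℝ) + 1) ^ (3 / 4 : ℝ) with hp_def
  have hp0 : 0 < p := by positivity
  have e1 : τ * ((n : ℝ) + 1) = p := by
    rw [hτ, hp_def]
    nth_rewrite 2 [← Real.rpow_one ((n : ℝ) + 1)]
    rw [← Real.rpow_add hp]
    norm_num
  have e2 : ((n : ℝ) + 1) ^ (1 / 2 : ℝ) = τ * p := by
    rw [hτ, hp_def, ← Real.rpow_add hp]
    norm_num
  have hτ1 : τ ≤ 1 := Real.rpow_le_one_of_one_le_of_nonpos (by simp) (by norm_num)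
  have iM := (hM.norm.pow 2).integrable hW
  have iF := (hF.norm.pow 2).integrable hW
  have iN := (hN.norm.pow 2).integrable hW
  have iMF := (hM.inner hF).integrable hW
  have k1 : Integrable (fun ω => ‖A (martingaleSum μ g γ θ₀ W n ω)‖ ^ 2
      + 2 * inner ℝ (A (martingaleSum μ g γ θ₀ W n ω)) (abelTerm g A θs γ θ₀ W n ω)) P :=
    iM.add (iMF.const_mul 2)
  have k2 : Integrable (fun ω => ‖A (martingaleSum μ g γ θ₀ W n ω)‖ ^ 2
      + 2 * inner ℝ (A (martingaleSum μ g γ θ₀ W n ω)) (abelTerm g A θs γ θ₀ W n ω)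
      + τ * ‖A (martingaleSum μ g γ θ₀ W n ω)‖ ^ 2) P := k1.add (iM.const_mul τ)
  have k3 : Integrable (fun ω => ‖A (martingaleSum μ g γ θ₀ W n ω)‖ ^ 2
      + 2 * inner ℝ (A (martingaleSum μ g γ θ₀ W n ω)) (abelTerm g A θs γ θ₀ W n ω)
      + τ * ‖A (martingaleSum μ g γ θ₀ W n ω)‖ ^ 2 + 2 * ‖abelTerm g A θs γ θ₀ W n ω‖ ^ 2) P :=
    k2.add (iF.const_mul 2)
  have k4 := iN.const_mul (τ⁻¹ + 2)
  have hMM : ∫ ω, ‖A (martingaleSum μ g γ θ₀ W n ω)‖ ^ 2 ∂P ≤ ((n : ℝ) + 1) * B := by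
    refine (h.integral_norm_martingaleSum_sq_le hW A n).trans ?_
    gcongr
    linarith
  have h3n := h3 n
  rw [e2] at h3n
  calc ∫ ω, ‖∑ k ∈ Finset.range n, (iterate g γ θ₀ W (k + 1) ω - θs)‖ ^ 2 ∂P
      ≤ ∫ ω, (‖A (martingaleSum μ g γ θ₀ W n ω)‖ ^ 2
        + 2 * inner ℝ (A (martingaleSum μ g γ θ₀ W n ω)) (abelTerm g A θs γ θ₀ W n ω)
        + τ * ‖A (martingaleSum μ g γ θ₀ W n ω)‖ ^ 2 + 2 * ‖abelTerm g A θs γ θ₀ W n ω‖ ^ 2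
        + (τ⁻¹ + 2) * ‖restTerm μ g H A θs γ θ₀ W n ω‖ ^ 2) ∂P := by
        refine integral_mono_of_nonneg (Eventually.of_forall fun ω => sq_nonneg _) (k3.add k4)
          (Eventually.of_forall fun ω => ?_)
        simp only
        rw [h.sum_error_eq hγ]
        set u := A (martingaleSum μ g γ θ₀ W n ω)
        set v := abelTerm g A θs γ θ₀ W n ω
        set w := restTerm μ g H A θs γ θ₀ W n ω
        have q1 : ‖u + v + w‖ ^ 2 = ‖u‖ ^ 2 + 2 * inner ℝ u v + 2 * inner ℝ u w
            + ‖v + w‖ ^ 2 := by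
          rw [add_assoc, norm_add_sq_real, inner_add_right]
          ring
        have q2 := norm_add_sq_le_two v w
        have q3 := mul_le_weighted_sq ‖u‖ ‖w‖ hτ0
        have q4 := real_inner_le_norm u w
        have q5 : (τ⁻¹ + 2) * ‖w‖ ^ 2 = ‖w‖ ^ 2 / τ + 2 * ‖w‖ ^ 2 := by ring
        rw [q1, q5]
        linarith
    _ = ∫ ω, ‖A (martingaleSum μ g γ θ₀ W n ω)‖ ^ 2 ∂P
        + 2 * ∫ ω, inner ℝ (A (martingaleSum μ g γ θ₀ W n ω)) (abelTerm g A θs γ θ₀ W n ω) ∂P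
        + τ * ∫ ω, ‖A (martingaleSum μ g γ θ₀ W n ω)‖ ^ 2 ∂P
        + 2 * ∫ ω, ‖abelTerm g A θs γ θ₀ W n ω‖ ^ 2 ∂P
        + (τ⁻¹ + 2) * ∫ ω, ‖restTerm μ g H A θs γ θ₀ W n ω‖ ^ 2 ∂P := by
        rw [integral_add k3 k4, integral_add k2 (iF.const_mul 2), integral_add k1 (iM.const_mul τ),
          integral_add iM (iMF.const_mul 2)]
        simp only [integral_const_mul]
    _ ≤ (n * ∫ w, ‖A (g θs w)‖ ^ 2 ∂μ + C₁ * p) + 2 * (C₄ * p) + τ * (((n : ℝ) + 1) * B)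
        + 2 * (C₂ * p) + (τ⁻¹ + 2) * (C₃ * (τ * p)) := by
        gcongr
        · exact h1 n
        · exact h4 n
        · exact h2 n
    _ = n * ∫ w, ‖A (g θs w)‖ ^ 2 ∂μ + (C₁ + 2 * C₄ + B + C₃ + 2 * C₂) * p
        + 2 * C₃ * (τ * p) := by
        rw [← mul_assoc τ, e1]
        field_simp
        ring
    _ ≤ n * ∫ w, ‖A (g θs w)‖ ^ 2 ∂μ + (C₁ + 2 * C₄ + B + C₃ + 2 * C₂) * p
        + 2 * C₃ * (1 * p) := by gcongr
    _ = _ := by ring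

end StochasticField

end LogisticSGD
end

noncomputable section
namespace LogisticSGD

/-! ### The averaged stochastic gradient descent for the logistic risk -/

/-- The observations `(x, y)` with `‖x‖ ≤ R` and `y = ± 1`. -/
def admissible (d : ℕ) (R : ℝ) : Set (EuclideanSpace ℝ (Fin d) × ℝ) :=
  {w | ‖w.1‖ ≤ R ∧ (w.2 = 1 ∨ w.2 = -1)}

theorem measurableSet_admissible (d : ℕ) (R : ℝ) : MeasurableSet (admissible d R) := by
  have h1 : MeasurableSet {w : EuclideanSpace ℝ (Fin d) × ℝ | ‖w.1‖ ≤ R} :=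
    measurableSet_le measurable_fst.norm measurable_const
  have h2 : MeasurableSet {w : EuclideanSpace ℝ (Fin d) × ℝ | w.2 = 1 ∨ w.2 = -1} :=
    (measurable_snd (measurableSet_singleton (1 : ℝ))).union
      (measurable_snd (measurableSet_singleton (-1 : ℝ)))
  exact h1.inter h2

/-- The stochastic gradient, set to zero at the observations that are not admissible. -/
def stochasticGradient {d : ℕ} (R : ℝ) (θ : EuclideanSpace ℝ (Fin d))
    (w : EuclideanSpace ℝ (Fin d) × ℝ) : EuclideanSpace ℝ (Fin d) :=
  (admissible d R).indicator (fun _ => (1 : ℝ)) w • -descentDir θ w.1 w.2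

theorem stochasticGradient_of_mem {d : ℕ} {R : ℝ} (θ : EuclideanSpace ℝ (Fin d))
    {w : EuclideanSpace ℝ (Fin d) × ℝ} (hw : w ∈ admissible d R) :
    stochasticGradient R θ w = -descentDir θ w.1 w.2 := by
  rw [stochasticGradient, Set.indicator_of_mem hw, one_smul]

theorem stochasticGradient_of_notMem {d : ℕ} {R : ℝ} (θ : EuclideanSpace ℝ (Fin d))
    {w : EuclideanSpace ℝ (Fin d) × ℝ} (hw : w ∉ admissible d R) :
    stochasticGradient R θ w = 0 := by
  rw [stochasticGradient, Set.indicator_of_notMem hw, zero_smul]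

theorem measurable_stochasticGradient {d : ℕ} (R : ℝ) :
    Measurable (Function.uncurry (stochasticGradient (d := d) R)) := by
  have h1 : Measurable fun p : EuclideanSpace ℝ (Fin d) × (EuclideanSpace ℝ (Fin d) × ℝ) =>
      (admissible d R).indicator (fun _ => (1 : ℝ)) p.2 :=
    (measurable_const.indicator (measurableSet_admissible d R)).comp measurable_snd
  have h2 : Measurable fun p : EuclideanSpace ℝ (Fin d) × (EuclideanSpace ℝ (Fin d) × ℝ) =>
      -descentDir p.1 p.2.1 p.2.2 := by
    have hx : Continuous fun p : EuclideanSpace ℝ (Fin d) × (EuclideanSpace ℝ (Fin d) × ℝ) =>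
        p.2.1 := by fun_prop
    have hy : Continuous fun p : EuclideanSpace ℝ (Fin d) × (EuclideanSpace ℝ (Fin d) × ℝ) =>
        p.2.2 := by fun_prop
    have he : Continuous fun p : EuclideanSpace ℝ (Fin d) × (EuclideanSpace ℝ (Fin d) × ℝ) =>
        1 + Real.exp (p.2.2 * inner ℝ p.1 p.2.1) := by fun_prop
    exact ((hy.div he fun p => by positivity).smul hx).neg.measurable
  exact h1.smul h2

theorem norm_smul_le_of_mem_admissible {d : ℕ} {R : ℝ} {w : EuclideanSpace ℝ (Fin d) × ℝ}
    (hw : w ∈ admissible d R) : ‖w.2 • w.1‖ ≤ R := by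
  rcases hw.2 with h | h <;> simpa [norm_smul, h] using hw.1

/-- Setting the gradient to zero off the admissible set makes this bound hold at every observation,
not just almost surely, as `StochasticField` requires. -/
theorem norm_stochasticGradient_le {d : ℕ} {R : ℝ} (hR : 0 ≤ R) (θ : EuclideanSpace ℝ (Fin d))
    (w : EuclideanSpace ℝ (Fin d) × ℝ) : ‖stochasticGradient R θ w‖ ≤ R := by
  by_cases hw : w ∈ admissible d R
  · rw [stochasticGradient_of_mem θ hw, neg_descentDir_eq, norm_smul]
    have h1 := abs_sigmoid_sub_one_le (inner ℝ (w.2 • w.1) θ)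
    have h2 := norm_smul_le_of_mem_admissible hw
    rw [← Real.norm_eq_abs] at h1
    calc _ ≤ 1 * R := mul_le_mul h1 h2 (norm_nonneg _) zero_le_one
      _ = R := one_mul R
  · rw [stochasticGradient_of_notMem θ hw, norm_zero]
    exact hR

theorem norm_stochasticGradient_sub_le {d : ℕ} {R : ℝ} (θ θ' : EuclideanSpace ℝ (Fin d))
    (w : EuclideanSpace ℝ (Fin d) × ℝ) :
    ‖stochasticGradient R θ w - stochasticGradient R θ' w‖ ≤ R ^ 2 * ‖θ - θ'‖ := by
  by_cases hw : w ∈ admissible d R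
  · rw [stochasticGradient_of_mem θ hw, stochasticGradient_of_mem θ' hw, neg_descentDir_eq,
      neg_descentDir_eq, ← sub_smul, norm_smul, sub_sub_sub_cancel_right, Real.norm_eq_abs]
    have h1 := abs_sigmoid_sub_le (inner ℝ (w.2 • w.1) θ) (inner ℝ (w.2 • w.1) θ')
    have h2 := norm_smul_le_of_mem_admissible hw
    rw [← inner_sub_right] at h1
    have h3 := h1.trans (abs_real_inner_le_norm _ _)
    have hR : 0 ≤ R := (norm_nonneg _).trans h2
    calc _ ≤ ‖w.2 • w.1‖ * ‖θ - θ'‖ * ‖w.2 • w.1‖ := by gcongr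
      _ ≤ R * ‖θ - θ'‖ * R := by gcongr
      _ = _ := by ring
  · rw [stochasticGradient_of_notMem θ hw, stochasticGradient_of_notMem θ' hw, sub_zero, norm_zero]
    positivity

theorem average_sub_eq {d : ℕ} (θ : ℕ → EuclideanSpace ℝ (Fin d)) (θs : EuclideanSpace ℝ (Fin d))
    {n : ℕ} (hn : 1 ≤ n) :
    average θ n - θs = (1 / (n : ℝ)) • ∑ k ∈ Finset.range n, (θ (k + 1) - θs) := by
  have hn' : (n : ℝ) ≠ 0 := by positivity
  have h1 : ∑ k ∈ Finset.Icc 1 n, θ k = ∑ k ∈ Finset.range n, θ (k + 1) := by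
    rw [Finset.range_eq_Ico, Finset.sum_Ico_add' θ 0 n 1]
    rfl
  rw [average, h1, Finset.sum_sub_distrib, smul_sub, Finset.sum_const, Finset.card_range,
    ← Nat.cast_smul_eq_nsmul ℝ, smul_smul, one_div_mul_cancel hn', one_smul]

namespace BoundedLogistic

variable {d : ℕ} {Ω : Type*} [MeasurableSpace Ω] {P : Measure Ω} [IsProbabilityMeasure P]
  {X : Ω → EuclideanSpace ℝ (Fin d)} {Y : Ω → ℝ} {θs : EuclideanSpace ℝ (Fin d)} {R : ℝ}

omit [IsProbabilityMeasure P] in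
theorem ae_mem_admissible (h : BoundedLogistic P X Y θs R) :
    ∀ᵐ ω ∂P, (X ω, Y ω) ∈ admissible d R := by
  filter_upwards [h.norm_le, h.model.values] with ω h1 h2
  exact ⟨h1, h2⟩

theorem integral_stochasticGradient (h : BoundedLogistic P X Y θs R)
    (θ : EuclideanSpace ℝ (Fin d)) :
    ∫ w, stochasticGradient R θ w ∂(P.map fun ω => (X ω, Y ω)) =
      gradient (logisticRisk P X Y) θ := by
  have hm : Measurable fun w => stochasticGradient R θ w :=
    (measurable_stochasticGradient R).of_uncurry_left
  have hmap := integral_map (h.measurable_X.prodMk h.measurable_Y).aemeasurable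
    (μ := P) hm.aestronglyMeasurable
  refine hmap.trans ?_
  refine Eq.trans (integral_congr_ae ?_) (h.gradient_risk_eq θ).symm
  filter_upwards [h.ae_mem_admissible] with ω hω
  exact stochasticGradient_of_mem θ hω

theorem fderiv_fderiv_risk_symm (h : BoundedLogistic P X Y θs R)
    (θ v w : EuclideanSpace ℝ (Fin d)) :
    fderiv ℝ (fderiv ℝ (logisticRisk P X Y)) θ v w =
      fderiv ℝ (fderiv ℝ (logisticRisk P X Y)) θ w v := by
  rw [h.fderiv_fderiv_risk_apply, h.fderiv_fderiv_risk_apply]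
  congr 1
  ext ω
  ring

/-- Mean value inequality on the ball of radius `‖θ - θs‖`: there the second derivative is within `R
^ 3 * ‖θ - θs‖` of its value at `θs`, and the first derivative vanishes at `θs`. -/
theorem norm_gradient_sub_hessian_le (h : BoundedLogistic P X Y θs R)
    (θ : EuclideanSpace ℝ (Fin d)) :
    ‖gradient (logisticRisk P X Y) θ -
      Matrix.toEuclideanCLM (𝕜 := ℝ) (hessian (logisticRisk P X Y) θs) (θ - θs)‖ ≤
      R ^ 3 * ‖θ - θs‖ ^ 2 := by
  have hR := h.nonneg_R
  have hlip := h.lipschitzWith_fderiv_fderiv_risk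
  have h1 := (convex_closedBall θs ‖θ - θs‖).norm_image_sub_le_of_norm_hasFDerivWithin_le'
    (f := fderiv ℝ (logisticRisk P X Y)) (f' := fderiv ℝ (fderiv ℝ (logisticRisk P X Y)))
    (φ := fderiv ℝ (fderiv ℝ (logisticRisk P X Y)) θs) (C := R ^ 3 * ‖θ - θs‖) (x := θs) (y := θ)
    (fun x _ => (h.hasFDerivAt_fderiv_risk x).differentiableAt.hasFDerivAt.hasFDerivWithinAt)
    (fun x hx => by
      have := hlip.dist_le_mul x θs
      rw [dist_eq_norm, Real.coe_toNNReal _ (pow_nonneg hR 3)] at this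
      refine this.trans ?_
      gcongr
      exact Metric.mem_closedBall.1 hx)
    (Metric.mem_closedBall_self (norm_nonneg _)) (by simp [dist_eq_norm])
  have h2 : fderiv ℝ (logisticRisk P X Y) θs = 0 := by
    have := h.gradient_risk_self
    rwa [gradient, LinearIsometryEquiv.map_eq_zero_iff] at this
  rw [h2, sub_zero] at h1
  have h3 : gradient (logisticRisk P X Y) θ -
      Matrix.toEuclideanCLM (𝕜 := ℝ) (hessian (logisticRisk P X Y) θs) (θ - θs) =
      (InnerProductSpace.toDual ℝ _).symm (fderiv ℝ (logisticRisk P X Y) θ -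
        fderiv ℝ (fderiv ℝ (logisticRisk P X Y)) θs (θ - θs)) := by
    have e : Matrix.toEuclideanCLM (𝕜 := ℝ) (hessian (logisticRisk P X Y) θs) (θ - θs) =
        (InnerProductSpace.toDual ℝ _).symm
          (fderiv ℝ (fderiv ℝ (logisticRisk P X Y)) θs (θ - θs)) := by
      refine ext_inner_right ℝ fun v => ?_
      rw [InnerProductSpace.toDual_symm_apply, real_inner_comm, h.fderiv_fderiv_risk_symm]
      exact inner_hessian_mulVec (logisticRisk P X Y) θs (θ - θs) v
    rw [e, LinearIsometryEquiv.map_sub, gradient]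
  rw [h3, LinearIsometryEquiv.norm_map]
  refine h1.trans_eq ?_
  ring

theorem exists_stochasticField (h : BoundedLogistic P X Y θs R) (hR : 0 < R) :
    ∃ c κ : ℝ, StochasticField (P.map fun ω => (X ω, Y ω)) (stochasticGradient R)
      (Matrix.toEuclideanCLM (𝕜 := ℝ) (hessian (logisticRisk P X Y) θs))
      (Matrix.toEuclideanCLM (𝕜 := ℝ) (hessian (logisticRisk P X Y) θs)⁻¹)
      θs R c κ (R ^ 2 + R ^ 3) := by
  obtain ⟨c, hc, hc'⟩ := h.exists_drift
  obtain ⟨κ, hκ, hκ'⟩ := h.exists_hessian_coercive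
  -- The factor `1 / (1 + R)` comes from `1 + R t ≤ (1 + R) √(1 + t²)`. In the constant `R ^ 2 + R ^
  -- 3`, the first term bounds the Lipschitz constant of the field and the second the linearization
  -- error.
  refine ⟨c / (1 + R), κ, ?_⟩
  constructor
  · exact measurable_stochasticGradient R
  · exact hR
  · exact norm_stochasticGradient_le hR.le
  · positivity
  · intro θ
    rw [h.integral_stochasticGradient]
    have h1 := hc' (θ - θs)
    rw [add_sub_cancel, real_inner_comm] at h1
    refine le_trans ?_ h1
    have hs1 : 1 ≤ √(1 + ‖θ - θs‖ ^ 2) := Real.one_le_sqrt.2 (by nlinarith [sq_nonneg ‖θ - θs‖])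
    have hs2 : ‖θ - θs‖ ≤ √(1 + ‖θ - θs‖ ^ 2) := Real.le_sqrt_of_sq_le (by linarith)
    set s := √(1 + ‖θ - θs‖ ^ 2)
    set t := ‖θ - θs‖
    have ht : 0 ≤ t := norm_nonneg _
    calc c / (1 + R) * (t ^ 2 / s) = c * (t ^ 2 / ((1 + R) * s)) := by field_simp
      _ ≤ c * (t ^ 2 / (1 + R * t)) := by
        gcongr
        nlinarith
  · exact hκ
  · intro v
    refine (hκ' v).trans_eq ?_
    exact (inner_hessian_mulVec (logisticRisk P X Y) θs v v).symm
  · positivity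
  · intro θ
    rw [h.integral_stochasticGradient]
    refine (h.norm_gradient_sub_hessian_le θ).trans ?_
    gcongr
    nlinarith [sq_nonneg R]
  · intro θ w
    refine (norm_stochasticGradient_sub_le θ θs w).trans ?_
    gcongr
    have : 0 ≤ R ^ 3 := by positivity
    linarith
  · intro v
    have hu := (Matrix.isUnit_iff_isUnit_det _).1 h.isUnit_hessian
    rw [← mul_apply_eq_comp, ← map_mul, Matrix.nonsing_inv_mul _ hu, map_one,
      one_apply_eq_self]

/-- For symmetric `B`, `Tr (B S B) = 𝔼 ‖B ΔM‖²`. At `θs` the gradient vanishes, so `ΔM` is minus the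
stochastic gradient. -/
theorem trace_limitCov_eq (h : BoundedLogistic P X Y θs R) (hR : 0 < R) :
    (limitCov P X Y θs).trace =
      ∫ w, ‖Matrix.toEuclideanCLM (𝕜 := ℝ) (hessian (logisticRisk P X Y) θs)⁻¹
        (stochasticGradient R θs w)‖ ^ 2 ∂(P.map fun ω => (X ω, Y ω)) := by
  set B := (hessian (logisticRisk P X Y) θs)⁻¹ with hB
  have hBT : ∀ i j, B i j = B j i := fun i j => by
    have h1 : (hessian (logisticRisk P X Y) θs).transpose = hessian (logisticRisk P X Y) θs := by
      ext i j
      exact h.fderiv_fderiv_risk_symm θs _ _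
    have h2 : B.transpose = B := by rw [hB, Matrix.transpose_nonsing_inv, h1]
    exact (congrFun (congrFun h2 j) i)
  set V : Ω → EuclideanSpace ℝ (Fin d) := fun ω => noise (logisticRisk P X Y) θs (X ω) (Y ω)
    with hV
  have hVeq : ∀ ω, V ω = descentDir θs (X ω) (Y ω) := fun ω => by
    simp only [hV, noise, h.gradient_risk_self, zero_add]
  have hVm : AEStronglyMeasurable V P := by
    have h1 : ∀ᵐ ω ∂P, -stochasticGradient R θs (X ω, Y ω) = V ω := by
      filter_upwards [h.ae_mem_admissible] with ω hω
      rw [stochasticGradient_of_mem θs hω, neg_neg, hVeq]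
    have h2 : Measurable fun ω => -stochasticGradient R θs (X ω, Y ω) :=
      (((measurable_stochasticGradient R).comp measurable_prodMk_left).comp
        (h.measurable_X.prodMk h.measurable_Y)).neg
    exact h2.aestronglyMeasurable.congr h1
  have hVR : ∀ᵐ ω ∂P, ‖V ω‖ ≤ R := by
    filter_upwards [h.ae_mem_admissible] with ω hω
    have := norm_stochasticGradient_le hR.le θs (X ω, Y ω)
    rwa [stochasticGradient_of_mem θs hω, norm_neg, ← hVeq] at this
  have hcoord : ∀ i, AEStronglyMeasurable (fun ω => V ω i) P := fun i => by
    have : Continuous fun v : EuclideanSpace ℝ (Fin d) => v i := by fun_prop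
    exact this.comp_aestronglyMeasurable hVm
  have hint : ∀ i j, Integrable (fun ω => V ω i * V ω j) P := fun i j => by
    refine Integrable.of_bound ((hcoord i).mul (hcoord j)) (R * R) ?_
    filter_upwards [hVR] with ω hω
    rw [norm_mul]
    exact mul_le_mul ((PiLp.norm_apply_le _ _).trans hω) ((PiLp.norm_apply_le _ _).trans hω)
      (norm_nonneg _) hR.le
  have hgm : Measurable fun w => ‖Matrix.toEuclideanCLM (𝕜 := ℝ) B
      (stochasticGradient R θs w)‖ ^ 2 :=
    (((Matrix.toEuclideanCLM (𝕜 := ℝ) B).measurable.comp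
      ((measurable_stochasticGradient R).comp measurable_prodMk_left)).norm).pow_const 2
  rw [integral_map (h.measurable_X.prodMk h.measurable_Y).aemeasurable hgm.aestronglyMeasurable]
  have e1 : ∫ ω, ‖Matrix.toEuclideanCLM (𝕜 := ℝ) B (stochasticGradient R θs (X ω, Y ω))‖ ^ 2 ∂P =
      ∫ ω, ∑ i, ∑ j, ∑ k, B i j * B i k * (V ω j * V ω k) ∂P := by
    refine integral_congr_ae ?_
    filter_upwards [h.ae_mem_admissible] with ω hω
    rw [stochasticGradient_of_mem θs hω, map_neg, norm_neg, ← hVeq, EuclideanSpace.real_norm_sq_eq]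
    refine Finset.sum_congr rfl fun i _ => ?_
    rw [Matrix.ofLp_toEuclideanCLM, Matrix.mulVec, dotProduct, sq, Finset.sum_mul_sum]
    refine Finset.sum_congr rfl fun j _ => Finset.sum_congr rfl fun k _ => ?_
    ring
  rw [e1, integral_finsetSum _ fun i _ => integrable_finsetSum _ fun j _ =>
    integrable_finsetSum _ fun k _ => (hint j k).const_mul _]
  rw [Matrix.trace]
  refine Finset.sum_congr rfl fun i _ => ?_
  rw [integral_finsetSum _ fun j _ => integrable_finsetSum _ fun k _ => (hint j k).const_mul _]
  simp only [limitCov, Matrix.diag_apply, Matrix.mul_apply, ← hB, Finset.sum_mul]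
  rw [Finset.sum_comm]
  refine Finset.sum_congr rfl fun j _ => ?_
  rw [integral_finsetSum _ fun k _ => (hint j k).const_mul _]
  refine Finset.sum_congr rfl fun k _ => ?_
  rw [integral_const_mul, hBT k i, noiseCov, Matrix.of_apply]
  ring

theorem exists_average_bound (h : BoundedLogistic P X Y θs R) (hR : 0 < R) {Ω' : Type*}
    [MeasurableSpace Ω'] {P' : Measure Ω'} [IsProbabilityMeasure P']
    {Xs : ℕ → Ω' → EuclideanSpace ℝ (Fin d)} {Ys : ℕ → Ω' → ℝ}
    (hind : iIndepFun (fun n ω => (Xs n ω, Ys n ω)) P')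
    (hid : ∀ n, IdentDistrib (fun ω => (Xs n ω, Ys n ω)) (fun ω => (X ω, Y ω)) P' P)
    {γ : ℝ} (hγ : 0 < γ) (θ₀ : EuclideanSpace ℝ (Fin d)) :
    ∃ C : ℝ, 0 < C ∧ ∀ n : ℕ, 1 ≤ n →
      Integrable (fun ω => ‖average (sgd (fun k => γ * (k : ℝ) ^ (-(3 / 4) : ℝ)) θ₀
        (fun k => Xs k ω) (fun k => Ys k ω)) n - θs‖ ^ 2) P' ∧
      ∫ ω, ‖average (sgd (fun k => γ * (k : ℝ) ^ (-(3 / 4) : ℝ)) θ₀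
        (fun k => Xs k ω) (fun k => Ys k ω)) n - θs‖ ^ 2 ∂P'
        ≤ (limitCov P X Y θs).trace / n + C * (n : ℝ) ^ (-(5 / 4) : ℝ) := by
  obtain ⟨c, κ, hS⟩ := h.exists_stochasticField hR
  have hae := fun n => (hid n).aemeasurable_fst
  -- Equality in law only makes the observations almost everywhere measurable, so they are replaced
  -- by measurable versions. Off one null set all observations are admissible and both recursions
  -- follow the same path.
  set W : ℕ → Ω' → EuclideanSpace ℝ (Fin d) × ℝ := fun n => (hae n).mk _ with hW_def
  have hWeq : ∀ n, (fun ω => (Xs n ω, Ys n ω)) =ᵐ[P'] W n := fun n => (hae n).ae_eq_mk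
  have hW : IsSample P' W (P.map fun ω => (X ω, Y ω)) := by
    refine ⟨fun n => (hae n).measurable_mk, hind.congr hWeq, fun n => ?_⟩
    rw [← Measure.map_congr (hWeq n), (hid n).map_eq]
  have hpath : ∀ᵐ ω ∂P', ∀ n, sgd (fun k => γ * (k : ℝ) ^ (-(3 / 4) : ℝ)) θ₀
      (fun k => Xs k ω) (fun k => Ys k ω) n = iterate (stochasticGradient R) γ θ₀ W n ω := by
    have h1 : ∀ᵐ ω ∂P', ∀ n, (Xs n ω, Ys n ω) ∈ admissible d R := ae_all_iff.2 fun n =>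
      (hid n).symm.ae_snd (p := fun w => w ∈ admissible d R) (measurableSet_admissible d R)
        h.ae_mem_admissible
    filter_upwards [h1, ae_all_iff.2 hWeq] with ω hadm heq n
    induction n with
    | zero => rfl
    | succ n ih =>
      have hn : W n ω = (Xs n ω, Ys n ω) := (heq n).symm
      rw [sgd, iterate, ih]
      beta_reduce
      rw [hn, stochasticGradient_of_mem _ (hadm n), smul_neg, sub_neg_eq_add, stepProfile]
      push_cast
      rfl
  have hpt : ∀ n : ℕ, 1 ≤ n → (fun ω => ‖average (sgd (fun k => γ * (k : ℝ) ^ (-(3 / 4) : ℝ)) θ₀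
      (fun k => Xs k ω) (fun k => Ys k ω)) n - θs‖ ^ 2) =ᵐ[P'] fun ω => (1 / (n : ℝ)) ^ 2 *
      ‖∑ k ∈ Finset.range n, (iterate (stochasticGradient R) γ θ₀ W (k + 1) ω - θs)‖ ^ 2 := by
    intro n hn
    filter_upwards [hpath] with ω hω
    rw [average_sub_eq _ _ hn, norm_smul, mul_pow, Real.norm_of_nonneg (by positivity)]
    simp only [hω]
  obtain ⟨C, hC, hC'⟩ := hS.exists_integral_sum_error_sq_le hW hγ θ₀
  -- The factor 2 replaces `(n + 1) ^ (3 / 4)` by `n ^ (3 / 4)`, which is possible for `n ≥ 1`.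
  refine ⟨2 * C, by positivity, fun n hn => ⟨?_, ?_⟩⟩
  · refine Integrable.congr ?_ (hpt n hn).symm
    have hb : PastBounded W n (fun ω => ∑ k ∈ Finset.range n,
        (iterate (stochasticGradient R) γ θ₀ W (k + 1) ω - θs)) :=
      PastBounded.sum fun k hk => (hS.pastBounded_error (k + 1)).mono (Finset.mem_range.1 hk)
    exact ((hb.norm.pow 2).integrable hW).const_mul _
  · rw [integral_congr_ae (hpt n hn), integral_const_mul, h.trace_limitCov_eq hR]
    have hn0 : (0 : ℝ) < n := by positivity
    have h1n : (1 : ℝ) ≤ n := by exact_mod_cast hn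
    have hpow : ((n : ℝ) + 1) ^ (3 / 4 : ℝ) ≤ 2 * (n : ℝ) ^ (3 / 4 : ℝ) := by
      calc ((n : ℝ) + 1) ^ (3 / 4 : ℝ) ≤ (2 * (n : ℝ)) ^ (3 / 4 : ℝ) :=
            Real.rpow_le_rpow (by positivity) (by linarith) (by norm_num)
        _ = 2 ^ (3 / 4 : ℝ) * (n : ℝ) ^ (3 / 4 : ℝ) := Real.mul_rpow (by norm_num) hn0.le
        _ ≤ 2 ^ (1 : ℝ) * (n : ℝ) ^ (3 / 4 : ℝ) := by
            gcongr
            · norm_num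
            · norm_num
        _ = _ := by rw [Real.rpow_one]
    have hexp : (1 / (n : ℝ)) ^ 2 * (n : ℝ) ^ (3 / 4 : ℝ) = (n : ℝ) ^ (-(5 / 4) : ℝ) := by
      have e : (1 / (n : ℝ)) ^ 2 = (n : ℝ) ^ (-2 : ℝ) := by
        rw [Real.rpow_neg hn0.le, one_div, inv_pow, ← Real.rpow_natCast]
        norm_num
      rw [e, ← Real.rpow_add hn0]
      norm_num
    refine (mul_le_mul_of_nonneg_left (hC' n) (by positivity)).trans ?_
    set T := ∫ w, ‖Matrix.toEuclideanCLM (𝕜 := ℝ) (hessian (logisticRisk P X Y) θs)⁻¹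
        (stochasticGradient R θs w)‖ ^ 2 ∂(P.map fun ω => (X ω, Y ω))
    calc (1 / (n : ℝ)) ^ 2 * (n * T + C * ((n : ℝ) + 1) ^ (3 / 4 : ℝ))
        ≤ (1 / (n : ℝ)) ^ 2 * (n * T + C * (2 * (n : ℝ) ^ (3 / 4 : ℝ))) := by gcongr
      _ = T / n + 2 * C * ((1 / (n : ℝ)) ^ 2 * (n : ℝ) ^ (3 / 4 : ℝ)) := by
        field_simp
      _ = _ := by rw [hexp]

end BoundedLogistic

end LogisticSGD
end

theorem proposition1p3 {d : ℕ} {Ω : Type*} [MeasurableSpace Ω] (P : Measure Ω)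
    [IsProbabilityMeasure P] (X : Ω → EuclideanSpace ℝ (Fin d)) (Y : Ω → ℝ)
    (hX : Measurable X) (hY : Measurable Y) (θs : EuclideanSpace ℝ (Fin d))
    (R : ℝ) (_hR : 0 < R) (hsupp : ∀ᵐ ω ∂P, ‖X ω‖ ≤ R)
    (hell : ∀ e : EuclideanSpace ℝ (Fin d), ‖e‖ = 1 →
      0 < variance (fun ω => inner ℝ (X ω) e) P)
    (hlog : LogisticSGD.IsLogisticModel P X Y θs) :
    (ConvexOn ℝ Set.univ (LogisticSGD.logisticRisk P X Y) ∧
      (∃ B : ℝ, ∀ θ, ‖fderiv ℝ (fderiv ℝ (LogisticSGD.logisticRisk P X Y)) θ‖ ≤ B) ∧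
      (∃ K : NNReal, LipschitzWith K (fderiv ℝ (fderiv ℝ (LogisticSGD.logisticRisk P X Y)))) ∧
      IsUnit (LogisticSGD.hessian (LogisticSGD.logisticRisk P X Y) θs) ∧
      Tendsto (LogisticSGD.logisticRisk P X Y)
        (Bornology.cobounded (EuclideanSpace ℝ (Fin d))) atTop ∧
      {θ | gradient (LogisticSGD.logisticRisk P X Y) θ = 0} = {θs} ∧
      LogisticSGD.GlobalKL 0 (LogisticSGD.logisticRisk P X Y) θs) ∧
    (∀ {Ω' : Type*} [MeasurableSpace Ω'] (P' : Measure Ω') [IsProbabilityMeasure P']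
      (Xs : ℕ → Ω' → EuclideanSpace ℝ (Fin d)) (Ys : ℕ → Ω' → ℝ),
      iIndepFun (fun n ω => (Xs n ω, Ys n ω)) P' →
      (∀ n, IdentDistrib (fun ω => (Xs n ω, Ys n ω)) (fun ω => (X ω, Y ω)) P' P) →
      ∀ γ : ℝ, 0 < γ → ∀ θ₀ : EuclideanSpace ℝ (Fin d),
      ∃ C : ℝ, 0 < C ∧ ∀ n : ℕ, 1 ≤ n →
        Integrable (fun ω => ‖LogisticSGD.average
          (LogisticSGD.sgd (fun k => γ * (k : ℝ) ^ (-(3 / 4) : ℝ)) θ₀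
            (fun k => Xs k ω) (fun k => Ys k ω)) n - θs‖ ^ 2) P' ∧
        ∫ ω, ‖LogisticSGD.average
          (LogisticSGD.sgd (fun k => γ * (k : ℝ) ^ (-(3 / 4) : ℝ)) θ₀
            (fun k => Xs k ω) (fun k => Ys k ω)) n - θs‖ ^ 2 ∂P'
          ≤ (LogisticSGD.limitCov P X Y θs).trace / n + C * (n : ℝ) ^ (-(5 / 4) : ℝ)) := by
  have h : LogisticSGD.BoundedLogistic P X Y θs R := ⟨hX, hY, hsupp, hell, hlog⟩
  refine ⟨⟨h.convexOn_risk, ⟨_, h.norm_fderiv_fderiv_risk_le⟩,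
    ⟨_, h.lipschitzWith_fderiv_fderiv_risk⟩, h.isUnit_hessian, h.tendsto_risk,
    h.gradient_risk_zeros, h.globalKL⟩, ?_⟩
  intro Ω' _ P' _ Xs Ys hind hid γ hγ θ₀
  exact h.exists_average_bound _hR hind hid hγ θ₀
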